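/- Let $\beta,d,\lambda,\rho>0$, $\alpha\ge 0$, let $(e_i)_{i\in\mathbb N}\subset[0,\infty)$ be edge weights, and let $n(L)\in\mathbb N$ be the number of surface defects for a wire of length $L>0$. *Bulk.* Let $\Omega_L=\{(x,y)\in[0,L]^2: |x-y|\le d\}$ and let $H_p^L$ be the Dirichlet Laplacian $-\partial_x^2-\partial_y^2$ on the space of antisymmetric functions in $L^2(\Omega_L)$ (the self-adjoint operator of the form $\int_{\Omega_L}|\nabla\varphi|^2$ on the antisymmetric functions in $H^1_0(\Omega_L)$), with eigenvalues $E_0(L)\le E_1(L)\le\dots$ counted with multiplicity and eigenfunctions $\varphi_n$. Put $E_0:=2\pi^2/d^2$. *Surface.* Let $\lambda_1(L),\dots,\lambda_{n(L)}(L)\ge 0$ be the eigenvalues, with multiplicity, of the non-negative weighted graph Laplacian $(\mathcal L f)(i)=\sum_j\gamma_{ij}(f(i)-f(j))$ of the path graph on $n(L)$ vertices, where the edge joining consecutive vertices $i,i+1$ has weight $e_i$. *Thermodynamic limit.* Let $L_k>0$, $L_k\to\infty$, with $L_k/n(L_k)$ bounded from above, and let $\mu_k\in\mathbb R$ (chemical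 potentials) and $\rho_{s,k}\ge 0$ (surface pair densities) satisfy, for all $k$, $$\mu_k<\min\{\lambda\rho_{s,k}-\alpha,\;E_0(L_k)\},\qquad \rho_{s,k}=\frac1{n(L_k)}\sum_{j=1}^{n(L_k)}\frac1{e^{\beta[\lambda_j(L_k)-\alpha+\lambda\rho_{s,k}-\mu_k]}-1},$$ and $$\rho=\lim_{k\to\infty}\frac1{L_k}\Big(\sum_{j=1}^{n(L_k)}\frac1{e^{\beta[\lambda_j(L_k)-\alpha+\lambda\rho_{s,k}-\mu_k]}-1}+\sum_{n=0}^\infty\frac1{e^{\beta(E_n(L_k)-\mu_k)}-1}\Big).$$ Let $\omega_k(n_{\varphi_n})$ be the expectation of the number of pairs in the bulk eigenstate $\varphi_n\oplus 0$ in the grand-canonical Gibbs state, at inverse temperature $\beta$ and chemical potential $\mu_k$, of the Hamiltonian $\sum_{j}(\lambda_j(L_k)-\alpha+\lambda\rho_{s,k})a_j^*a_j+\sum_{n\ge0}E_n(L_k)a_n^*a_n$ on the bosonic Fock space over $L^2_a(\Omega_{L_k})\oplus\mathbb C^{n(L_k)}$, where $L^2_a$ denotes the antisymmetric functions. Put $\rho_{0,k}:=\omega_k(n_{\varphi_0})/L_k$.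 **Theorem.** Suppose that $\mu_k$ converges to a limit $\mu\in[-\infty,\infty)$ with $\mu\le E_0$. Then the integrals and the series in $$\rho_{exc}:=\frac{\sqrt2}{\pi}\sum_{n=1}^\infty\int_0^\infty\frac{dx}{e^{\beta\,2\pi^2n^2/d^2}\,e^{\beta(x^2-\mu)}-1}$$ converge (with $\rho_{exc}:=0$ if $\mu=-\infty$), and $$\lim_{k\to\infty}\Big(\frac{n(L_k)}{L_k}\rho_{s,k}+\rho_{0,k}\Big)=\rho-\rho_{exc}.$$ Moreover, $\rho_{exc}$ is the limiting density of pairs in the excited bulk states: $$\lim_{k\to\infty}\frac1{L_k}\sum_{n=1}^\infty\omega_k(n_{\varphi_n})=\rho_{exc}.$$ -/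

import Mathlib

open MeasureTheory Filter Topology
open scoped ContDiff ENNReal

noncomputable section

namespace ElectronPairs

/-! ### The bulk: one pair of electrons on the interval `[0, L]` -/

/-- The configuration space `Ω_L` of a pair on `[0, L]` whose extension is at most `d`. -/
def pairRegion (d L : ℝ) : Set (ℝ × ℝ) :=
  {p | 0 ≤ p.1 ∧ p.1 ≤ L ∧ 0 ≤ p.2 ∧ p.2 ≤ L ∧ |p.1 - p.2| ≤ d}

/-- Lebesgue measure on `Ω_L`. -/
def pairMeasure (d L : ℝ) : Measure (ℝ × ℝ) := volume.restrict (pairRegion d L)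

/-- The Hilbert space `L²(Ω_L)` of complex-valued functions. -/
abbrev PairL2 (d L : ℝ) : Type := Lp ℂ 2 (pairMeasure d L)

/-- Antisymmetric elements of `L²(Ω_L)`, `φ(x, y) = -φ(y, x)`. -/
def IsAntisymmetric {d L : ℝ} (φ : PairL2 d L) : Prop :=
  ∀ᵐ p ∂(pairMeasure d L), φ p = - φ p.swap

/-- Antisymmetric smooth functions with compact support in the interior of `Ω_L`. -/
structure IsPairTest (d L : ℝ) (u : ℝ × ℝ → ℂ) : Prop where
  smooth : ContDiff ℝ ∞ u
  compact : HasCompactSupport u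
  support : tsupport u ⊆ interior (pairRegion d L)
  antisymm : ∀ p, u p = - u p.swap

/-- The triples `(φ, ∂₁φ, ∂₂φ)` with `φ` an antisymmetric element of the Sobolev space
`H¹₀(Ω_L)`: the closure in `L² × L² × L²` of the triples `(u, ∂₁u, ∂₂u)`, `u` an antisymmetric
test function. Its first components form the domain of the quadratic form `∫ |∇φ|²`. -/
def pairFormGraph (d L : ℝ) : Set (PairL2 d L × PairL2 d L × PairL2 d L) :=
  closure {t | ∃ u : ℝ × ℝ → ℂ, IsPairTest d L u ∧
    t.1 =ᵐ[pairMeasure d L] u ∧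
    t.2.1 =ᵐ[pairMeasure d L] (fun p => fderiv ℝ u p (1, 0)) ∧
    t.2.2 =ᵐ[pairMeasure d L] (fun p => fderiv ℝ u p (0, 1))}

/-- `φ` lies in the domain of the pair Hamiltonian `H_p^L` and `H_p^L φ = f`, where `H_p^L` is the
self-adjoint operator on antisymmetric functions associated with the quadratic form `∫ |∇φ|²` with
Dirichlet conditions on the boundary of `Ω_L`. -/
def PairHamiltonian {d L : ℝ} (φ f : PairL2 d L) : Prop :=
  IsAntisymmetric f ∧ ∃ g₁ g₂ : PairL2 d L, (φ, g₁, g₂) ∈ pairFormGraph d L ∧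
    ∀ v w₁ w₂ : PairL2 d L, (v, w₁, w₂) ∈ pairFormGraph d L →
      inner ℂ g₁ w₁ + inner ℂ g₂ w₂ = inner ℂ f v

/-- The eigenvalue `E_n(L)` of `H_p^L`, `n = 0, 1, 2, …`, in increasing order and counted with
multiplicity: the least `t` for which there are `n + 1` orthonormal eigenfunctions of `H_p^L` with
eigenvalues at most `t`. -/
def bulkEigenvalue (d L : ℝ) (n : ℕ) : ℝ :=
  sInf {t : ℝ | ∃ φ : Fin (n + 1) → PairL2 d L, Orthonormal ℂ φ ∧
    ∀ i, ∃ E : ℝ, E ≤ t ∧ PairHamiltonian (φ i) ((E : ℂ) • φ i)}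

/-- The lower edge `E_0 = 2π²/d²`. -/
def bulkThreshold (d : ℝ) : ℝ := 2 * Real.pi ^ 2 / d ^ 2

/-! ### The surface: the weighted path graph -/

/-- Edge weights of the path graph on `N` vertices; `e i` is the weight of the edge joining the
vertices `i` and `i + 1`. -/
def pathWeight (e : ℕ → ℝ) (N : ℕ) (i j : Fin N) : ℝ :=
  if (j : ℕ) = i + 1 then e i else if (i : ℕ) = j + 1 then e j else 0

/-- The (non-negative) weighted graph Laplacian, `(𝓛f)(i) = ∑ j, γ i j * (f i - f j)`. -/
def pathLaplacian (e : ℕ → ℝ) (N : ℕ) : Matrix (Fin N) (Fin N) ℝ :=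
  Matrix.diagonal (fun i => ∑ j, pathWeight e N i j) - Matrix.of (pathWeight e N)

theorem pathWeight_symm (e : ℕ → ℝ) (N : ℕ) (i j : Fin N) :
    pathWeight e N i j = pathWeight e N j i := by
  unfold pathWeight
  split_ifs <;> first | rfl | omega

theorem pathLaplacian_isHermitian (e : ℕ → ℝ) (N : ℕ) : (pathLaplacian e N).IsHermitian := by
  refine Matrix.IsHermitian.sub (Matrix.isHermitian_diagonal _) ?_
  ext i j
  simp [Matrix.conjTranspose_apply, pathWeight_symm e N j i]

/-- The eigenvalues `λ_j` of the graph Laplacian on `N` vertices, counted with multiplicity. -/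
def surfaceEigenvalue (e : ℕ → ℝ) (N : ℕ) (j : Fin N) : ℝ :=
  (pathLaplacian_isHermitian e N).eigenvalues j

/-! ### Statistical mechanics -/

/-- The Bose occupation number `1 / (exp (β (E - μ)) - 1)`. -/
def bose (β μ E : ℝ) : ℝ := 1 / (Real.exp (β * (E - μ)) - 1)

/-- Boltzmann weight `exp (-β (Γ - μ N))` of the vector of the occupation number basis of the
bosonic Fock space that has `ν i` particles in the mode `i`, for the second-quantised Hamiltonian
`Γ = ∑ i, ε i a*_i a_i` and the number operator `N = ∑ i, a*_i a_i`. -/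
def boltzmannWeight {ι : Type} (β μ : ℝ) (ε : ι → ℝ) (ν : ι →₀ ℕ) : ℝ≥0∞ :=
  ENNReal.ofReal (Real.exp (-β * ν.sum (fun i k => (ε i - μ) * k)))

/-- The expectation of the number operator `a*_i a_i` in the grand-canonical Gibbs state,
`tr (exp (-β (Γ - μ N)) a*_i a_i) / tr (exp (-β (Γ - μ N)))`, the traces being taken in the
occupation number basis of the bosonic Fock space. -/
def gibbsOccupation {ι : Type} (β μ : ℝ) (ε : ι → ℝ) (i : ι) : ℝ :=
  ((∑' ν : ι →₀ ℕ, boltzmannWeight β μ ε ν * (ν i : ℝ≥0∞)) /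
    ∑' ν : ι →₀ ℕ, boltzmannWeight β μ ε ν).toReal

/-- The energies of the modes on `L²_a(Ω_L) ⊕ ℂᴺ`: `λ_j - α + lam * ρs` for the surface modes
(mean-field interaction of strength `lam` at surface pair density `ρs`), `E_n(L)` for the bulk. -/
def modeEnergy (d L α lam ρs : ℝ) (e : ℕ → ℝ) (N : ℕ) : Fin N ⊕ ℕ → ℝ
  | Sum.inl j => surfaceEigenvalue e N j - α + lam * ρs
  | Sum.inr n => bulkEigenvalue d L n

/-- The Gibbs expectation of the number of pairs in the bulk eigenstate `φ_n ⊕ 0`. -/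
def bulkOccupation (β μ d L α lam ρs : ℝ) (e : ℕ → ℝ) (N n : ℕ) : ℝ :=
  gibbsOccupation β μ (modeEnergy d L α lam ρs e N) (Sum.inr n)

/-- The total number of pairs on the surface, `∑ j, 1 / (exp (β (λ_j - α + lam ρs - μ)) - 1)`. -/
def surfaceNumber (β μ α lam ρs : ℝ) (e : ℕ → ℝ) (N : ℕ) : ℝ :=
  ∑ j : Fin N, bose β μ (surfaceEigenvalue e N j - α + lam * ρs)

/-- The integrand `1 / (exp (2π²n²β/d²) exp (β (x² - μ)) - 1)`. -/
def excitedIntegrand (β d μ : ℝ) (n : ℕ) (x : ℝ) : ℝ :=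
  1 / (Real.exp (β * (2 * Real.pi ^ 2 * (n : ℝ) ^ 2 / d ^ 2)) * Real.exp (β * (x ^ 2 - μ)) - 1)

/-- `(√2/π) ∑_{n ≥ 1} ∫_0^∞ 1 / (exp (2π²n²β/d²) exp (β (x² - μ)) - 1) dx`. -/
def excitedDensity (β d μ : ℝ) : ℝ :=
  Real.sqrt 2 / Real.pi * ∑' n : ℕ, ∫ x in Set.Ioi (0 : ℝ), excitedIntegrand β d μ (n + 1) x

end ElectronPairs

end

/-! The total density is prescribed, so everything reduces to the bulk pair density `1/L ∑ₙ bose β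
μ_k E_n(L)`. If `μ_k` tends to a limit below the threshold `2π²/d²`, this density converges to
`ρ_exc` (to `0` if `μ_k → -∞`). If `μ_k` tended to the threshold, it would diverge, which the finite
`ρ` excludes. Hence `μ_k` stays away from the threshold, the occupation of the bulk ground state is
bounded and disappears after division by `L`, and `ρ_exc` is carried by the excited states alone.
The remaining `ρ - ρ_exc` sits on the surface, where the self-consistency equation identifies `n(L)
ρ_s` with the total surface number.

The spectrum of the pair Hamiltonian is not explicit, because `Ω_L` has triangular ends. In the
coordinates `x + y` and `y - x`, however, `Ω_L` lies between two rectangles of the same width, with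
length parameters `L - d` and `L`. Their antisymmetric Dirichlet modes are products of sines, with
eigenvalues `rectEigenvalue`. Trial functions on the inner rectangle bound the eigenvalues from
above (`mem_bulkLevels_of_lt_card`). Odd reflection and Parseval's identity on the outer one bound
them from below (`exists_energy_ge`, `lt_card_of_bulkEigenvalue_lt`). The estimate
`exists_energy_ge` also shows that the form domain embeds compactly in `L²`, which provides the
eigenfunctions.

Hall's marriage theorem turns both eigenvalue counts into injections of mode labels
(`exists_injective_rectEigenvalue_le`, `exists_injective_le_rectEigenvalue`). Since the Bose
function is decreasing, the bulk sum is then trapped between two explicit double sums. Within each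
transversal band these are Riemann sums of a monotone function with step `π/(√2 l)`. The band edges
agree because the widths do, and the lengths differ only by `d`, so both bounds have the same limit
(`tendsto_bulkDensity`). At the threshold the lowest band is one-dimensional with a `1/x²`
singularity, whence the divergence (`tendsto_bulkDensity_atTop`). Finally, `gibbsOccupation_eq_bose`
identifies the Gibbs expectations with Bose functions. -/

noncomputable section

namespace ElectronPairs

/-! ### Min–max for compact positive operators -/

section Spectral

variable {H : Type*} [NormedAddCommGroup H] [InnerProductSpace ℂ H] [CompleteSpace H]

open Module.End in
/-- A compact positive operator has an eigenvalue at least as large as any of its Rayleigh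
quotients. -/
theorem exists_eigenvector_ge_of_isCompactOperator {T : H →L[ℂ] H} (hT : IsCompactOperator T)
    (hs : T.IsSymmetric) (hpos : ∀ x, 0 ≤ (inner ℂ (T x) x).re) {c : ℝ} (hc : 0 < c) {x : H}
    (hx : x ≠ 0) (hcx : c * ‖x‖ ^ 2 ≤ (inner ℂ (T x) x).re) :
    ∃ κ : ℝ, c ≤ κ ∧ ∃ v, v ≠ 0 ∧ T v = (κ : ℂ) • v := by
  have hxn : 0 < ‖x‖ := norm_pos_iff.2 hx
  have hnorm : c ≤ ‖T‖ := by
    have h1 : (inner ℂ (T x) x).re ≤ ‖T‖ * ‖x‖ ^ 2 := by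
      calc (inner ℂ (T x) x).re ≤ ‖inner ℂ (T x) x‖ := Complex.re_le_norm _
        _ ≤ ‖T x‖ * ‖x‖ := norm_inner_le_norm _ _
        _ ≤ ‖T‖ * ‖x‖ * ‖x‖ := by gcongr; exact T.le_opNorm x
        _ = _ := by ring
    exact le_of_mul_le_mul_right (hcx.trans h1) (by positivity)
  have : Nontrivial H := ⟨x, 0, hx⟩
  -- The spectral radius is attained in the spectrum and, by self-adjointness, equals `‖T‖`. By
  -- compactness the nonzero point `k` is an eigenvalue, and positivity leaves only `k = ‖T‖`.
  obtain ⟨k, hk, hknorm⟩ :=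
    spectrum.exists_nnnorm_eq_spectralRadius_of_nonempty (spectrum.nonempty T)
  rw [T.spectralRadius_eq_nnnorm hs.isSelfAdjoint] at hknorm
  have hkn : ‖k‖ = ‖T‖ := by
    have := congrArg ENNReal.toReal hknorm
    simpa using this
  have hk0 : k ≠ 0 := by
    rintro rfl
    simp at hkn
    linarith
  have hev : HasEigenvalue (T : Module.End ℂ H) k :=
    (hT.hasEigenvalue_iff_mem_spectrum hk0).2 hk
  obtain ⟨v, hv⟩ := hev.exists_hasEigenvector
  have hconj := hs.conj_eigenvalue_eq_self hev
  have hkre : (k.re : ℂ) = k := Complex.conj_eq_iff_re.1 hconj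
  have hTv : T v = k • v := hv.apply_eq_smul
  have hre : 0 ≤ k.re := by
    have h := hpos v
    rw [hTv, inner_smul_left, hconj, ← hkre, Complex.re_ofReal_mul] at h
    have h2 : (inner ℂ v v).re = ‖v‖ ^ 2 := inner_self_eq_norm_sq (𝕜 := ℂ) v
    rw [h2] at h
    have : 0 < ‖v‖ := norm_pos_iff.2 hv.2
    exact nonneg_of_mul_nonneg_left h (by positivity)
  have habs : k.re = ‖T‖ := by
    rw [← hkn, ← hkre, Complex.norm_real, Complex.ofReal_re, Real.norm_of_nonneg hre]
  exact ⟨k.re, habs ▸ hnorm, v, hv.2, by rw [hkre, hTv]⟩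

/-- If the Rayleigh quotients of a compact positive operator are at least `c` on a subspace of
dimension at least `n`, it has `n` orthonormal eigenvectors with eigenvalues at least `c`. -/
theorem exists_orthonormal_eigenvectors_ge {T : H →L[ℂ] H} (hT : IsCompactOperator T)
    (hs : T.IsSymmetric) (hpos : ∀ x, 0 ≤ (inner ℂ (T x) x).re) {c : ℝ} (hc : 0 < c)
    (W : Submodule ℂ H) [FiniteDimensional ℂ W]
    (hW : ∀ x ∈ W, c * ‖x‖ ^ 2 ≤ (inner ℂ (T x) x).re) (n : ℕ)
    (hn : n ≤ Module.finrank ℂ W) :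
    ∃ φ : Fin n → H, Orthonormal ℂ φ ∧ ∀ i, ∃ κ : ℝ, c ≤ κ ∧ T (φ i) = (κ : ℂ) • φ i := by
  induction n with
  | zero => exact ⟨fun i => i.elim0, ⟨fun i => i.elim0, fun i => i.elim0⟩, fun i => i.elim0⟩
  | succ n ih =>
    obtain ⟨φ, hφ, hφT⟩ := ih (by omega)
    choose κ hκc hκ using hφT
    let K : Submodule ℂ H := Submodule.span ℂ (Set.range φ)
    have hmem : ∀ y : H, y ∈ Kᗮ ↔ ∀ i, inner ℂ (φ i) y = 0 := by
      intro y
      rw [Submodule.mem_orthogonal]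
      constructor
      · exact fun h i => h _ (Submodule.subset_span ⟨i, rfl⟩)
      · intro h u hu
        induction hu using Submodule.span_induction with
        | mem u hu => obtain ⟨i, rfl⟩ := hu; exact h i
        | zero => simp
        | add a b _ _ ha hb => rw [inner_add_left, ha, hb, add_zero]
        | smul a b _ hb => rw [inner_smul_left, hb, mul_zero]
    have hinv : ∀ y ∈ Kᗮ, T y ∈ Kᗮ := by
      intro y hy
      rw [hmem] at hy ⊢
      intro i
      have h := hs (φ i) y
      simp only [ContinuousLinearMap.coe_coe] at h
      rw [← h, hκ, inner_smul_left, hy, mul_zero]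
    -- Orthogonality to the `n` eigenvectors already found imposes `n` conditions on a space of
    -- dimension at least `n + 1`, so `W` meets their orthogonal complement. That complement is
    -- invariant under `T`, and the previous theorem applies to the restriction.
    let ℓ : W →ₗ[ℂ] (Fin n → ℂ) :=
      LinearMap.pi (fun i => (innerSL ℂ (φ i)).toLinearMap ∘ₗ W.subtype)
    have hker : LinearMap.ker ℓ ≠ ⊥ := by
      apply LinearMap.ker_ne_bot_of_finrank_lt
      rw [Module.finrank_fin_fun]
      omega
    obtain ⟨w, hw, hw0⟩ := Submodule.exists_mem_ne_zero_of_ne_bot hker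
    have hwK : (w : H) ∈ Kᗮ := by
      rw [hmem]
      intro i
      exact congrFun (LinearMap.mem_ker.1 hw) i
    let S : Kᗮ →L[ℂ] Kᗮ := T.restrict hinv
    have hScoe : ∀ y : Kᗮ, ((S y : Kᗮ) : H) = T y := fun y => rfl
    have hSc : IsCompactOperator S := hT.restrict' hinv
    have hSs : S.IsSymmetric := hs.restrict_invariant hinv
    obtain ⟨κ', hκ', v, hv0, hv⟩ := exists_eigenvector_ge_of_isCompactOperator hSc hSs
      (fun y => hpos y) hc (x := (⟨w, hwK⟩ : Kᗮ)) (by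
        intro h
        apply hw0
        exact Subtype.ext (congrArg (fun y : Kᗮ => (y : H)) h))
      (hW w w.2)
    have hvH : T (v : H) = (κ' : ℂ) • (v : H) := by
      have := congrArg Subtype.val hv
      simpa [hScoe] using this
    have hvn : ‖(v : H)‖ ≠ 0 := by simpa using hv0
    let v' : H := ((‖(v : H)‖⁻¹ : ℝ) : ℂ) • (v : H)
    have hv'T : T v' = (κ' : ℂ) • v' := by
      simp only [v', map_smul, hvH, smul_comm (κ' : ℂ)]
    have hv'n : ‖v'‖ = 1 := by
      simp only [v', norm_smul, Complex.norm_real, norm_inv, norm_norm]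
      exact inv_mul_cancel₀ hvn
    have hv'o : ∀ i, inner ℂ (φ i) v' = 0 := by
      intro i
      simp only [v', inner_smul_right, (hmem v).1 v.2 i, mul_zero]
    refine ⟨Fin.snoc φ v', ?_, ?_⟩
    · rw [orthonormal_iff_ite]
      rw [orthonormal_iff_ite] at hφ
      intro i j
      induction i using Fin.lastCases with
      | last =>
        induction j using Fin.lastCases with
        | last => simp [hv'n]
        | cast j =>
          simp only [Fin.snoc_last, Fin.snoc_castSucc]
          rw [if_neg (by simp [Fin.ext_iff]; omega), ← inner_conj_symm, hv'o, map_zero]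
      | cast i =>
        induction j using Fin.lastCases with
        | last =>
          simp only [Fin.snoc_last, Fin.snoc_castSucc]
          rw [if_neg (by simp [Fin.ext_iff]; omega), hv'o]
        | cast j => simp [hφ i j]
    · intro i
      induction i using Fin.lastCases with
      | last => exact ⟨κ', hκ', by simpa using hv'T⟩
      | cast i => exact ⟨κ i, hκc i, by simpa using hκ i⟩

/-- Up to an arbitrarily small multiple of the norm, `J` is controlled by finitely many functionals.
Bounded sets in `Fin m → ℂ` are totally bounded, so a finite net for the `F`-image of the unit ball
pulls back to a finite net for its `J`-image. -/
theorem isCompactOperator_of_forall_le {V : Type*} [NormedAddCommGroup V] [InnerProductSpace ℂ V]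
    (J : V →L[ℂ] H)
    (h : ∀ ε > 0, ∃ (m : ℕ) (F : V →L[ℂ] (Fin m → ℂ)), ∀ v, ‖J v‖ ≤ ε * ‖v‖ + ‖F v‖) :
    IsCompactOperator J := by
  refine (isCompactOperator_iff_isCompact_closure_image_ball (J : V →ₗ[ℂ] H) zero_lt_one).2 ?_
  refine TotallyBounded.isCompact_of_isClosed ?_ isClosed_closure
  apply TotallyBounded.closure
  rw [Metric.totallyBounded_iff]
  intro ε hε
  -- Two points of the unit ball are at distance at most `2`, so the net yields `2 · ε/8 + ε/4 < ε`.
  obtain ⟨m, F, hF⟩ := h (ε / 8) (by positivity)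
  have hbdd : TotallyBounded (F '' Metric.ball 0 1) := by
    refine TotallyBounded.subset ?_ (isCompact_closedBall (0 : Fin m → ℂ) ‖F‖).totallyBounded
    rintro _ ⟨v, hv, rfl⟩
    rw [mem_closedBall_zero_iff]
    rw [mem_ball_zero_iff] at hv
    exact (F.le_opNorm v).trans (by nlinarith [norm_nonneg F])
  obtain ⟨t, htsub, htfin, ht⟩ :=
    totallyBounded_iff_subset.1 hbdd _ (Metric.dist_mem_uniformity (by positivity : 0 < ε / 4))
  have htsub' : ∀ y ∈ t, ∃ v ∈ Metric.ball (0 : V) 1, F v = y := fun y hy => htsub hy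
  choose! g hg hgF using htsub'
  refine ⟨(fun y => J (g y)) '' t, htfin.image _, ?_⟩
  rintro _ ⟨v, hv, rfl⟩
  have hFv := ht ⟨v, hv, rfl⟩
  simp only [Set.mem_iUnion] at hFv ⊢
  obtain ⟨y, hy, hvy⟩ := hFv
  refine ⟨J (g y), ⟨y, hy, rfl⟩, ?_⟩
  change dist _ _ < _ at hvy
  rw [dist_eq_norm] at hvy
  rw [Metric.mem_ball, dist_eq_norm, ContinuousLinearMap.coe_coe, ← map_sub]
  have h1 := hF (v - g y)
  have h2 : ‖F (v - g y)‖ < ε / 4 := by rwa [map_sub, hgF y hy]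
  have h3 : ‖v - g y‖ ≤ 2 := by
    have := hg y hy
    rw [mem_ball_zero_iff] at this hv
    linarith [norm_sub_le v (g y)]
  nlinarith

variable {V : Type*} [NormedAddCommGroup V] [InnerProductSpace ℂ V] [CompleteSpace V]

open ContinuousLinearMap (adjoint)

/-- Variational principle: a compact embedding `J` of a form domain `V` into `H`. -/
theorem exists_orthonormal_eigenvectors_of_form_le (J : V →L[ℂ] H) (hJ : IsCompactOperator J)
    {t : ℝ} (ht : 0 < 1 + t) (W : Submodule ℂ V) [FiniteDimensional ℂ W]
    (hW : ∀ v ∈ W, ‖v‖ ^ 2 ≤ (1 + t) * ‖J v‖ ^ 2) (n : ℕ) (hn : n ≤ Module.finrank ℂ W) :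
    ∃ φ : Fin n → H, Orthonormal ℂ φ ∧
      ∀ i, ∃ κ : ℝ, (1 + t)⁻¹ ≤ κ ∧ J (adjoint J (φ i)) = (κ : ℂ) • φ i := by
  have hre : ∀ x, (inner ℂ ((J ∘L adjoint J) x) x).re = ‖adjoint J x‖ ^ 2 := by
    intro x
    rw [ContinuousLinearMap.comp_apply, ← ContinuousLinearMap.adjoint_inner_right]
    exact inner_self_eq_norm_sq (𝕜 := ℂ) _
  have hinj : Function.Injective (J.toLinearMap ∘ₗ W.subtype) := by
    rw [← LinearMap.ker_eq_bot, LinearMap.ker_eq_bot']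
    intro v hv
    have h := hW v v.2
    have hv' : J (v : V) = 0 := hv
    rw [hv', norm_zero] at h
    have : ‖(v : V)‖ = 0 := by
      have := norm_nonneg (v : V)
      nlinarith
    simpa using this
  have := exists_orthonormal_eigenvectors_ge (T := J ∘L adjoint J) (c := (1 + t)⁻¹)
    (hJ.comp_clm (adjoint J)) ?_ (fun x => by rw [hre]; positivity) (by positivity)
    (LinearMap.range (J.toLinearMap ∘ₗ W.subtype)) ?_ n ?_
  · exact this
  · intro x y
    simp only [ContinuousLinearMap.coe_coe, ContinuousLinearMap.comp_apply]
    rw [← ContinuousLinearMap.adjoint_inner_right, ContinuousLinearMap.adjoint_inner_left]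
  · rintro _ ⟨v, rfl⟩
    rw [hre]
    have hv := hW v v.2
    change (1 + t)⁻¹ * ‖J (v : V)‖ ^ 2 ≤ ‖adjoint J (J (v : V))‖ ^ 2
    set a := ‖J (v : V)‖ with ha
    set b := ‖adjoint J (J (v : V))‖ with hb
    -- Cauchy–Schwarz for `⟪v, J* J v⟫ = ‖J v‖²` converts the upper bound on the form norm of `v`
    -- into a lower bound for the Rayleigh quotient of `J J*` at `J v`.
    have h1 : a ^ 2 ≤ ‖(v : V)‖ * b := by
      have h2 : (inner ℂ (J (v : V)) (J (v : V)) : ℂ).re = a ^ 2 :=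
        inner_self_eq_norm_sq (𝕜 := ℂ) _
      rw [← h2, ← ContinuousLinearMap.adjoint_inner_right]
      exact (Complex.re_le_norm _).trans (norm_inner_le_norm _ _)
    have hb0 : 0 ≤ b := norm_nonneg _
    have ha0 : 0 ≤ a := norm_nonneg _
    rw [inv_mul_le_iff₀ ht]
    rcases ha0.eq_or_lt with h0 | h0
    · rw [← h0]
      simp only [ne_eq, OfNat.ofNat_ne_zero, not_false_eq_true, zero_pow]
      positivity
    · have h3 : (a ^ 2) ^ 2 ≤ ‖(v : V)‖ ^ 2 * b ^ 2 := by
        rw [← mul_pow]; exact pow_le_pow_left₀ (by positivity) h1 2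
      have h4 : a ^ 2 * a ^ 2 ≤ a ^ 2 * ((1 + t) * b ^ 2) := by
        nlinarith [mul_le_mul_of_nonneg_right hv (sq_nonneg b)]
      exact le_of_mul_le_mul_left h4 (by positivity)
  · rw [LinearMap.finrank_range_of_inj hinj]
    exact hn

end Spectral

/-! ### The form domain as a Hilbert space -/

variable {d L : ℝ}

theorem isPairTest_zero : IsPairTest d L (fun _ => 0) where
  smooth := contDiff_const
  compact := HasCompactSupport.zero (α := ℝ × ℝ) (β := ℂ)
  support := by
    have : tsupport (fun _ : ℝ × ℝ => (0 : ℂ)) = ∅ := by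
      simp
    simp [this]
  antisymm := by simp

theorem IsPairTest.add {u v : ℝ × ℝ → ℂ} (hu : IsPairTest d L u) (hv : IsPairTest d L v) :
    IsPairTest d L (fun p => u p + v p) where
  smooth := hu.smooth.add hv.smooth
  compact := hu.compact.add hv.compact
  support := (tsupport_add u v).trans (Set.union_subset hu.support hv.support)
  antisymm p := by rw [hu.antisymm p, hv.antisymm p]; ring

theorem IsPairTest.const_mul {u : ℝ × ℝ → ℂ} (hu : IsPairTest d L u) (c : ℂ) :
    IsPairTest d L (fun p => c * u p) where
  smooth := contDiff_const.mul hu.smooth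
  compact := hu.compact.mul_left
  support := (closure_mono (Function.support_mul_subset_right _ _)).trans hu.support
  antisymm p := by rw [hu.antisymm p]; ring

theorem IsPairTest.differentiable {u : ℝ × ℝ → ℂ} (hu : IsPairTest d L u) :
    Differentiable ℝ u := hu.smooth.differentiable (by simp)

/-- The triples `(u, ∂₁u, ∂₂u)`, `u` an antisymmetric test function. -/
def pairTestTriples (d L : ℝ) : Submodule ℂ (PairL2 d L × PairL2 d L × PairL2 d L) where
  carrier := {t | ∃ u : ℝ × ℝ → ℂ, IsPairTest d L u ∧
    t.1 =ᵐ[pairMeasure d L] u ∧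
    t.2.1 =ᵐ[pairMeasure d L] (fun p => fderiv ℝ u p (1, 0)) ∧
    t.2.2 =ᵐ[pairMeasure d L] (fun p => fderiv ℝ u p (0, 1))}
  zero_mem' := by
    refine ⟨_, isPairTest_zero, ?_, ?_, ?_⟩
    · exact Lp.coeFn_zero ℂ 2 _
    · simp only [fderiv_fun_const, Pi.zero_apply, zero_apply]
      exact Lp.coeFn_zero ℂ 2 _
    · simp only [fderiv_fun_const, Pi.zero_apply, zero_apply]
      exact Lp.coeFn_zero ℂ 2 _
  add_mem' := by
    rintro s t ⟨u, hu, hu0, hu1, hu2⟩ ⟨v, hv, hv0, hv1, hv2⟩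
    have hd : ∀ p, fderiv ℝ (fun p => u p + v p) p = fderiv ℝ u p + fderiv ℝ v p := fun p =>
      fderiv_fun_add (hu.differentiable p) (hv.differentiable p)
    refine ⟨_, hu.add hv, ?_, ?_, ?_⟩
    · filter_upwards [Lp.coeFn_add s.1 t.1, hu0, hv0] with p h h1 h2
      simp only [Prod.fst_add, h, Pi.add_apply, h1, h2]
    · filter_upwards [Lp.coeFn_add s.2.1 t.2.1, hu1, hv1] with p h h1 h2
      simp only [Prod.fst_add, Prod.snd_add, h, Pi.add_apply, h1, h2, hd,
        add_apply]
    · filter_upwards [Lp.coeFn_add s.2.2 t.2.2, hu2, hv2] with p h h1 h2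
      simp only [Prod.snd_add, h, Pi.add_apply, h1, h2, hd, add_apply]
  smul_mem' := by
    rintro c t ⟨u, hu, hu0, hu1, hu2⟩
    have hd : ∀ p, fderiv ℝ (fun p => c * u p) p = c • fderiv ℝ u p := fun p =>
      fderiv_const_mul (hu.differentiable p) c
    refine ⟨_, hu.const_mul c, ?_, ?_, ?_⟩
    · filter_upwards [Lp.coeFn_smul c t.1, hu0] with p h h1
      simp only [Prod.smul_fst, h, Pi.smul_apply, h1, smul_eq_mul]
    · filter_upwards [Lp.coeFn_smul c t.2.1, hu1] with p h h1
      simp only [Prod.smul_fst, Prod.smul_snd, h, Pi.smul_apply, h1, hd,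
        smul_apply]
    · filter_upwards [Lp.coeFn_smul c t.2.2, hu2] with p h h1
      simp only [Prod.smul_snd, h, Pi.smul_apply, h1, hd, smul_apply]

/-- The ambient Hilbert space of triples. -/
abbrev PairTriple (d L : ℝ) : Type := PiLp 2 (fun _ : Fin 3 => PairL2 d L)

/-- The form domain with the inner product of the Sobolev space `H¹`. -/
def pairFormSpace (d L : ℝ) : Submodule ℂ (PairTriple d L) where
  carrier := {x | (x 0, x 1, x 2) ∈ (pairTestTriples d L).topologicalClosure}
  zero_mem' := by
    exact Submodule.zero_mem (pairTestTriples d L).topologicalClosure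
  add_mem' := fun {x y} hx hy => by
    exact Submodule.add_mem (pairTestTriples d L).topologicalClosure hx hy
  smul_mem' := fun c x hx => by
    exact Submodule.smul_mem (pairTestTriples d L).topologicalClosure c hx

theorem isClosed_pairFormSpace : IsClosed (pairFormSpace d L : Set (PairTriple d L)) := by
  have hc : Continuous (fun x : PairTriple d L => (x 0, x 1, x 2)) := by fun_prop
  exact (Submodule.isClosed_topologicalClosure (pairTestTriples d L)).preimage hc

instance : CompleteSpace (pairFormSpace d L) :=
  isClosed_pairFormSpace.completeSpace_coe

/-- The embedding of the form domain into `L²(Ω_L)`. -/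
def pairEmbedding (d L : ℝ) : pairFormSpace d L →L[ℂ] PairL2 d L :=
  (PiLp.proj 2 (fun _ : Fin 3 => PairL2 d L) 0) ∘L (pairFormSpace d L).subtypeL

theorem pairEmbedding_apply (x : pairFormSpace d L) :
    pairEmbedding d L x = (x : PairTriple d L) 0 := rfl

theorem norm_sq_pairFormSpace (x : pairFormSpace d L) :
    ‖x‖ ^ 2 = ‖(x : PairTriple d L) 0‖ ^ 2 + ‖(x : PairTriple d L) 1‖ ^ 2
      + ‖(x : PairTriple d L) 2‖ ^ 2 := by
  rw [Submodule.coe_norm, PiLp.norm_sq_eq_of_L2, Fin.sum_univ_three]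

theorem inner_pairFormSpace (x y : pairFormSpace d L) :
    inner ℂ x y = inner ℂ ((x : PairTriple d L) 0) ((y : PairTriple d L) 0)
      + inner ℂ ((x : PairTriple d L) 1) ((y : PairTriple d L) 1)
      + inner ℂ ((x : PairTriple d L) 2) ((y : PairTriple d L) 2) := by
  rw [Submodule.coe_inner, PiLp.inner_apply, Fin.sum_univ_three]

theorem measurableSet_pairRegion (d L : ℝ) : MeasurableSet (pairRegion d L) := by
  unfold pairRegion
  measurability

theorem pairRegion_subset_Icc (d L : ℝ) : pairRegion d L ⊆ Set.Icc 0 L ×ˢ Set.Icc 0 L :=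
  fun _ hp => ⟨⟨hp.1, hp.2.1⟩, ⟨hp.2.2.1, hp.2.2.2.1⟩⟩

instance isFiniteMeasure_pairMeasure (d L : ℝ) : IsFiniteMeasure (pairMeasure d L) := by
  refine ⟨?_⟩
  rw [pairMeasure, Measure.restrict_apply_univ]
  refine (measure_mono (pairRegion_subset_Icc d L)).trans_lt ?_
  exact (isCompact_Icc.prod isCompact_Icc).measure_lt_top

theorem measurePreserving_swap_pairMeasure (d L : ℝ) :
    MeasurePreserving (Prod.swap : ℝ × ℝ → ℝ × ℝ) (pairMeasure d L) (pairMeasure d L) := by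
  have h : MeasurePreserving (Prod.swap : ℝ × ℝ → ℝ × ℝ) volume volume :=
    Measure.measurePreserving_swap
  have h1 : Prod.swap ⁻¹' pairRegion d L = pairRegion d L := by
    ext ⟨x, y⟩
    change (0 ≤ y ∧ y ≤ L ∧ 0 ≤ x ∧ x ≤ L ∧ |y - x| ≤ d) ↔
      (0 ≤ x ∧ x ≤ L ∧ 0 ≤ y ∧ y ≤ L ∧ |x - y| ≤ d)
    rw [abs_sub_comm y x]
    tauto
  have := h.restrict_preimage (measurableSet_pairRegion d L)
  rwa [h1] at this

theorem isClosed_setOf_isAntisymmetric (d L : ℝ) :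
    IsClosed {φ : PairL2 d L | IsAntisymmetric φ} := by
  let S : PairL2 d L →L[ℂ] PairL2 d L :=
    (Lp.compMeasurePreservingₗᵢ ℂ Prod.swap
      (measurePreserving_swap_pairMeasure d L)).toContinuousLinearMap
  have h : {φ : PairL2 d L | IsAntisymmetric φ} = {φ | φ = - S φ} := by
    ext φ
    have hS : S φ =ᵐ[pairMeasure d L] φ ∘ Prod.swap :=
      Lp.coeFn_compMeasurePreserving φ (measurePreserving_swap_pairMeasure d L)
    change (∀ᵐ p ∂(pairMeasure d L), φ p = - φ p.swap) ↔ φ = - S φ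
    rw [Lp.ext_iff]
    constructor
    · intro h
      filter_upwards [h, hS, Lp.coeFn_neg (S φ)] with p h1 h2 h3
      rw [h3, Pi.neg_apply, h2, h1]; rfl
    · intro h
      filter_upwards [h, hS, Lp.coeFn_neg (S φ)] with p h1 h2 h3
      rw [h1, h3, Pi.neg_apply, h2]; rfl
  rw [h]
  exact isClosed_eq continuous_id (by fun_prop)

/-- Antisymmetry is a closed condition in `L²` because the swap preserves the measure, so it
survives the closure that defines the form domain. -/
theorem isAntisymmetric_of_mem_pairFormGraph {φ g₁ g₂ : PairL2 d L}
    (h : (φ, g₁, g₂) ∈ pairFormGraph d L) : IsAntisymmetric φ := by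
  have hcl : IsClosed {t : PairL2 d L × PairL2 d L × PairL2 d L | IsAntisymmetric t.1} :=
    (isClosed_setOf_isAntisymmetric d L).preimage continuous_fst
  refine closure_minimal ?_ hcl h
  rintro t ⟨u, hu, h0, -, -⟩
  have h0' := (measurePreserving_swap_pairMeasure d L).quasiMeasurePreserving.ae_eq_comp h0
  change ∀ᵐ p ∂(pairMeasure d L), t.1 p = - t.1 p.swap
  filter_upwards [h0, h0'] with p h1 h2
  simp only [Function.comp_apply] at h2
  rw [h1, h2, hu.antisymm p]

theorem IsAntisymmetric.smul {φ : PairL2 d L} (h : IsAntisymmetric φ) (c : ℂ) :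
    IsAntisymmetric (c • φ) := by
  have h0 := Lp.coeFn_smul c φ
  have h1 := (measurePreserving_swap_pairMeasure d L).quasiMeasurePreserving.ae_eq_comp h0
  unfold IsAntisymmetric at *
  filter_upwards [h, h0, h1] with p a b e
  simp only [Function.comp_apply, Pi.smul_apply] at e b
  rw [b, e, a, smul_neg]

open ContinuousLinearMap (adjoint)

/-- With the `H¹` inner product on the form domain, `J J*` is `(1 + H_p)⁻¹` on antisymmetric
functions. An eigenvalue `κ` of it therefore corresponds to the energy `κ⁻¹ - 1`. The weak equation
is the defining property of the adjoint, minus the `L²` part of the inner product. -/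
theorem pairHamiltonian_of_adjoint_eq {φ : PairL2 d L} {κ : ℝ} (hκ : 0 < κ)
    (h : pairEmbedding d L (adjoint (pairEmbedding d L) φ) = (κ : ℂ) • φ) :
    PairHamiltonian φ (((κ⁻¹ - 1 : ℝ) : ℂ) • φ) := by
  have hκ' : (κ : ℂ) ≠ 0 := by exact_mod_cast hκ.ne'
  set v := adjoint (pairEmbedding d L) φ with hv
  set y : pairFormSpace d L := (κ : ℂ)⁻¹ • v with hy
  have hy0 : (y : PairTriple d L) 0 = φ := by
    have : (y : PairTriple d L) 0 = (κ : ℂ)⁻¹ • pairEmbedding d L v := by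
      rw [← pairEmbedding_apply, hy, map_smul]
    rw [this, h, smul_smul, inv_mul_cancel₀ hκ', one_smul]
  have hmem : (φ, (y : PairTriple d L) 1, (y : PairTriple d L) 2) ∈ pairFormGraph d L := by
    rw [← hy0]; exact y.2
  refine ⟨(isAntisymmetric_of_mem_pairFormGraph hmem).smul _, _, _, hmem, ?_⟩
  intro w₀ w₁ w₂ hw
  let w : pairFormSpace d L := ⟨WithLp.toLp 2 ![w₀, w₁, w₂], hw⟩
  have h1 : inner ℂ y w = (κ : ℂ)⁻¹ * inner ℂ φ w₀ := by
    refine (inner_smul_left v w _).trans ?_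
    rw [hv, ContinuousLinearMap.adjoint_inner_left, pairEmbedding_apply, map_inv₀,
      Complex.conj_ofReal]
    rfl
  rw [inner_pairFormSpace, hy0] at h1
  have h2 : inner ℂ ((y : PairTriple d L) 1) w₁ + inner ℂ ((y : PairTriple d L) 2) w₂
      = (κ : ℂ)⁻¹ * inner ℂ φ w₀ - inner ℂ φ w₀ := by
    rw [← h1]
    simp only [w]
    simp
    ring
  rw [h2, inner_smul_left, Complex.conj_ofReal]
  push_cast
  ring

theorem eigenvalue_nonneg {φ : PairL2 d L} (hφ : φ ≠ 0) {E : ℝ}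
    (h : PairHamiltonian φ ((E : ℂ) • φ)) : 0 ≤ E := by
  obtain ⟨-, g₁, g₂, hg, h⟩ := h
  have h1 := h _ _ _ hg
  rw [inner_smul_left, Complex.conj_ofReal] at h1
  have h2 := congrArg Complex.re h1
  rw [Complex.add_re, Complex.re_ofReal_mul] at h2
  have e : ∀ x : PairL2 d L, (inner ℂ x x).re = ‖x‖ ^ 2 := fun x =>
    inner_self_eq_norm_sq (𝕜 := ℂ) x
  rw [e, e, e] at h2
  have : 0 < ‖φ‖ := norm_pos_iff.2 hφ
  by_contra! hE
  nlinarith [sq_nonneg ‖g₁‖, sq_nonneg ‖g₂‖, mul_pos this this]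

/-! ### Variational bounds for the eigenvalue levels -/

/-- The levels `t` up to which there are `n + 1` orthonormal eigenfunctions. -/
def bulkLevels (d L : ℝ) (n : ℕ) : Set ℝ :=
  {t : ℝ | ∃ φ : Fin (n + 1) → PairL2 d L, Orthonormal ℂ φ ∧
    ∀ i, ∃ E : ℝ, E ≤ t ∧ PairHamiltonian (φ i) ((E : ℂ) • φ i)}

theorem bulkEigenvalue_eq (d L : ℝ) (n : ℕ) : bulkEigenvalue d L n = sInf (bulkLevels d L n) := rfl

theorem nonneg_of_mem_bulkLevels {n : ℕ} {t : ℝ} (ht : t ∈ bulkLevels d L n) : 0 ≤ t := by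
  obtain ⟨φ, hφ, h⟩ := ht
  obtain ⟨E, hE, hE'⟩ := h 0
  exact (eigenvalue_nonneg (hφ.ne_zero 0) hE').trans hE

/-- If the energy form is at least `t` on the functions annihilated by at most `n` functionals,
then `t` is a lower bound of the levels. -/
theorem le_of_mem_bulkLevels {ι : Type*} [Fintype ι] (ℓ : PairL2 d L →ₗ[ℂ] (ι → ℂ)) {n : ℕ}
    (hι : Fintype.card ι ≤ n) {t : ℝ}
    (hℓ : ∀ x : pairFormSpace d L, ℓ ((x : PairTriple d L) 0) = 0 →
      t * ‖(x : PairTriple d L) 0‖ ^ 2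
        ≤ ‖(x : PairTriple d L) 1‖ ^ 2 + ‖(x : PairTriple d L) 2‖ ^ 2)
    {s : ℝ} (hs : s ∈ bulkLevels d L n) : t ≤ s := by
  obtain ⟨φ, hφ, h⟩ := hs
  choose E hE hH using h
  choose hanti g₁ g₂ hg hform using hH
  let x : Fin (n + 1) → pairFormSpace d L := fun i => ⟨WithLp.toLp 2 ![φ i, g₁ i, g₂ i], hg i⟩
  let A : (Fin (n + 1) → ℂ) →ₗ[ℂ] pairFormSpace d L := Fintype.linearCombination ℂ x
  -- Some nonzero combination of the `n + 1` eigenfunctions is annihilated by the at most `n`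
  -- functionals. Its Rayleigh quotient is at least `t` by hypothesis and at most `s` as an average
  -- of the `E i`.
  have hker : LinearMap.ker (ℓ ∘ₗ (pairEmbedding d L).toLinearMap ∘ₗ A) ≠ ⊥ := by
    apply LinearMap.ker_ne_bot_of_finrank_lt
    rw [Module.finrank_fintype_fun_eq_card, Module.finrank_fintype_fun_eq_card, Fintype.card_fin]
    omega
  obtain ⟨c, hc, hc0⟩ := Submodule.exists_mem_ne_zero_of_ne_bot hker
  have hA : ∀ j, ((A c : pairFormSpace d L) : PairTriple d L) j
      = ∑ i, c i • (x i : PairTriple d L) j := by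
    intro j
    simp only [A, Fintype.linearCombination_apply]
    rw [Submodule.coe_sum, WithLp.ofLp_sum, Finset.sum_apply]
    rfl
  have hx0 : ∀ i, (x i : PairTriple d L) 0 = φ i := fun i => rfl
  have hx1 : ∀ i, (x i : PairTriple d L) 1 = g₁ i := fun i => rfl
  have hx2 : ∀ i, (x i : PairTriple d L) 2 = g₂ i := fun i => rfl
  have key := hℓ (A c) (LinearMap.mem_ker.1 hc)
  have hn : ∀ (j : Fin 3), ‖((A c : pairFormSpace d L) : PairTriple d L) j‖ ^ 2
      = (∑ i, ∑ k, (starRingEnd ℂ) (c i) * (c k *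
        inner ℂ ((x i : PairTriple d L) j) ((x k : PairTriple d L) j))).re := by
    intro j
    have e : ∀ x : PairL2 d L, (inner ℂ x x).re = ‖x‖ ^ 2 := fun x =>
      inner_self_eq_norm_sq (𝕜 := ℂ) x
    rw [← e, hA, sum_inner]
    simp only [inner_sum, inner_smul_left, inner_smul_right]
    congr 1
    exact Finset.sum_congr rfl fun i _ => Finset.sum_congr rfl fun k _ => by ring
  have hc2 : ∀ i, (starRingEnd ℂ) (c i) * c i = ((‖c i‖ ^ 2 : ℝ) : ℂ) := fun i => by
    rw [Complex.conj_mul', ← Complex.ofReal_pow]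
  have horth := orthonormal_iff_ite.1 hφ
  have hn0 : ‖((A c : pairFormSpace d L) : PairTriple d L) 0‖ ^ 2 = ∑ i, ‖c i‖ ^ 2 := by
    rw [hn]
    simp only [hx0, horth, mul_ite, mul_one, mul_zero, Finset.sum_ite_eq, Finset.mem_univ, if_true,
      hc2]
    rw [← Complex.ofReal_sum, Complex.ofReal_re]
  have hn12 : ‖((A c : pairFormSpace d L) : PairTriple d L) 1‖ ^ 2
      + ‖((A c : pairFormSpace d L) : PairTriple d L) 2‖ ^ 2 = ∑ i, E i * ‖c i‖ ^ 2 := by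
    rw [hn, hn, ← Complex.add_re, ← Finset.sum_add_distrib]
    simp only [← Finset.sum_add_distrib, ← mul_add, hx1, hx2]
    -- The weak eigenvalue equation tested with another eigenfunction: the form is diagonal in the
    -- `φ i`.
    have : ∀ i k, inner ℂ (g₁ i) (g₁ k) + inner ℂ (g₂ i) (g₂ k)
        = if i = k then (E i : ℂ) else 0 := by
      intro i k
      rw [hform i _ _ _ (hg k), inner_smul_left, Complex.conj_ofReal, horth]
      simp
    simp only [this, mul_ite, mul_zero, Finset.sum_ite_eq, Finset.mem_univ, if_true]
    have h3 : ∀ i, (starRingEnd ℂ) (c i) * (c i * (E i : ℂ)) = ((E i * ‖c i‖ ^ 2 : ℝ) : ℂ) := by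
      intro i
      rw [← mul_assoc, hc2]
      push_cast
      ring
    simp only [h3]
    rw [← Complex.ofReal_sum, Complex.ofReal_re]
  rw [hn0, hn12] at key
  have hpos : 0 < ∑ i, ‖c i‖ ^ 2 := by
    obtain ⟨i, hi⟩ := Function.ne_iff.1 hc0
    refine Finset.sum_pos' (fun i _ => by positivity) ⟨i, Finset.mem_univ i, ?_⟩
    have : 0 < ‖c i‖ := norm_pos_iff.2 hi
    positivity
  have hle : ∑ i, E i * ‖c i‖ ^ 2 ≤ s * ∑ i, ‖c i‖ ^ 2 := by
    rw [Finset.mul_sum]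
    gcongr with i
    exact hE i
  exact le_of_mul_le_mul_right (key.trans hle) hpos

/-- Variational upper bound for the eigenvalues. -/
theorem mem_bulkLevels_of_form_le (hJ : IsCompactOperator (pairEmbedding d L)) {t : ℝ}
    (ht : 0 ≤ t) (W : Submodule ℂ (pairFormSpace d L)) [FiniteDimensional ℂ W]
    (hW : ∀ v ∈ W, ‖(v : PairTriple d L) 1‖ ^ 2 + ‖(v : PairTriple d L) 2‖ ^ 2
      ≤ t * ‖(v : PairTriple d L) 0‖ ^ 2) {n : ℕ} (hn : n + 1 ≤ Module.finrank ℂ W) :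
    t ∈ bulkLevels d L n := by
  obtain ⟨φ, hφ, h⟩ := exists_orthonormal_eigenvectors_of_form_le (pairEmbedding d L) hJ
    (by linarith : 0 < 1 + t) W (fun v hv => by
      rw [norm_sq_pairFormSpace, pairEmbedding_apply]
      linarith [hW v hv]) (n + 1) hn
  refine ⟨φ, hφ, fun i => ?_⟩
  obtain ⟨κ, hκ, h⟩ := h i
  have hpos : 0 < κ := lt_of_lt_of_le (by positivity) hκ
  refine ⟨κ⁻¹ - 1, ?_, pairHamiltonian_of_adjoint_eq hpos h⟩
  have := inv_le_of_inv_le₀ (by linarith) hκ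
  linarith

/-! ### Parseval's identity on a rotated rectangle -/

/-- The character `exp (-iπ n x / A)`. -/
def expChar (A : ℝ) (n : ℤ) (x : ℝ) : ℂ := Complex.exp (-(Real.pi * n * x / A : ℝ) * Complex.I)

theorem continuous_expChar (A : ℝ) (n : ℤ) : Continuous (expChar A n) := by
  unfold expChar
  fun_prop

theorem norm_expChar (A : ℝ) (n : ℤ) (x : ℝ) : ‖expChar A n x‖ = 1 := by
  rw [expChar, ← Complex.ofReal_neg, Complex.norm_exp_ofReal_mul_I]

theorem hasSum_sq_norm_integral_expChar {A : ℝ} (hA : 0 < A) {f : ℝ → ℂ} (hf : Continuous f) :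
    HasSum (fun n : ℤ => ‖∫ x in -A..A, expChar A n x * f x‖ ^ 2)
      (2 * A * ∫ x in -A..A, ‖f x‖ ^ 2) := by
  have hab : -A < A := by linarith
  have hL2 : MemLp f 2 (volume.restrict (Set.Ioc (-A) A)) := by
    obtain ⟨C, hC⟩ := (isCompact_Icc (a := -A) (b := A)).exists_bound_of_continuousOn
      hf.continuousOn
    refine MemLp.of_bound hf.aestronglyMeasurable C ?_
    filter_upwards [ae_restrict_mem measurableSet_Ioc] with x hx
    exact hC x (Set.Ioc_subset_Icc_self hx)
  have h := (hasSum_sq_fourierCoeffOn hab hL2).mul_left ((2 * A) ^ 2)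
  convert! h using 1
  · funext n
    rw [fourierCoeffOn_eq_integral, norm_smul, mul_pow (‖_‖), ← mul_assoc]
    have h1 : (2 * A) ^ 2 * ‖1 / (A - -A)‖ ^ 2 = 1 := by
      rw [Real.norm_eq_abs, sq_abs]
      field_simp
      ring
    rw [h1, one_mul]
    congr 3
    funext x
    rw [fourier_coe_apply, smul_eq_mul, expChar]
    congr 2
    have : (A : ℂ) ≠ 0 := by exact_mod_cast hA.ne'
    push_cast
    have h2 : (A : ℂ) - -A = 2 * A := by ring
    rw [h2]
    field_simp
  · rw [smul_eq_mul]
    field_simp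
    ring

/-- One-dimensional Parseval is applied in `v` for fixed `s`, then in `s` to each coefficient. The
sum over `n` passes through the integral by dominated convergence, its terms being nonnegative with
continuous sum `q`. -/
theorem hasSum_sq_norm_integral_expChar_prod {A B : ℝ} (hA : 0 < A) (hB : 0 < B)
    {w : ℝ × ℝ → ℂ} (hw : Continuous w) :
    HasSum (fun k : ℤ × ℤ =>
        ‖∫ s in -A..A, ∫ v in -B..B, expChar B k.1 v * expChar A k.2 s * w (s, v)‖ ^ 2)
      (4 * A * B * ∫ s in -A..A, ∫ v in -B..B, ‖w (s, v)‖ ^ 2) := by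
  let c : ℤ → ℝ → ℂ := fun n s => ∫ v in -B..B, expChar B n v * w (s, v)
  have hc : ∀ n, Continuous (c n) := fun n =>
    intervalIntegral.continuous_parametric_intervalIntegral_of_continuous' (by
      have := continuous_expChar B n
      simp only [Function.uncurry_def]
      fun_prop) _ _
  let q : ℝ → ℝ := fun s => 2 * B * ∫ v in -B..B, ‖w (s, v)‖ ^ 2
  have hq : Continuous q := continuous_const.mul
    (intervalIntegral.continuous_parametric_intervalIntegral_of_continuous' (by
      simp only [Function.uncurry_def]
      fun_prop) _ _)
  have h1 : ∀ s, HasSum (fun n => ‖c n s‖ ^ 2) (q s) := fun s =>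
    hasSum_sq_norm_integral_expChar hB (hw.comp (by fun_prop))
  have h2 : HasSum (fun n => ∫ s in -A..A, ‖c n s‖ ^ 2) (∫ s in -A..A, q s) := by
    apply intervalIntegral.hasSum_integral_of_dominated_convergence (fun n s => ‖c n s‖ ^ 2)
    · exact fun n => ((hc n).norm.pow 2).aestronglyMeasurable
    · exact fun n => Eventually.of_forall fun s _ => by
        rw [Real.norm_of_nonneg (by positivity)]
    · exact Eventually.of_forall fun s _ => (h1 s).summable
    · simp only [fun s => (h1 s).tsum_eq]
      exact hq.intervalIntegrable _ _
    · exact Eventually.of_forall fun s _ => h1 s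
  have h3 : ∀ n : ℤ, HasSum (fun m : ℤ => ‖∫ s in -A..A, expChar A m s * c n s‖ ^ 2)
      (2 * A * ∫ s in -A..A, ‖c n s‖ ^ 2) := fun n => hasSum_sq_norm_integral_expChar hA (hc n)
  have hterm : (fun k : ℤ × ℤ =>
        ‖∫ s in -A..A, ∫ v in -B..B, expChar B k.1 v * expChar A k.2 s * w (s, v)‖ ^ 2)
      = fun k : ℤ × ℤ => ‖∫ s in -A..A, expChar A k.2 s * c k.1 s‖ ^ 2 := by
    funext k
    congr 3
    funext s
    rw [← intervalIntegral.integral_const_mul]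
    congr 1
    funext v
    ring
  have hval : 4 * A * B * ∫ s in -A..A, ∫ v in -B..B, ‖w (s, v)‖ ^ 2
      = 2 * A * ∫ s in -A..A, q s := by
    simp only [q]
    rw [intervalIntegral.integral_const_mul]
    ring
  rw [hterm, hval]
  have h4 := h2.mul_left (2 * A)
  have hs : Summable (fun k : ℤ × ℤ => ‖∫ s in -A..A, expChar A k.2 s * c k.1 s‖ ^ 2) := by
    rw [summable_prod_of_nonneg (fun k => by positivity)]
    refine ⟨fun n => (h3 n).summable, ?_⟩
    simp only [fun n => (h3 n).tsum_eq]
    exact h4.summable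
  have h5 := hs.hasSum.prod_fiberwise h3
  rw [h4.unique h5]
  exact hs.hasSum

/-- The substitution `s = x + y`, `v = y - x`, whose inverse has determinant `1/2`. The support
condition truncates both integrals. -/
theorem integral_eq_integral_rotated {E : Type*} [NormedAddCommGroup E] [NormedSpace ℝ E]
    {A B : ℝ} (hA : 0 < A) (hB : 0 < B) {g : ℝ × ℝ → E} (hg : Continuous g)
    (hsupp : ∀ p, g p ≠ 0 → |p.1 + p.2| ≤ A ∧ |p.2 - p.1| ≤ B) :
    ∫ p, g p = (1 / 2 : ℝ) • ∫ s in -A..A, ∫ v in -B..B, g ((s - v) / 2, (s + v) / 2) := by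
  let M : Matrix (Fin 2) (Fin 2) ℝ := !![1 / 2, -(1 / 2); 1 / 2, 1 / 2]
  let T : ℝ × ℝ →L[ℝ] ℝ × ℝ := LinearMap.toContinuousLinearMap
    (Matrix.toLin (Module.Basis.finTwoProd ℝ) (Module.Basis.finTwoProd ℝ) M)
  have hT : ∀ q : ℝ × ℝ, T q = ((q.1 - q.2) / 2, (q.1 + q.2) / 2) := by
    intro q
    simp only [T, M, LinearMap.coe_toContinuousLinearMap', Matrix.toLin_finTwoProd_apply]
    ext <;> simp <;> ring
  have hdet : T.det = 1 / 2 := by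
    simp only [T, M, ContinuousLinearMap.det, LinearMap.det_toContinuousLinearMap,
      LinearMap.det_toLin, Matrix.det_fin_two_of]
    norm_num
  have hinj : Function.Injective T := by
    intro a b h
    rw [hT, hT, Prod.mk.injEq] at h
    ext <;> linarith [h.1, h.2]
  have hsurj : T '' Set.univ = Set.univ := by
    rw [Set.image_univ, Set.range_eq_univ]
    intro p
    refine ⟨(p.1 + p.2, p.2 - p.1), ?_⟩
    rw [hT]
    ext <;> simp <;> ring
  have h1 := integral_image_eq_integral_abs_det_fderiv_smul volume MeasurableSet.univ
    (fun x _ => T.hasFDerivWithinAt (s := Set.univ) (x := x)) hinj.injOn g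
  rw [hsurj, setIntegral_univ, setIntegral_univ, hdet, abs_of_pos (by norm_num : (0 : ℝ) < 1 / 2),
    integral_smul] at h1
  rw [h1]
  congr 1
  simp only [hT]
  let w : ℝ × ℝ → E := fun q => g ((q.1 - q.2) / 2, (q.1 + q.2) / 2)
  have hw : Continuous w := by fun_prop
  have hws : ∀ q, w q ≠ 0 → |q.1| ≤ A ∧ |q.2| ≤ B := by
    intro q hq
    have := hsupp _ hq
    simp only at this
    rwa [show (q.1 - q.2) / 2 + (q.1 + q.2) / 2 = q.1 by ring,
      show (q.1 + q.2) / 2 - (q.1 - q.2) / 2 = q.2 by ring] at this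
  have hcs : HasCompactSupport w := by
    refine HasCompactSupport.of_support_subset_isCompact
      (isCompact_Icc.prod isCompact_Icc : IsCompact (Set.Icc (-A) A ×ˢ Set.Icc (-B) B)) ?_
    intro q hq
    exact ⟨abs_le.1 (hws q hq).1, abs_le.1 (hws q hq).2⟩
  change ∫ q, w q = _
  rw [Measure.volume_eq_prod, integral_prod _ (hw.integrable_of_hasCompactSupport hcs)]
  rw [intervalIntegral.integral_of_le (by linarith), ← integral_Icc_eq_integral_Ioc,
    setIntegral_eq_integral_of_forall_compl_eq_zero]
  · congr 1
    funext s
    rw [intervalIntegral.integral_of_le (by linarith), ← integral_Icc_eq_integral_Ioc,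
      setIntegral_eq_integral_of_forall_compl_eq_zero]
    intro v hv
    by_contra h
    exact hv (abs_le.1 (hws (s, v) h).2)
  · intro s hs
    have : ∀ v, w (s, v) = 0 := by
      intro v
      by_contra h
      exact hs (abs_le.1 (hws (s, v) h).1)
    change ∫ v in -B..B, w (s, v) = 0
    simp [this]

/-- The characters of the rectangle `|x + y| ≤ A`, `|y - x| ≤ B`. -/
def planeWave (A B : ℝ) (k : ℤ × ℤ) (p : ℝ × ℝ) : ℂ :=
  expChar B k.1 (p.2 - p.1) * expChar A k.2 (p.1 + p.2)

theorem continuous_planeWave (A B : ℝ) (k : ℤ × ℤ) : Continuous (planeWave A B k) := by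
  have h1 := continuous_expChar B k.1
  have h2 := continuous_expChar A k.2
  unfold planeWave
  fun_prop

theorem hasSum_sq_norm_integral_planeWave {A B : ℝ} (hA : 0 < A) (hB : 0 < B)
    {g : ℝ × ℝ → ℂ} (hg : Continuous g)
    (hsupp : ∀ p, g p ≠ 0 → |p.1 + p.2| ≤ A ∧ |p.2 - p.1| ≤ B) :
    HasSum (fun k : ℤ × ℤ => ‖∫ p, planeWave A B k p * g p‖ ^ 2)
      (2 * A * B * ∫ p, ‖g p‖ ^ 2) := by
  have h := (hasSum_sq_norm_integral_expChar_prod hA hB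
    (w := fun q => g ((q.1 - q.2) / 2, (q.1 + q.2) / 2)) (by fun_prop)).mul_left (1 / 4)
  convert! h using 1
  · funext k
    have hc := continuous_planeWave A B k
    rw [integral_eq_integral_rotated hA hB (by fun_prop)
      (fun p hp => hsupp p (right_ne_zero_of_mul hp)), norm_smul, mul_pow]
    congr 1
    · norm_num
    congr 3
    funext s
    congr 1
    funext v
    simp only [planeWave]
    rw [show (s - v) / 2 + (s + v) / 2 = s by ring,
      show (s + v) / 2 - (s - v) / 2 = v by ring]
  · rw [integral_eq_integral_rotated hA hB (by fun_prop)
      (fun p hp => hsupp p (fun h => hp (by simp [h])))]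
    simp only [smul_eq_mul]
    ring

/-! ### The energy form from below -/

/-- The Laplace eigenvalue of `planeWave A B k`. -/
def waveEnergy (A B : ℝ) (k : ℤ × ℤ) : ℝ :=
  2 * Real.pi ^ 2 * ((k.1 : ℝ) ^ 2 / B ^ 2 + (k.2 : ℝ) ^ 2 / A ^ 2)

theorem planeWave_eq (A B : ℝ) (k : ℤ × ℤ) (p : ℝ × ℝ) :
    planeWave A B k p = Complex.exp
      (-(((Real.pi * (k.2 / A - k.1 / B) : ℝ) * p.1 + (Real.pi * (k.2 / A + k.1 / B) : ℝ) * p.2)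
        * Complex.I)) := by
  rw [planeWave, expChar, expChar, ← Complex.exp_add]
  congr 1
  push_cast
  ring

theorem fderiv_planeWave (A B : ℝ) (k : ℤ × ℤ) (p w : ℝ × ℝ) :
    fderiv ℝ (planeWave A B k) p w = -(((Real.pi * (k.2 / A - k.1 / B) : ℝ) * w.1
      + (Real.pi * (k.2 / A + k.1 / B) : ℝ) * w.2) * Complex.I) * planeWave A B k p := by
  have h1 : HasFDerivAt (fun p : ℝ × ℝ => (p.1 : ℂ))
      (Complex.ofRealCLM ∘L ContinuousLinearMap.fst ℝ ℝ ℝ) p :=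
    (Complex.ofRealCLM ∘L ContinuousLinearMap.fst ℝ ℝ ℝ).hasFDerivAt
  have h2 : HasFDerivAt (fun p : ℝ × ℝ => (p.2 : ℂ))
      (Complex.ofRealCLM ∘L ContinuousLinearMap.snd ℝ ℝ ℝ) p :=
    (Complex.ofRealCLM ∘L ContinuousLinearMap.snd ℝ ℝ ℝ).hasFDerivAt
  have h3 := ((((h1.const_mul ((Real.pi * (k.2 / A - k.1 / B) : ℝ) : ℂ)).add
    (h2.const_mul ((Real.pi * (k.2 / A + k.1 / B) : ℝ) : ℂ))).mul_const Complex.I).neg).cexp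
  have h4 : planeWave A B k = fun p => Complex.exp
      (-(((Real.pi * (k.2 / A - k.1 / B) : ℝ) * p.1 + (Real.pi * (k.2 / A + k.1 / B) : ℝ) * p.2)
        * Complex.I)) := funext (planeWave_eq A B k)
  rw [h4]
  refine (congrFun (congrArg DFunLike.coe h3.fderiv) w).trans ?_
  simp
  ring

theorem differentiable_planeWave (A B : ℝ) (k : ℤ × ℤ) : Differentiable ℝ (planeWave A B k) := by
  unfold planeWave expChar
  fun_prop

/-- The Fourier coefficients of a function on a rotated rectangle. -/
def waveCoeff (A B : ℝ) (g : ℝ × ℝ → ℂ) (k : ℤ × ℤ) : ℂ := ∫ p, planeWave A B k p * g p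

theorem continuous_fderiv_apply {u : ℝ × ℝ → ℂ} (hu : ContDiff ℝ ∞ u) (w : ℝ × ℝ) :
    Continuous (fun p => fderiv ℝ u p w) :=
  (hu.continuous_fderiv (by simp)).clm_apply continuous_const

theorem hasCompactSupport_fderiv_apply {u : ℝ × ℝ → ℂ} (hc : HasCompactSupport u) (w : ℝ × ℝ) :
    HasCompactSupport (fun p => fderiv ℝ u p w) :=
  hc.fderiv_apply ℝ w

/-- Integration by parts; compact support removes the boundary terms although the plane waves vanish
nowhere. -/
theorem waveCoeff_fderiv (A B : ℝ) {u : ℝ × ℝ → ℂ} (hu : ContDiff ℝ ∞ u)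
    (hc : HasCompactSupport u) (w : ℝ × ℝ) (k : ℤ × ℤ) :
    waveCoeff A B (fun p => fderiv ℝ u p w) k =
      (((Real.pi * (k.2 / A - k.1 / B) * w.1 + Real.pi * (k.2 / A + k.1 / B) * w.2 : ℝ) : ℂ)
        * Complex.I) * waveCoeff A B u k := by
  have hpw := continuous_planeWave A B k
  have hud : Differentiable ℝ u := hu.differentiable (by simp)
  unfold waveCoeff
  rw [integral_mul_fderiv_eq_neg_fderiv_mul_of_integrable]
  · simp only [fderiv_planeWave]
    rw [← integral_const_mul, ← integral_neg]
    congr 1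
    funext p
    push_cast
    ring
  · simp only [fderiv_planeWave]
    exact Continuous.integrable_of_hasCompactSupport (by have := hu.continuous; fun_prop)
      hc.mul_left
  · exact Continuous.integrable_of_hasCompactSupport
      (hpw.mul (continuous_fderiv_apply hu w)) (hasCompactSupport_fderiv_apply hc w).mul_left
  · exact Continuous.integrable_of_hasCompactSupport (hpw.mul hu.continuous) hc.mul_left
  · exact fun p _ => differentiable_planeWave A B k p
  · exact fun p _ => hud p

/-- Parseval for both partial derivatives. The squared wave numbers `π(k₂/A ∓ k₁/B)` add up to
`waveEnergy`, since the cross terms cancel. -/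
theorem hasSum_waveEnergy_mul {A B : ℝ} (hA : 0 < A) (hB : 0 < B) {u : ℝ × ℝ → ℂ}
    (hu : ContDiff ℝ ∞ u) (hc : HasCompactSupport u)
    (hsupp : ∀ p ∈ tsupport u, |p.1 + p.2| ≤ A ∧ |p.2 - p.1| ≤ B) :
    HasSum (fun k : ℤ × ℤ => waveEnergy A B k * ‖waveCoeff A B u k‖ ^ 2)
      (2 * A * B * ((∫ p, ‖fderiv ℝ u p (1, 0)‖ ^ 2) + ∫ p, ‖fderiv ℝ u p (0, 1)‖ ^ 2)) := by
  have hs : ∀ w : ℝ × ℝ, ∀ p, fderiv ℝ u p w ≠ 0 → |p.1 + p.2| ≤ A ∧ |p.2 - p.1| ≤ B := by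
    intro w p hp
    refine hsupp p (support_fderiv_subset ℝ ?_)
    intro h
    exact hp (by rw [h]; rfl)
  have h := (hasSum_sq_norm_integral_planeWave hA hB (continuous_fderiv_apply hu (1, 0))
    (hs _)).add (hasSum_sq_norm_integral_planeWave hA hB (continuous_fderiv_apply hu (0, 1)) (hs _))
  convert! h using 1
  · funext k
    change _ = ‖waveCoeff A B (fun p => fderiv ℝ u p (1, 0)) k‖ ^ 2
      + ‖waveCoeff A B (fun p => fderiv ℝ u p (0, 1)) k‖ ^ 2
    rw [waveCoeff_fderiv A B hu hc, waveCoeff_fderiv A B hu hc]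
    simp only [norm_mul, mul_pow, Complex.norm_real, Complex.norm_I, Real.norm_eq_abs, sq_abs,
      waveEnergy]
    field_simp
    ring
  · ring

/-! ### Odd reflection and the sine modes of the circumscribed rectangle -/

/-- Reflection of the plane in the line `x + y = 0`. -/
def antiReflect (p : ℝ × ℝ) : ℝ × ℝ := (-p.2, -p.1)

theorem antiReflect_antiReflect (p : ℝ × ℝ) : antiReflect (antiReflect p) = p := by
  simp [antiReflect]

theorem contDiff_antiReflect : ContDiff ℝ ∞ antiReflect := by
  unfold antiReflect
  fun_prop

theorem continuous_antiReflect : Continuous antiReflect := contDiff_antiReflect.continuous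

theorem hasCompactSupport_comp_antiReflect {u : ℝ × ℝ → ℂ} (hc : HasCompactSupport u) :
    HasCompactSupport fun p => u (antiReflect p) := by
  let e : ℝ × ℝ ≃ₜ ℝ × ℝ :=
    { toFun := antiReflect, invFun := antiReflect, left_inv := antiReflect_antiReflect,
      right_inv := antiReflect_antiReflect, continuous_toFun := continuous_antiReflect,
      continuous_invFun := continuous_antiReflect }
  exact hc.comp_homeomorph e

theorem integral_comp_swap {E : Type*} [NormedAddCommGroup E] [NormedSpace ℝ E] (f : ℝ × ℝ → E) :
    ∫ p : ℝ × ℝ, f p.swap = ∫ p, f p :=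
  integral_prod_swap f

theorem integral_comp_antiReflect {E : Type*} [NormedAddCommGroup E] [NormedSpace ℝ E]
    (f : ℝ × ℝ → E) : ∫ p, f (antiReflect p) = ∫ p, f p := by
  rw [← integral_comp_swap f, ← integral_neg_eq_self (fun p : ℝ × ℝ => f p.swap)]
  rfl

theorem planeWave_swap (A B : ℝ) (k : ℤ × ℤ) (p : ℝ × ℝ) :
    planeWave A B k p.swap = planeWave A B (-k.1, k.2) p := by
  rw [planeWave_eq, planeWave_eq]
  congr 1
  push_cast [Prod.fst_swap, Prod.snd_swap]
  ring

theorem planeWave_antiReflect (A B : ℝ) (k : ℤ × ℤ) (p : ℝ × ℝ) :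
    planeWave A B k (antiReflect p) = planeWave A B (k.1, -k.2) p := by
  rw [planeWave_eq, planeWave_eq]
  congr 1
  simp only [antiReflect]
  push_cast
  ring

theorem waveCoeff_neg_fst {A B : ℝ} {g : ℝ × ℝ → ℂ} (hg : ∀ p, g p.swap = - g p) (k : ℤ × ℤ) :
    waveCoeff A B g (-k.1, k.2) = - waveCoeff A B g k := by
  unfold waveCoeff
  rw [← integral_comp_swap (fun p => planeWave A B k p * g p), ← integral_neg]
  simp only [planeWave_swap, hg, mul_neg, neg_neg]

theorem waveCoeff_neg_snd {A B : ℝ} {g : ℝ × ℝ → ℂ} (hg : ∀ p, g (antiReflect p) = - g p)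
    (k : ℤ × ℤ) : waveCoeff A B g (k.1, -k.2) = - waveCoeff A B g k := by
  unfold waveCoeff
  rw [← integral_comp_antiReflect (fun p => planeWave A B k p * g p), ← integral_neg]
  simp only [planeWave_antiReflect, hg, mul_neg, neg_neg]

/-- The two oddnesses flip the sign of the coefficient under `k.1 ↦ -k.1` and `k.2 ↦ -k.2`. So a
coefficient with a zero index vanishes, and the others repeat those of the positive quadrant, which
`ℕ × ℕ` parametrises with a shift by one. -/
theorem norm_waveCoeff_le_of_odd {A B : ℝ} {g : ℝ × ℝ → ℂ} (h1 : ∀ p, g p.swap = - g p)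
    (h2 : ∀ p, g (antiReflect p) = - g p) (k : ℤ × ℤ) :
    waveCoeff A B g k = 0 ∨ ∃ p : ℕ × ℕ, k.1 ^ 2 = ((p.1 : ℤ) + 1) ^ 2 ∧
      k.2 ^ 2 = ((p.2 : ℤ) + 1) ^ 2 ∧
      ‖waveCoeff A B g k‖ = ‖waveCoeff A B g ((p.1 : ℤ) + 1, (p.2 : ℤ) + 1)‖ := by
  have e1 : ∀ k, ‖waveCoeff A B g (-k.1, k.2)‖ = ‖waveCoeff A B g k‖ := fun k => by
    rw [waveCoeff_neg_fst h1, norm_neg]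
  have e2 : ∀ k, ‖waveCoeff A B g (k.1, -k.2)‖ = ‖waveCoeff A B g k‖ := fun k => by
    rw [waveCoeff_neg_snd h2, norm_neg]
  obtain ⟨a, b⟩ := k
  by_cases ha : a = 0
  · left
    have := waveCoeff_neg_fst (A := A) (B := B) h1 (a, b)
    subst ha
    simpa using self_eq_neg.1 (by simpa using this)
  by_cases hb : b = 0
  · left
    have := waveCoeff_neg_snd (A := A) (B := B) h2 (a, b)
    subst hb
    simpa using self_eq_neg.1 (by simpa using this)
  right
  refine ⟨(a.natAbs - 1, b.natAbs - 1), ?_, ?_, ?_⟩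
  · rw [show ((a.natAbs - 1 : ℕ) : ℤ) + 1 = |a| by rw [Int.abs_eq_natAbs]; omega, sq_abs]
  · rw [show ((b.natAbs - 1 : ℕ) : ℤ) + 1 = |b| by rw [Int.abs_eq_natAbs]; omega, sq_abs]
  · rw [show ((a.natAbs - 1 : ℕ) : ℤ) + 1 = |a| by rw [Int.abs_eq_natAbs]; omega,
      show ((b.natAbs - 1 : ℕ) : ℤ) + 1 = |b| by rw [Int.abs_eq_natAbs]; omega]
    rcases abs_choice a with h | h <;> rcases abs_choice b with h' | h' <;> rw [h, h']
    · exact (e2 (a, b)).symm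
    · exact (e1 (a, b)).symm
    · rw [e2 (-a, b), e1 (a, b)]

/-- Eigenvalues of the Dirichlet Laplacian on the antisymmetric functions on the rotated rectangle
`|y - x| ≤ d`, `0 ≤ x + y ≤ 2ℓ`. -/
def rectEigenvalue (d l : ℝ) (p : ℕ × ℕ) : ℝ :=
  2 * Real.pi ^ 2 * ((p.1 : ℝ) + 1) ^ 2 / d ^ 2
    + (Real.pi / (Real.sqrt 2 * l) * ((p.2 : ℝ) + 1)) ^ 2

theorem rectEigenvalue_eq_waveEnergy (d l : ℝ) (p : ℕ × ℕ) :
    rectEigenvalue d l p = waveEnergy (2 * l) d ((p.1 : ℤ) + 1, (p.2 : ℤ) + 1) := by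
  simp only [rectEigenvalue, waveEnergy, mul_pow, div_pow]
  rw [Real.sq_sqrt (by norm_num)]
  push_cast
  ring

theorem finite_setOf_waveEnergy_lt {A B : ℝ} (hA : 0 < A) (hB : 0 < B) (t : ℝ) :
    {k : ℤ × ℤ | waveEnergy A B k < t}.Finite := by
  have hpi := Real.pi_pos
  obtain ⟨M, hM⟩ := exists_nat_gt (t * B ^ 2 / (2 * Real.pi ^ 2) + t * A ^ 2 / (2 * Real.pi ^ 2))
  refine Set.Finite.subset ((Set.finite_Icc (-(M : ℤ)) M).prod (Set.finite_Icc (-(M : ℤ)) M)) ?_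
  intro k hk
  change 2 * Real.pi ^ 2 * ((k.1 : ℝ) ^ 2 / B ^ 2 + (k.2 : ℝ) ^ 2 / A ^ 2) < t at hk
  have ht : 0 < t := lt_of_le_of_lt (by positivity) hk
  have key : ∀ (C : ℝ) (n : ℤ), 0 < C → 2 * Real.pi ^ 2 * ((n : ℝ) ^ 2 / C ^ 2) < t →
      t * C ^ 2 / (2 * Real.pi ^ 2) ≤ M → n ∈ Set.Icc (-(M : ℤ)) M := by
    intro C n hC hn hCM
    have h1 : (n : ℝ) ^ 2 < t * C ^ 2 / (2 * Real.pi ^ 2) := by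
      rw [lt_div_iff₀ (by positivity)]
      rw [mul_div_assoc', div_lt_iff₀ (by positivity)] at hn
      linarith
    have h2 : (n ^ 2 : ℤ) ≤ M := by
      have : ((n ^ 2 : ℤ) : ℝ) ≤ ((M : ℤ) : ℝ) := by push_cast; linarith
      exact_mod_cast this
    have h3 : |n| ≤ n ^ 2 := by
      rw [← sq_abs]
      exact Int.le_self_sq |n|
    exact abs_le.1 (h3.trans h2)
  refine ⟨key B k.1 hB ?_ ?_, key A k.2 hA ?_ ?_⟩
  · refine lt_of_le_of_lt ?_ hk
    gcongr
    exact le_add_of_nonneg_right (by positivity)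
  · have : 0 ≤ t * A ^ 2 / (2 * Real.pi ^ 2) := by positivity
    linarith
  · refine lt_of_le_of_lt ?_ hk
    gcongr
    exact le_add_of_nonneg_left (by positivity)
  · have : 0 ≤ t * B ^ 2 / (2 * Real.pi ^ 2) := by positivity
    linarith

theorem finite_setOf_rectEigenvalue_lt {d l : ℝ} (hd : 0 < d) (hl : 0 < l) (t : ℝ) :
    {p : ℕ × ℕ | rectEigenvalue d l p < t}.Finite := by
  have h := finite_setOf_waveEnergy_lt (by positivity : 0 < 2 * l) hd t
  refine (h.preimage (f := fun p : ℕ × ℕ => ((p.1 : ℤ) + 1, (p.2 : ℤ) + 1)) ?_).subset ?_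
  · rintro ⟨a, b⟩ - ⟨a', b'⟩ - h
    simp only [Prod.mk.injEq] at h ⊢
    omega
  · intro p hp
    change rectEigenvalue d l p < t at hp
    rw [rectEigenvalue_eq_waveEnergy] at hp
    exact hp

theorem interior_pairRegion_subset (d L : ℝ) :
    interior (pairRegion d L) ⊆ Set.Ioo 0 L ×ˢ Set.Ioo 0 L := by
  have := interior_mono (pairRegion_subset_Icc d L)
  rwa [interior_prod_eq, interior_Icc] at this

/-- Functions supported on the two sides of the line `x + y = 0` are orthogonal. -/
theorem integral_norm_sq_add_comp_antiReflect {a b : ℝ × ℝ → ℂ} (ha : Continuous a)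
    (hb : Continuous b) (hac : HasCompactSupport a) (hbc : HasCompactSupport b)
    (ha0 : ∀ p, a p ≠ 0 → 0 < p.1 ∧ 0 < p.2) (hb0 : ∀ p, b p ≠ 0 → 0 < p.1 ∧ 0 < p.2) :
    ∫ p, ‖a p + b (antiReflect p)‖ ^ 2 = (∫ p, ‖a p‖ ^ 2) + ∫ p, ‖b p‖ ^ 2 := by
  have hint : ∀ {g : ℝ × ℝ → ℂ}, Continuous g → HasCompactSupport g →
      Integrable (fun p => ‖g p‖ ^ 2) := by
    intro g hg hgc
    refine Continuous.integrable_of_hasCompactSupport (hg.norm.pow 2) ?_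
    exact hgc.comp_left (g := fun z : ℂ => ‖z‖ ^ 2) (by simp)
  have hbR : Continuous fun p => b (antiReflect p) := hb.comp continuous_antiReflect
  have hbRc : HasCompactSupport fun p => b (antiReflect p) := hasCompactSupport_comp_antiReflect hbc
  rw [← integral_comp_antiReflect (fun p => ‖b p‖ ^ 2), ← integral_add (hint ha hac) (hint hbR hbRc)]
  congr 1
  funext p
  by_cases h : a p = 0
  · simp [h]
  · have : b (antiReflect p) = 0 := by
      by_contra h'
      have h1 := ha0 p h
      have h2 := hb0 _ h'
      simp only [antiReflect] at h2
      linarith [h1.1, h2.2]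
    simp [this]

/-- Shifts the reflection from the function to the wave, so that the coefficient becomes a pairing
with `u` itself and hence a bounded functional on `L²(Ω_L)`. -/
theorem waveCoeff_sub_antiReflect {A B : ℝ} {u : ℝ × ℝ → ℂ} (hu : Continuous u)
    (hc : HasCompactSupport u) (k : ℤ × ℤ) :
    waveCoeff A B (fun p => u p - u (antiReflect p)) k
      = ∫ p, (planeWave A B k p - planeWave A B k (antiReflect p)) * u p := by
  have hpw := continuous_planeWave A B k
  have hR := continuous_antiReflect
  have i1 : Integrable (fun p => planeWave A B k p * u p) :=
    Continuous.integrable_of_hasCompactSupport (by fun_prop) hc.mul_left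
  have i2 : Integrable (fun p => planeWave A B k (antiReflect p) * u p) :=
    Continuous.integrable_of_hasCompactSupport (by fun_prop) hc.mul_left
  have hcR : HasCompactSupport fun p => u (antiReflect p) := hasCompactSupport_comp_antiReflect hc
  have i3 : Integrable (fun p => planeWave A B k p * u (antiReflect p)) :=
    Continuous.integrable_of_hasCompactSupport (by fun_prop) hcR.mul_left
  unfold waveCoeff
  simp only [mul_sub, sub_mul]
  rw [integral_sub i1 i3, integral_sub i1 i2,
    ← integral_comp_antiReflect (fun p => planeWave A B k p * u (antiReflect p))]
  simp only [antiReflect_antiReflect]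

theorem IsPairTest.mem_region {d L : ℝ} {u : ℝ × ℝ → ℂ} (hu : IsPairTest d L u) {p : ℝ × ℝ}
    (hp : p ∈ tsupport u) : p ∈ pairRegion d L ∧ 0 < p.1 ∧ 0 < p.2 := by
  have h := hu.support hp
  have h' := interior_pairRegion_subset d L h
  exact ⟨interior_subset h, h'.1.1, h'.2.1⟩

theorem IsPairTest.mem_region_of_ne {d L : ℝ} {u : ℝ × ℝ → ℂ} (hu : IsPairTest d L u) {p : ℝ × ℝ}
    (hp : u p ≠ 0) : p ∈ pairRegion d L ∧ 0 < p.1 ∧ 0 < p.2 :=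
  hu.mem_region (subset_tsupport u hp)

theorem IsPairTest.mem_region_of_fderiv_ne {d L : ℝ} {u : ℝ × ℝ → ℂ} (hu : IsPairTest d L u)
    (w : ℝ × ℝ) {p : ℝ × ℝ} (hp : fderiv ℝ u p w ≠ 0) :
    p ∈ pairRegion d L ∧ 0 < p.1 ∧ 0 < p.2 := by
  refine hu.mem_region (support_fderiv_subset ℝ ?_)
  intro h
  exact hp (by rw [h]; rfl)

/-- The odd reflection of a function in the line `x + y = 0`. -/
def oddExtension (u : ℝ × ℝ → ℂ) (p : ℝ × ℝ) : ℂ := u p - u (antiReflect p)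

theorem fderiv_oddExtension {u : ℝ × ℝ → ℂ} (hu : Differentiable ℝ u) (p w : ℝ × ℝ) :
    fderiv ℝ (oddExtension u) p w
      = fderiv ℝ u p w - fderiv ℝ u (antiReflect p) (antiReflect w) := by
  let R : ℝ × ℝ →L[ℝ] ℝ × ℝ :=
    (-ContinuousLinearMap.snd ℝ ℝ ℝ).prod (-ContinuousLinearMap.fst ℝ ℝ ℝ)
  have h1 : HasFDerivAt (fun p => u (antiReflect p)) ((fderiv ℝ u (antiReflect p)) ∘L R) p :=
    HasFDerivAt.comp p (hu (antiReflect p)).hasFDerivAt R.hasFDerivAt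
  have h2 := (hu p).hasFDerivAt.sub h1
  exact congrFun (congrArg DFunLike.coe h2.fderiv) w

/-- The lower bound for the energy form of test functions, up to finitely many modes. -/
theorem exists_energy_ge_pairTest {d L : ℝ} (hd : 0 < d) (hL : 0 < L) {t : ℝ} (ht : 0 ≤ t) :
    ∃ K : ℝ, 0 ≤ K ∧ ∀ u, IsPairTest d L u → t * ∫ p, ‖u p‖ ^ 2 ≤
      (∫ p, ‖fderiv ℝ u p (1, 0)‖ ^ 2) + (∫ p, ‖fderiv ℝ u p (0, 1)‖ ^ 2)
      + K * ∑ p ∈ (finite_setOf_rectEigenvalue_lt hd hL t).toFinset,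
        ‖waveCoeff (2 * L) d (oddExtension u) ((p.1 : ℤ) + 1, (p.2 : ℤ) + 1)‖ ^ 2 := by
  have hA : 0 < 2 * L := by positivity
  let S := (finite_setOf_waveEnergy_lt hA hd t).toFinset
  -- Parseval on `|x + y| ≤ 2L`, `|y - x| ≤ d` carries the factor `2(2L)d`, and reflection doubles
  -- every integral; this accounts for `4(2L)d`. Each of the `S.card` waves below `t` costs at most
  -- `t Q`.
  refine ⟨t * S.card / (4 * (2 * L) * d), by positivity, fun u hu => ?_⟩
  have huc := hu.smooth.continuous
  have hud := hu.differentiable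
  set U := oddExtension u with hU
  have hUs : ContDiff ℝ ∞ U := hu.smooth.sub (hu.smooth.comp contDiff_antiReflect)
  have hUc : HasCompactSupport U := hu.compact.sub (hasCompactSupport_comp_antiReflect hu.compact)
  have hsupp : ∀ p ∈ tsupport U, |p.1 + p.2| ≤ 2 * L ∧ |p.2 - p.1| ≤ d := by
    have hcl : IsClosed {p : ℝ × ℝ | |p.1 + p.2| ≤ 2 * L ∧ |p.2 - p.1| ≤ d} := by
      simp only [Set.ofPred_and]
      exact (isClosed_le (by fun_prop) (by fun_prop)).inter
        (isClosed_le (by fun_prop) (by fun_prop))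
    refine closure_minimal ?_ hcl
    intro p hp
    have key : ∀ q, u q ≠ 0 → |q.1 + q.2| ≤ 2 * L ∧ |q.2 - q.1| ≤ d := by
      intro q hq
      obtain ⟨⟨h1, h2, h3, h4, h5⟩, -⟩ := hu.mem_region_of_ne hq
      exact ⟨abs_le.2 ⟨by linarith, by linarith⟩, by rwa [abs_sub_comm]⟩
    by_cases h : u p = 0
    · have h' : u (antiReflect p) ≠ 0 := by
        intro h'
        exact hp (by simp [hU, oddExtension, h, h'])
      have := key _ h'
      simp only [antiReflect] at this
      refine ⟨?_, ?_⟩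
      · rw [← abs_neg]
        convert this.1 using 2
        ring
      · convert this.2 using 2
        ring
    · exact key p h
  have e1 := hasSum_waveEnergy_mul hA hd hUs hUc hsupp
  have e2 : HasSum (fun k => ‖waveCoeff (2 * L) d U k‖ ^ 2) (2 * (2 * L) * d * ∫ p, ‖U p‖ ^ 2) :=
    hasSum_sq_norm_integral_planeWave hA hd hUs.continuous
      (fun p hp => hsupp p (subset_tsupport U hp))
  have n0 : ∫ p, ‖U p‖ ^ 2 = 2 * ∫ p, ‖u p‖ ^ 2 := by
    have := integral_norm_sq_add_comp_antiReflect huc huc.neg hu.compact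
      (hu.compact.comp_left (g := Neg.neg) neg_zero)
      (fun p hp => (hu.mem_region_of_ne hp).2)
      (fun p hp => (hu.mem_region_of_ne (neg_ne_zero.1 hp)).2)
    simp only [Pi.neg_apply, norm_neg, ← sub_eq_add_neg] at this
    rw [two_mul]
    exact this
  have cd := continuous_fderiv_apply hu.smooth
  have cc := hasCompactSupport_fderiv_apply hu.compact
  have n1 : (∫ p, ‖fderiv ℝ U p (1, 0)‖ ^ 2) + ∫ p, ‖fderiv ℝ U p (0, 1)‖ ^ 2
      = 2 * ((∫ p, ‖fderiv ℝ u p (1, 0)‖ ^ 2) + ∫ p, ‖fderiv ℝ u p (0, 1)‖ ^ 2) := by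
    have m1 := integral_norm_sq_add_comp_antiReflect (cd (1, 0)) (cd (0, 1)) (cc _) (cc _)
      (fun p hp => (hu.mem_region_of_fderiv_ne _ hp).2)
      (fun p hp => (hu.mem_region_of_fderiv_ne _ hp).2)
    have m2 := integral_norm_sq_add_comp_antiReflect (cd (0, 1)) (cd (1, 0)) (cc _) (cc _)
      (fun p hp => (hu.mem_region_of_fderiv_ne _ hp).2)
      (fun p hp => (hu.mem_region_of_fderiv_ne _ hp).2)
    -- The reflection exchanges the two partial derivatives with a sign, which the odd extension
    -- turns into a plus. Only the sum of the two energies is therefore seen to double.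
    have w1 : ∀ p, fderiv ℝ U p (1, 0) = fderiv ℝ u p (1, 0) + fderiv ℝ u (antiReflect p) (0, 1) := by
      intro p
      rw [hU, fderiv_oddExtension hud, sub_eq_add_neg, ← map_neg]
      simp [antiReflect]
    have w2 : ∀ p, fderiv ℝ U p (0, 1) = fderiv ℝ u p (0, 1) + fderiv ℝ u (antiReflect p) (1, 0) := by
      intro p
      rw [hU, fderiv_oddExtension hud, sub_eq_add_neg, ← map_neg]
      simp [antiReflect]
    simp only [w1, w2]
    rw [m1, m2]
    ring
  rw [n1] at e1
  rw [n0] at e2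
  set Q := ∑ p ∈ (finite_setOf_rectEigenvalue_lt hd hL t).toFinset,
        ‖waveCoeff (2 * L) d U ((p.1 : ℤ) + 1, (p.2 : ℤ) + 1)‖ ^ 2 with hQ
  have hQ0 : 0 ≤ Q := Finset.sum_nonneg fun p _ => by positivity
  have hodd1 : ∀ p, U p.swap = - U p := by
    intro p
    have h1 := hu.antisymm p
    have h2 := hu.antisymm (antiReflect p)
    have h3 : antiReflect p.swap = (antiReflect p).swap := rfl
    simp only [hU, oddExtension, h3]
    rw [h1, h2]
    ring
  have hodd2 : ∀ p, U (antiReflect p) = - U p := by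
    intro p
    simp only [hU, oddExtension, antiReflect_antiReflect]
    ring
  have hle : ∀ k ∈ S, ‖waveCoeff (2 * L) d U k‖ ^ 2 ≤ Q := by
    intro k hk
    have hk' : waveEnergy (2 * L) d k < t :=
      (Set.Finite.mem_toFinset (finite_setOf_waveEnergy_lt hA hd t)).1 hk
    rcases norm_waveCoeff_le_of_odd (A := 2 * L) (B := d) hodd1 hodd2 k with h | ⟨p, hp1, hp2, h⟩
    · rw [h]; simpa using hQ0
    · rw [h]
      refine Finset.single_le_sum (f := fun p : ℕ × ℕ =>
        ‖waveCoeff (2 * L) d U ((p.1 : ℤ) + 1, (p.2 : ℤ) + 1)‖ ^ 2)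
        (fun p _ => by positivity) ((Set.Finite.mem_toFinset _).2 ?_)
      change rectEigenvalue d L p < t
      have h1 : (k.1 : ℝ) ^ 2 = (((p.1 : ℤ) + 1 : ℤ) : ℝ) ^ 2 := by exact_mod_cast hp1
      have h2 : (k.2 : ℝ) ^ 2 = (((p.2 : ℤ) + 1 : ℤ) : ℝ) ^ 2 := by exact_mod_cast hp2
      rw [rectEigenvalue_eq_waveEnergy, waveEnergy]
      rw [waveEnergy, h1, h2] at hk'
      exact hk'
  have hsum := (e1.sub (e2.mul_left t))
  have hlow : -(t * (S.card * Q)) ≤ 2 * (2 * L) * d * (2 * ((∫ p, ‖fderiv ℝ u p (1, 0)‖ ^ 2)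
      + ∫ p, ‖fderiv ℝ u p (0, 1)‖ ^ 2)) - t * (2 * (2 * L) * d * (2 * ∫ p, ‖u p‖ ^ 2)) := by
    -- The terms `(waveEnergy - t)|c_k|²` outside `S` are nonnegative and may be dropped.
    have h1 := sum_le_hasSum S (fun k hk => by
      have hk' : ¬ waveEnergy (2 * L) d k < t := fun h => hk ((Set.Finite.mem_toFinset _).2 h)
      rw [← sub_mul]
      exact mul_nonneg (by linarith) (by positivity)) hsum
    refine le_trans ?_ h1
    rw [← nsmul_eq_mul, ← Finset.sum_const, Finset.mul_sum, ← Finset.sum_neg_distrib]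
    refine Finset.sum_le_sum fun k hk => ?_
    have h2 := hle k hk
    have h3 : 0 ≤ waveEnergy (2 * L) d k := by unfold waveEnergy; positivity
    have h4 : 0 ≤ waveEnergy (2 * L) d k * ‖waveCoeff (2 * L) d U k‖ ^ 2 := by positivity
    have h5 := mul_le_mul_of_nonneg_left h2 ht
    linarith
  have hpos : 0 < 4 * (2 * L) * d := by positivity
  rw [div_mul_eq_mul_div, ← sub_le_iff_le_add', le_div_iff₀ hpos]
  linarith

/-! ### From test functions to the form domain; compactness and the lower bound -/

/-- The restriction of an antisymmetric mode of the rectangle to `Ω_L`. -/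
def sineMode (d L : ℝ) (p : ℕ × ℕ) (q : ℝ × ℝ) : ℂ :=
  planeWave (2 * L) d ((p.1 : ℤ) + 1, (p.2 : ℤ) + 1) q
    - planeWave (2 * L) d ((p.1 : ℤ) + 1, (p.2 : ℤ) + 1) (antiReflect q)

theorem norm_planeWave (A B : ℝ) (k : ℤ × ℤ) (p : ℝ × ℝ) : ‖planeWave A B k p‖ = 1 := by
  rw [planeWave, norm_mul, norm_expChar, norm_expChar, one_mul]

/-- The conjugate compensates the conjugate-linearity of the inner product in its first slot, so
that `sineFunctional` integrates against the mode itself. -/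
theorem memLp_conj_sineMode (d L : ℝ) (p : ℕ × ℕ) :
    MemLp (fun q => (starRingEnd ℂ) (sineMode d L p q)) 2 (pairMeasure d L) := by
  have hc : Continuous (fun q => (starRingEnd ℂ) (sineMode d L p q)) := by
    have h1 := continuous_planeWave (2 * L) d ((p.1 : ℤ) + 1, (p.2 : ℤ) + 1)
    have h2 := continuous_antiReflect
    unfold sineMode
    exact Complex.continuous_conj.comp (by fun_prop)
  refine MemLp.of_bound hc.aestronglyMeasurable 2 (Eventually.of_forall fun q => ?_)
  rw [RCLike.norm_conj]
  refine (norm_sub_le _ _).trans ?_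
  rw [norm_planeWave, norm_planeWave]
  norm_num

/-- The coefficient of an element of `L²(Ω_L)` with respect to a mode of the rectangle. -/
def sineFunctional (d L : ℝ) (p : ℕ × ℕ) : PairL2 d L →L[ℂ] ℂ :=
  innerSL ℂ (memLp_conj_sineMode d L p).toLp

theorem sineFunctional_apply {d L : ℝ} (p : ℕ × ℕ) (φ : PairL2 d L) :
    sineFunctional d L p φ = ∫ q, sineMode d L p q * φ q ∂(pairMeasure d L) := by
  rw [sineFunctional, innerSL_apply_apply, L2.inner_def]
  refine integral_congr_ae ?_
  filter_upwards [(memLp_conj_sineMode d L p).coeFn_toLp] with q hq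
  rw [hq, RCLike.inner_apply, RCLike.conj_conj, mul_comm]

theorem norm_sq_pairL2 {d L : ℝ} (φ : PairL2 d L) :
    ‖φ‖ ^ 2 = ∫ q, ‖φ q‖ ^ 2 ∂(pairMeasure d L) := by
  have h : (inner ℂ φ φ).re = ‖φ‖ ^ 2 := inner_self_eq_norm_sq (𝕜 := ℂ) φ
  rw [← h, L2.inner_def]
  have h2 : ∀ q, inner ℂ (φ q) (φ q) = ((‖φ q‖ ^ 2 : ℝ) : ℂ) := fun q => by
    rw [inner_self_eq_norm_sq_to_K]
    push_cast
    rfl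
  simp only [h2]
  exact (congrArg Complex.re (integral_ofReal (𝕜 := ℂ))).trans (Complex.ofReal_re _)

theorem integral_pairMeasure_eq {d L : ℝ} {E : Type*} [NormedAddCommGroup E] [NormedSpace ℝ E]
    {g : ℝ × ℝ → E} (hg : ∀ p, g p ≠ 0 → p ∈ pairRegion d L) :
    ∫ q, g q ∂(pairMeasure d L) = ∫ q, g q := by
  rw [pairMeasure, setIntegral_eq_integral_of_forall_compl_eq_zero]
  intro q hq
  by_contra h
  exact hq (hg q h)

theorem norm_sq_pairL2_of_ae_eq {d L : ℝ} {φ : PairL2 d L} {g : ℝ × ℝ → ℂ}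
    (h : φ =ᵐ[pairMeasure d L] g) (hg : ∀ p, g p ≠ 0 → p ∈ pairRegion d L) :
    ‖φ‖ ^ 2 = ∫ q, ‖g q‖ ^ 2 := by
  rw [norm_sq_pairL2, ← integral_pairMeasure_eq (d := d) (L := L) (g := fun q => ‖g q‖ ^ 2)]
  · refine integral_congr_ae ?_
    filter_upwards [h] with q hq
    rw [hq]
  · intro p hp
    exact hg p fun h0 => hp (by simp [h0])

/-- The lower bound for the energy form, up to finitely many modes. -/
theorem exists_energy_ge {d L : ℝ} (hd : 0 < d) (hL : 0 < L) {t : ℝ} (ht : 0 ≤ t) :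
    ∃ K : ℝ, 0 ≤ K ∧ ∀ x : pairFormSpace d L, t * ‖(x : PairTriple d L) 0‖ ^ 2 ≤
      ‖(x : PairTriple d L) 1‖ ^ 2 + ‖(x : PairTriple d L) 2‖ ^ 2
      + K * ∑ p ∈ (finite_setOf_rectEigenvalue_lt hd hL t).toFinset,
        ‖sineFunctional d L p ((x : PairTriple d L) 0)‖ ^ 2 := by
  obtain ⟨K, hK, h⟩ := exists_energy_ge_pairTest hd hL ht
  refine ⟨K, hK, fun x => ?_⟩
  -- Both sides are continuous in the triple, the coefficients being bounded functionals on `L²`, so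
  -- the inequality passes from test functions to the closure.
  have hcl : IsClosed {s : PairL2 d L × PairL2 d L × PairL2 d L | t * ‖s.1‖ ^ 2 ≤
      ‖s.2.1‖ ^ 2 + ‖s.2.2‖ ^ 2 + K * ∑ p ∈ (finite_setOf_rectEigenvalue_lt hd hL t).toFinset,
        ‖sineFunctional d L p s.1‖ ^ 2} :=
    isClosed_le (by fun_prop) (by fun_prop)
  have hx : ((x : PairTriple d L) 0, (x : PairTriple d L) 1, (x : PairTriple d L) 2)
    ∈ pairFormGraph d L := x.2
  suffices hs : ∀ s ∈ pairTestTriples d L, t * ‖s.1‖ ^ 2 ≤ ‖s.2.1‖ ^ 2 + ‖s.2.2‖ ^ 2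
      + K * ∑ p ∈ (finite_setOf_rectEigenvalue_lt hd hL t).toFinset,
        ‖sineFunctional d L p s.1‖ ^ 2 by
    have hsub : (pairTestTriples d L : Set (PairL2 d L × PairL2 d L × PairL2 d L)) ⊆
        {s | t * ‖s.1‖ ^ 2 ≤ ‖s.2.1‖ ^ 2 + ‖s.2.2‖ ^ 2 + K *
          ∑ p ∈ (finite_setOf_rectEigenvalue_lt hd hL t).toFinset,
            ‖sineFunctional d L p s.1‖ ^ 2} := fun s hs' => hs s hs'
    have hcm := closure_minimal hsub hcl
    have hxm := hcm hx
    rwa [Set.mem_ofPred_eq] at hxm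
  rintro s ⟨u, hu, h0, h1, h2⟩
  rw [norm_sq_pairL2_of_ae_eq h0 fun p hp => (hu.mem_region_of_ne hp).1,
    norm_sq_pairL2_of_ae_eq h1 fun p hp => (hu.mem_region_of_fderiv_ne _ hp).1,
    norm_sq_pairL2_of_ae_eq h2 fun p hp => (hu.mem_region_of_fderiv_ne _ hp).1]
  have hfun : ∀ p, sineFunctional d L p s.1
      = waveCoeff (2 * L) d (oddExtension u) ((p.1 : ℤ) + 1, (p.2 : ℤ) + 1) := by
    intro p
    rw [sineFunctional_apply]
    refine Eq.trans ?_ (waveCoeff_sub_antiReflect hu.smooth.continuous hu.compact _).symm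
    rw [← integral_pairMeasure_eq (d := d) (L := L)]
    · refine integral_congr_ae ?_
      filter_upwards [h0] with q hq
      rw [hq, sineMode]
    · intro q hq
      exact (hu.mem_region_of_ne (right_ne_zero_of_mul hq)).1
  simp only [hfun]
  exact h u hu

/-- The energy estimate with `t = ε⁻²` reads `‖J x‖² ≤ ε² ‖x‖²` plus finitely many squared
coefficients, which is the criterion `isCompactOperator_of_forall_le`. -/
theorem isCompactOperator_pairEmbedding {d L : ℝ} (hd : 0 < d) (hL : 0 < L) :
    IsCompactOperator (pairEmbedding d L) := by
  refine isCompactOperator_of_forall_le _ fun ε hε => ?_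
  obtain ⟨K, hK, h⟩ := exists_energy_ge hd hL (t := (ε ^ 2)⁻¹) (by positivity)
  set F := (finite_setOf_rectEigenvalue_lt hd hL (ε ^ 2)⁻¹).toFinset
  let G : PairL2 d L →L[ℂ] (Fin F.card → ℂ) :=
    ContinuousLinearMap.pi fun i => sineFunctional d L (F.equivFin.symm i)
  let c : ℝ := ε * Real.sqrt (K * F.card)
  refine ⟨F.card, ((c : ℂ) • G) ∘L pairEmbedding d L, fun x => ?_⟩
  have hG : ∀ p ∈ F, ‖sineFunctional d L p ((x : PairTriple d L) 0)‖ ≤ ‖G (pairEmbedding d L x)‖ := by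
    intro p hp
    have := norm_le_pi_norm (G (pairEmbedding d L x)) (F.equivFin ⟨p, hp⟩)
    simpa [G, pairEmbedding_apply] using this
  have hsum : ∑ p ∈ F, ‖sineFunctional d L p ((x : PairTriple d L) 0)‖ ^ 2
      ≤ F.card * ‖G (pairEmbedding d L x)‖ ^ 2 := by
    rw [← nsmul_eq_mul, ← Finset.sum_const]
    exact Finset.sum_le_sum fun p hp => pow_le_pow_left₀ (norm_nonneg _) (hG p hp) 2
  have h1 := h x
  have hn := norm_sq_pairFormSpace x
  have hc : ‖(((c : ℂ) • G) ∘L pairEmbedding d L) x‖ = c * ‖G (pairEmbedding d L x)‖ := by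
    rw [ContinuousLinearMap.comp_apply, smul_apply, norm_smul, Complex.norm_real,
      Real.norm_of_nonneg (by positivity)]
  rw [hc, pairEmbedding_apply]
  rw [← pairEmbedding_apply] at h1 ⊢
  set a := ‖pairEmbedding d L x‖ with ha
  set g := ‖G (pairEmbedding d L x)‖ with hg
  have hg0 : 0 ≤ g := norm_nonneg _
  have hc0 : 0 ≤ c := by positivity
  have h2 : a ^ 2 ≤ (ε * ‖x‖) ^ 2 + (c * g) ^ 2 := by
    have h3 : (ε ^ 2)⁻¹ * a ^ 2 ≤ ‖x‖ ^ 2 + K * F.card * g ^ 2 := by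
      have := mul_le_mul_of_nonneg_left hsum hK
      rw [pairEmbedding_apply] at h1
      nlinarith [sq_nonneg ‖(x : PairTriple d L) 0‖]
    rw [inv_mul_le_iff₀ (by positivity)] at h3
    have h4 : c ^ 2 = ε ^ 2 * (K * F.card) := by
      simp only [c]
      rw [mul_pow, Real.sq_sqrt (by positivity)]
    rw [mul_pow, mul_pow, h4]
    linarith
  have h5 : 0 ≤ ε * ‖x‖ := by positivity
  have h6 : 0 ≤ c * g := by positivity
  nlinarith [mul_nonneg h5 h6]

/-- Comparison with the circumscribed rectangle. -/
theorem lt_card_of_bulkEigenvalue_lt {d L : ℝ} (hd : 0 < d) (hL : 0 < L) {n : ℕ}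
    (hne : (bulkLevels d L n).Nonempty) {t : ℝ} (h : bulkEigenvalue d L n < t) :
    n < (finite_setOf_rectEigenvalue_lt hd hL t).toFinset.card := by
  by_contra! hcard
  have hE : 0 ≤ bulkEigenvalue d L n := by
    rw [bulkEigenvalue_eq]
    exact Real.sInf_nonneg fun s hs => nonneg_of_mem_bulkLevels hs
  obtain ⟨K, hK, hform⟩ := exists_energy_ge hd hL (t := t) (hE.trans h.le)
  set F := (finite_setOf_rectEigenvalue_lt hd hL t).toFinset
  -- If at most `n` modes lay below `t`, the functions annihilated by them would have energy at
  -- least `t`, forcing `E_n ≥ t`. Nonemptiness of the levels is needed because `sInf ∅ = 0`.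
  let ℓ : PairL2 d L →ₗ[ℂ] (F → ℂ) := LinearMap.pi fun p => (sineFunctional d L p).toLinearMap
  have : t ≤ bulkEigenvalue d L n := by
    rw [bulkEigenvalue_eq]
    refine le_csInf hne fun s hs => ?_
    refine le_of_mem_bulkLevels ℓ (by simpa using hcard) (fun x hx => ?_) hs
    refine (hform x).trans (le_of_eq ?_)
    rw [Finset.sum_eq_zero, mul_zero, add_zero]
    intro p hp
    have : sineFunctional d L p ((x : PairTriple d L) 0) = 0 := congrFun hx ⟨p, hp⟩
    rw [this]
    simp
  linarith

/-! ### Trial functions -/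

/-- A smooth odd cutoff of the identity near `0`. -/
def cutId (s : ℝ) : ℝ := s * Real.smoothTransition (s ^ 2 - 1)

theorem contDiff_cutId : ContDiff ℝ ∞ cutId := by
  unfold cutId
  exact contDiff_id.mul (Real.smoothTransition.contDiff.comp (by fun_prop))

theorem cutId_of_abs_le {s : ℝ} (hs : |s| ≤ 1) : cutId s = 0 := by
  have h : s ^ 2 ≤ 1 := (sq_le_one_iff_abs_le_one s).2 hs
  rw [cutId, Real.smoothTransition.zero_of_nonpos (by linarith), mul_zero]

theorem cutId_of_le_abs {s : ℝ} (hs : 2 ≤ |s|) : cutId s = s := by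
  have h : 2 ^ 2 ≤ s ^ 2 := by
    rw [← sq_abs s]
    exact pow_le_pow_left₀ (by norm_num) hs 2
  rw [cutId, Real.smoothTransition.one_of_one_le (by linarith), mul_one]

theorem cutId_neg (s : ℝ) : cutId (-s) = - cutId s := by
  simp [cutId]

theorem abs_cutId_le (s : ℝ) : |cutId s| ≤ |s| := by
  rw [cutId, abs_mul, abs_of_nonneg (Real.smoothTransition.nonneg _)]
  exact mul_le_of_le_one_right (abs_nonneg s) (Real.smoothTransition.le_one _)

theorem deriv_cutId_of_lt_abs {s : ℝ} (hs : 2 < |s|) : deriv cutId s = 1 := by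
  have h : cutId =ᶠ[𝓝 s] id := by
    filter_upwards [(continuous_abs.isOpen_preimage _ isOpen_Ioi).mem_nhds hs] with r hr
    exact cutId_of_le_abs (le_of_lt hr)
  rw [h.deriv_eq, deriv_id]

theorem exists_abs_deriv_cutId_le : ∃ C, 0 ≤ C ∧ ∀ s, |deriv cutId s| ≤ C := by
  have hc : Continuous (deriv cutId) := contDiff_cutId.continuous_deriv (by simp)
  obtain ⟨C, hC⟩ := (isCompact_Icc (a := (-2 : ℝ)) (b := 2)).exists_bound_of_continuousOn
    hc.continuousOn
  refine ⟨max C 1, by positivity, fun s => ?_⟩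
  by_cases hs : |s| ≤ 2
  · exact (hC s (abs_le.1 hs)).trans (le_max_left _ _)
  · rw [deriv_cutId_of_lt_abs (not_le.1 hs), abs_one]
    exact le_max_right _ _

/-- The truncation to `R` of `Ψ`, smoothed where `|Ψ|` is of order `ε`. -/
def cutTrial (R : Set (ℝ × ℝ)) (Ψ : ℝ × ℝ → ℝ) (ε : ℝ) : ℝ × ℝ → ℂ :=
  R.indicator fun p => ((ε * cutId (Ψ p / ε) : ℝ) : ℂ)

section CutTrial

variable {R : Set (ℝ × ℝ)} {Ψ : ℝ × ℝ → ℝ} {ε : ℝ}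

theorem cutTrial_eventuallyEq_of_mem {p : ℝ × ℝ} (hp : p ∈ interior R) :
    cutTrial R Ψ ε =ᶠ[𝓝 p] fun p => ((ε * cutId (Ψ p / ε) : ℝ) : ℂ) := by
  filter_upwards [isOpen_interior.mem_nhds hp] with q hq
  exact Set.indicator_of_mem (interior_subset hq) _

/-- At a point of `R` outside the interior `Ψ` vanishes, hence `|Ψ| < ε` nearby, where the cutoff is
zero. This makes the truncation smooth and keeps its support inside the interior. -/
theorem cutTrial_eventuallyEq_zero (hΨ : Continuous Ψ) (hR : IsClosed R)
    (hbd : ∀ p ∈ R, Ψ p ≠ 0 → p ∈ interior R) (hε : 0 < ε) {p : ℝ × ℝ} (hp : p ∉ interior R) :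
    cutTrial R Ψ ε =ᶠ[𝓝 p] fun _ => 0 := by
  by_cases hpR : p ∈ R
  · have h0 : Ψ p = 0 := by
      by_contra h
      exact hp (hbd p hpR h)
    have hnhds : {q | |Ψ q| < ε} ∈ 𝓝 p := by
      refine (isOpen_lt (continuous_abs.comp hΨ) continuous_const).mem_nhds ?_
      change |Ψ p| < ε
      rwa [h0, abs_zero]
    filter_upwards [hnhds] with q hq
    have hq' : |Ψ q| < ε := hq
    by_cases hqR : q ∈ R
    · rw [cutTrial, Set.indicator_of_mem hqR, cutId_of_abs_le, mul_zero, Complex.ofReal_zero]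
      rw [abs_div, abs_of_pos hε, div_le_one hε]
      exact hq'.le
    · exact Set.indicator_of_notMem hqR _
  · filter_upwards [hR.isOpen_compl.mem_nhds hpR] with q hq
    exact Set.indicator_of_notMem hq _

theorem contDiff_cutTrial (hΨ : ContDiff ℝ ∞ Ψ) (hR : IsClosed R)
    (hbd : ∀ p ∈ R, Ψ p ≠ 0 → p ∈ interior R) (hε : 0 < ε) : ContDiff ℝ ∞ (cutTrial R Ψ ε) := by
  rw [contDiff_iff_contDiffAt]
  intro p
  by_cases hp : p ∈ interior R
  · refine ContDiffAt.congr_of_eventuallyEq ?_ (cutTrial_eventuallyEq_of_mem hp)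
    refine ContDiff.contDiffAt ?_
    refine Complex.ofRealCLM.contDiff.comp (contDiff_const.mul (contDiff_cutId.comp ?_))
    exact hΨ.div_const ε
  · exact contDiffAt_const.congr_of_eventuallyEq
      (cutTrial_eventuallyEq_zero hΨ.continuous hR hbd hε hp)

theorem tsupport_cutTrial_subset (hΨ : Continuous Ψ) (hR : IsClosed R)
    (hbd : ∀ p ∈ R, Ψ p ≠ 0 → p ∈ interior R) (hε : 0 < ε) :
    tsupport (cutTrial R Ψ ε) ⊆ interior R := by
  intro p hp
  by_contra h
  exact (notMem_tsupport_iff_eventuallyEq.2 (cutTrial_eventuallyEq_zero hΨ hR hbd hε h)) hp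

theorem fderiv_cutTrial_of_mem (hΨ : Differentiable ℝ Ψ) (hε : 0 < ε) {p : ℝ × ℝ}
    (hp : p ∈ interior R) (w : ℝ × ℝ) :
    fderiv ℝ (cutTrial R Ψ ε) p w = ((deriv cutId (Ψ p / ε) * fderiv ℝ Ψ p w : ℝ) : ℂ) := by
  rw [(cutTrial_eventuallyEq_of_mem hp).fderiv_eq]
  have h1 : HasDerivAt cutId (deriv cutId (Ψ p / ε)) (Ψ p / ε) :=
    (contDiff_cutId.differentiable (by simp) _).hasDerivAt
  have h2 : HasFDerivAt (fun q => Ψ q / ε) (ε⁻¹ • fderiv ℝ Ψ p) p := by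
    simpa [div_eq_inv_mul] using (hΨ p).hasFDerivAt.const_mul ε⁻¹
  have h3 := (h1.comp_hasFDerivAt p h2).const_mul ε
  have h4 := (Complex.ofRealCLM.hasFDerivAt (x := ε * cutId (Ψ p / ε))).comp p h3
  refine (congrFun (congrArg DFunLike.coe h4.fderiv) w).trans ?_
  simp only [ContinuousLinearMap.comp_apply, smul_apply, smul_eq_mul,
    Complex.ofRealCLM_apply]
  congr 1
  field_simp

theorem fderiv_cutTrial_of_notMem (hΨ : Continuous Ψ) (hR : IsClosed R)
    (hbd : ∀ p ∈ R, Ψ p ≠ 0 → p ∈ interior R) (hε : 0 < ε) {p : ℝ × ℝ} (hp : p ∉ interior R)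
    (w : ℝ × ℝ) : fderiv ℝ (cutTrial R Ψ ε) p w = 0 := by
  rw [(cutTrial_eventuallyEq_zero hΨ hR hbd hε hp).fderiv_eq]
  simp

theorem isPairTest_cutTrial {d L : ℝ} (hΨ : ContDiff ℝ ∞ Ψ) (hR : IsCompact R)
    (hbd : ∀ p ∈ R, Ψ p ≠ 0 → p ∈ interior R) (hRΩ : R ⊆ pairRegion d L)
    (hanti : ∀ p, Ψ p.swap = - Ψ p) (hRs : ∀ p : ℝ × ℝ, p.swap ∈ R ↔ p ∈ R) (hε : 0 < ε) :
    IsPairTest d L (cutTrial R Ψ ε) where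
  smooth := contDiff_cutTrial hΨ hR.isClosed hbd hε
  compact := hR.of_isClosed_subset (isClosed_tsupport _)
    ((tsupport_cutTrial_subset hΨ.continuous hR.isClosed hbd hε).trans interior_subset)
  support := (tsupport_cutTrial_subset hΨ.continuous hR.isClosed hbd hε).trans (interior_mono hRΩ)
  antisymm p := by
    by_cases hp : p ∈ R
    · rw [cutTrial, Set.indicator_of_mem hp, Set.indicator_of_mem ((hRs p).2 hp), hanti,
        neg_div, cutId_neg]
      push_cast
      ring
    · rw [cutTrial, Set.indicator_of_notMem hp, Set.indicator_of_notMem (mt (hRs p).1 hp), neg_zero]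

end CutTrial

theorem tendsto_pairL2_of_bounded {d L : ℝ} {φ : ℕ → PairL2 d L} {ψ : PairL2 d L}
    {f : ℕ → ℝ × ℝ → ℂ} {g : ℝ × ℝ → ℂ} (hφ : ∀ k, φ k =ᵐ[pairMeasure d L] f k)
    (hψ : ψ =ᵐ[pairMeasure d L] g) {C : ℝ} (hf : ∀ k p, ‖f k p‖ ≤ C) (hg : ∀ p, ‖g p‖ ≤ C)
    (hlim : ∀ᵐ p ∂(pairMeasure d L), Tendsto (fun k => f k p) atTop (𝓝 (g p))) :
    Tendsto φ atTop (𝓝 ψ) := by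
  rw [tendsto_iff_norm_sub_tendsto_zero]
  have h1 : Tendsto (fun k => ‖φ k - ψ‖ ^ 2) atTop (𝓝 0) := by
    have e : ∀ k, ‖φ k - ψ‖ ^ 2 = ∫ q, ‖(φ k - ψ) q‖ ^ 2 ∂(pairMeasure d L) :=
      fun k => norm_sq_pairL2 _
    simp only [e]
    have h0 : (0 : ℝ) = ∫ _ : ℝ × ℝ, (0 : ℝ) ∂(pairMeasure d L) := by simp
    rw [h0]
    refine tendsto_integral_of_dominated_convergence (fun _ => (C + C) ^ 2) (fun k => ?_)
      (integrable_const _) (fun k => ?_) ?_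
    · exact ((Lp.aestronglyMeasurable (φ k - ψ)).norm.pow 2)
    · filter_upwards [hφ k, hψ, Lp.coeFn_sub (φ k) ψ] with q h1 h2 h3
      rw [h3, Pi.sub_apply, h1, h2, Real.norm_of_nonneg (by positivity)]
      exact pow_le_pow_left₀ (norm_nonneg _)
        ((norm_sub_le _ _).trans (add_le_add (hf k q) (hg q))) 2
    · filter_upwards [hlim, ae_all_iff.2 hφ, hψ, ae_all_iff.2 fun k => Lp.coeFn_sub (φ k) ψ]
        with q h0 h1 h2 h3
      have h4 := ((h0.sub_const (g q)).norm).pow 2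
      simp only [sub_self, norm_zero, ne_eq, OfNat.ofNat_ne_zero, not_false_eq_true, zero_pow] at h4
      refine h4.congr fun k => ?_
      rw [h3 k, Pi.sub_apply, h1 k, h2]
  have h2 := h1.sqrt
  simpa using h2

theorem tendsto_cut {s : ℝ} (hs : s ≠ 0) {ε : ℕ → ℝ} (hε : ∀ k, 0 < ε k)
    (hlim : Tendsto ε atTop (𝓝 0)) : ∀ᶠ k in atTop, 2 < |s / ε k| := by
  have h : ∀ᶠ k in atTop, ε k < |s| / 2 := hlim.eventually_lt_const (by positivity)
  filter_upwards [h] with k hk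
  rw [abs_div, abs_of_pos (hε k), lt_div_iff₀ (hε k)]
  linarith

/-- The triples of test functions supported in `R`. -/
def pairTestTriplesIn (d L : ℝ) (R : Set (ℝ × ℝ)) :
    Set (PairL2 d L × PairL2 d L × PairL2 d L) :=
  {t | ∃ u : ℝ × ℝ → ℂ, IsPairTest d L u ∧ tsupport u ⊆ R ∧
    t.1 =ᵐ[pairMeasure d L] u ∧
    t.2.1 =ᵐ[pairMeasure d L] (fun p => fderiv ℝ u p (1, 0)) ∧
    t.2.2 =ᵐ[pairMeasure d L] (fun p => fderiv ℝ u p (0, 1))}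

theorem closure_pairTestTriplesIn_subset (d L : ℝ) (R : Set (ℝ × ℝ)) :
    closure (pairTestTriplesIn d L R) ⊆ pairFormGraph d L :=
  closure_mono fun _ ⟨u, hu, _, h⟩ => ⟨u, hu, h⟩

theorem memLp_of_continuous_of_hasCompactSupport {d L : ℝ} {g : ℝ × ℝ → ℂ} (hg : Continuous g)
    (hc : HasCompactSupport g) : MemLp g 2 (pairMeasure d L) := by
  exact (hg.memLp_of_hasCompactSupport hc (μ := volume)).restrict _

/-- Smooth functions on a region, vanishing on its boundary, belong to the form domain. -/
theorem mem_closure_pairTestTriplesIn {d L : ℝ} {R : Set (ℝ × ℝ)} {Ψ : ℝ × ℝ → ℝ}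
    (hΨ : ContDiff ℝ ∞ Ψ) (hR : IsCompact R) (hbd : ∀ p ∈ R, Ψ p ≠ 0 → p ∈ interior R)
    (hRΩ : R ⊆ pairRegion d L) (hanti : ∀ p, Ψ p.swap = - Ψ p)
    (hRs : ∀ p : ℝ × ℝ, p.swap ∈ R ↔ p ∈ R) (hnull : ∀ᵐ p : ℝ × ℝ, Ψ p ≠ 0)
    {t : PairL2 d L × PairL2 d L × PairL2 d L}
    (h0 : t.1 =ᵐ[pairMeasure d L] R.indicator fun p => (Ψ p : ℂ))
    (h1 : t.2.1 =ᵐ[pairMeasure d L] R.indicator fun p => (fderiv ℝ Ψ p (1, 0) : ℂ))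
    (h2 : t.2.2 =ᵐ[pairMeasure d L] R.indicator fun p => (fderiv ℝ Ψ p (0, 1) : ℂ)) :
    t ∈ closure (pairTestTriplesIn d L R) := by
  let ε : ℕ → ℝ := fun k => 1 / ((k : ℝ) + 1)
  have hε : ∀ k, 0 < ε k := fun k => by positivity
  have hεlim : Tendsto ε atTop (𝓝 0) := tendsto_one_div_add_atTop_nhds_zero_nat
  have hΨc := hΨ.continuous
  have hΨd : Differentiable ℝ Ψ := hΨ.differentiable (by simp)
  let u : ℕ → ℝ × ℝ → ℂ := fun k => cutTrial R Ψ (ε k)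
  have hu : ∀ k, IsPairTest d L (u k) := fun k =>
    isPairTest_cutTrial hΨ hR hbd hRΩ hanti hRs (hε k)
  have m0 : ∀ k, MemLp (u k) 2 (pairMeasure d L) := fun k =>
    memLp_of_continuous_of_hasCompactSupport (hu k).smooth.continuous (hu k).compact
  have m1 : ∀ w k, MemLp (fun p => fderiv ℝ (u k) p w) 2 (pairMeasure d L) := fun w k =>
    memLp_of_continuous_of_hasCompactSupport (continuous_fderiv_apply (hu k).smooth w)
      (hasCompactSupport_fderiv_apply (hu k).compact w)
  have hnull' : ∀ᵐ p ∂(pairMeasure d L), Ψ p ≠ 0 := ae_restrict_of_ae hnull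
  obtain ⟨C, hC0, hC⟩ := exists_abs_deriv_cutId_le
  -- The gradient of the truncation is `cutId'(Ψ/ε) ∇Ψ`: bounded uniformly in `ε`, and equal to `∇Ψ`
  -- for small `ε` wherever `Ψ ≠ 0`, that is, almost everywhere in `R`.
  have hder : ∀ (w : ℝ × ℝ) (ψ : PairL2 d L),
      ψ =ᵐ[pairMeasure d L] (R.indicator fun p => (fderiv ℝ Ψ p w : ℂ)) →
      Tendsto (fun k => (m1 w k).toLp) atTop (𝓝 ψ) := by
    intro w ψ hψ
    have hwc : Continuous fun p => fderiv ℝ Ψ p w :=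
      (hΨ.continuous_fderiv (by simp)).clm_apply continuous_const
    obtain ⟨B, hB⟩ := hR.exists_bound_of_continuousOn hwc.continuousOn
    have hB0 : 0 ≤ max B 0 := le_max_right _ _
    refine tendsto_pairL2_of_bounded (C := max C 1 * max B 0) (fun k => (m1 w k).coeFn_toLp) hψ
      (fun k p => ?_) (fun p => ?_) ?_
    · by_cases hp : p ∈ interior R
      · rw [fderiv_cutTrial_of_mem hΨd (hε k) hp, Complex.norm_real, norm_mul]
        exact mul_le_mul ((hC _).trans (le_max_left _ _))
          ((hB p (interior_subset hp)).trans (le_max_left _ _)) (norm_nonneg _) (by positivity)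
      · rw [fderiv_cutTrial_of_notMem hΨc hR.isClosed hbd (hε k) hp, norm_zero]
        positivity
    · by_cases hp : p ∈ R
      · rw [Set.indicator_of_mem hp, Complex.norm_real, ← one_mul ‖_‖]
        exact mul_le_mul (le_max_right _ _)
          ((hB p hp).trans (le_max_left _ _)) (norm_nonneg _) (by positivity)
      · rw [Set.indicator_of_notMem hp, norm_zero]
        positivity
    · filter_upwards [hnull'] with p hp
      refine tendsto_const_nhds.congr' ?_
      by_cases hpR : p ∈ R
      · filter_upwards [tendsto_cut hp hε hεlim] with k hk
        rw [fderiv_cutTrial_of_mem hΨd (hε k) (hbd p hpR hp), deriv_cutId_of_lt_abs hk, one_mul,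
          Set.indicator_of_mem hpR]
      · refine Eventually.of_forall fun k => ?_
        change _ = fderiv ℝ (cutTrial R Ψ (ε k)) p w
        rw [fderiv_cutTrial_of_notMem hΨc hR.isClosed hbd (hε k)
          (fun h => hpR (interior_subset h)), Set.indicator_of_notMem hpR]
  have hlim0 : Tendsto (fun k => (m0 k).toLp) atTop (𝓝 t.1) := by
    obtain ⟨B, hB⟩ := hR.exists_bound_of_continuousOn hΨc.continuousOn
    refine tendsto_pairL2_of_bounded (C := max B 0) (fun k => (m0 k).coeFn_toLp) h0
      (fun k p => ?_) (fun p => ?_) ?_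
    · by_cases hp : p ∈ R
      · rw [show u k p = ((ε k * cutId (Ψ p / ε k) : ℝ) : ℂ) from Set.indicator_of_mem hp _,
          Complex.norm_real, norm_mul, Real.norm_of_nonneg (hε k).le]
        have h := mul_le_mul_of_nonneg_left (abs_cutId_le (Ψ p / ε k)) (hε k).le
        rw [abs_div, abs_of_pos (hε k), mul_div_cancel₀ _ (hε k).ne'] at h
        exact h.trans ((hB p hp).trans (le_max_left _ _))
      · rw [show u k p = 0 from Set.indicator_of_notMem hp _, norm_zero]
        positivity
    · by_cases hp : p ∈ R
      · rw [Set.indicator_of_mem hp, Complex.norm_real]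
        exact (hB p hp).trans (le_max_left _ _)
      · rw [Set.indicator_of_notMem hp, norm_zero]
        positivity
    · filter_upwards [hnull'] with p hp
      refine tendsto_const_nhds.congr' ?_
      by_cases hpR : p ∈ R
      · filter_upwards [tendsto_cut hp hε hεlim] with k hk
        rw [show u k p = ((ε k * cutId (Ψ p / ε k) : ℝ) : ℂ) from Set.indicator_of_mem hpR _,
          cutId_of_le_abs hk.le, mul_div_cancel₀ _ (hε k).ne', Set.indicator_of_mem hpR]
      · exact Eventually.of_forall fun k => by
          change _ = u k p
          rw [show u k p = 0 from Set.indicator_of_notMem hpR _, Set.indicator_of_notMem hpR]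
  refine mem_closure_of_tendsto
    (hlim0.prodMk_nhds ((hder (1, 0) t.2.1 h1).prodMk_nhds (hder (0, 1) t.2.2 h2)))
    (Eventually.of_forall fun k => ⟨u k, hu k, ?_, (m0 k).coeFn_toLp, (m1 _ k).coeFn_toLp,
      (m1 _ k).coeFn_toLp⟩)
  exact (tsupport_cutTrial_subset hΨc hR.isClosed hbd (hε k)).trans interior_subset

/-- The product of a function of `x + y` and a function of `y - x`. -/
def rotatedProd (g h : ℝ → ℝ) (q : ℝ × ℝ) : ℝ := g (q.1 + q.2) * h (q.2 - q.1)

theorem contDiff_rotatedProd {g h : ℝ → ℝ} (hg : ContDiff ℝ ∞ g) (hh : ContDiff ℝ ∞ h) :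
    ContDiff ℝ ∞ (rotatedProd g h) :=
  (hg.comp (contDiff_fst.add contDiff_snd)).mul (hh.comp (contDiff_snd.sub contDiff_fst))

theorem fderiv_rotatedProd {g h g' h' : ℝ → ℝ} (hg : ∀ s, HasDerivAt g (g' s) s)
    (hh : ∀ s, HasDerivAt h (h' s) s) (q w : ℝ × ℝ) :
    fderiv ℝ (rotatedProd g h) q w
      = (w.1 + w.2) * rotatedProd g' h q + (w.2 - w.1) * rotatedProd g h' q := by
  have h1 := (hg (q.1 + q.2)).comp_hasFDerivAt q
    ((ContinuousLinearMap.fst ℝ ℝ ℝ).hasFDerivAt.add (ContinuousLinearMap.snd ℝ ℝ ℝ).hasFDerivAt)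
  have h2 := (hh (q.2 - q.1)).comp_hasFDerivAt q
    ((ContinuousLinearMap.snd ℝ ℝ ℝ).hasFDerivAt.sub (ContinuousLinearMap.fst ℝ ℝ ℝ).hasFDerivAt)
  refine (congrFun (congrArg DFunLike.coe (h1.mul h2).fderiv) w).trans ?_
  simp [rotatedProd]
  ring

theorem integral_ofReal_mul_fderiv {f : ℝ × ℝ → ℝ} (hf : ContDiff ℝ ∞ f) {u : ℝ × ℝ → ℂ}
    (hu : ContDiff ℝ ∞ u) (hc : HasCompactSupport u) (w : ℝ × ℝ) :
    ∫ p, (f p : ℂ) * fderiv ℝ u p w = - ∫ p, ((fderiv ℝ f p w : ℝ) : ℂ) * u p := by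
  have hfc : ContDiff ℝ ∞ fun p => (f p : ℂ) := Complex.ofRealCLM.contDiff.comp hf
  have hd : ∀ p, fderiv ℝ (fun p => (f p : ℂ)) p w = ((fderiv ℝ f p w : ℝ) : ℂ) := by
    intro p
    have h1 := (Complex.ofRealCLM.hasFDerivAt (x := f p)).comp p
      (hf.differentiable (by simp) p).hasFDerivAt
    exact congrFun (congrArg DFunLike.coe h1.fderiv) w
  simp only [← hd]
  refine integral_mul_fderiv_eq_neg_fderiv_mul_of_integrable ?_ ?_ ?_ ?_ ?_
  · exact Continuous.integrable_of_hasCompactSupport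
      ((continuous_fderiv_apply hfc w).mul hu.continuous) hc.mul_left
  · exact Continuous.integrable_of_hasCompactSupport
      (hfc.continuous.mul (continuous_fderiv_apply hu w)) (hasCompactSupport_fderiv_apply hc w).mul_left
  · exact Continuous.integrable_of_hasCompactSupport (hfc.continuous.mul hu.continuous) hc.mul_left
  · exact fun p _ => hfc.differentiable (by simp) p
  · exact fun p _ => hu.differentiable (by simp) p

theorem inner_pairL2_of_ae_eq {d L : ℝ} {R : Set (ℝ × ℝ)} (hR : R ⊆ pairRegion d L)
    {φ ψ : PairL2 d L} {f : ℝ × ℝ → ℝ} {g : ℝ × ℝ → ℂ}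
    (hφ : φ =ᵐ[pairMeasure d L] R.indicator fun p => (f p : ℂ)) (hψ : ψ =ᵐ[pairMeasure d L] g)
    (hg : ∀ p, g p ≠ 0 → p ∈ R) : inner ℂ φ ψ = ∫ p, (f p : ℂ) * g p := by
  rw [L2.inner_def, ← integral_pairMeasure_eq (d := d) (L := L)]
  · refine integral_congr_ae ?_
    filter_upwards [hφ, hψ] with p h1 h2
    rw [h1, h2, RCLike.inner_apply]
    by_cases hp : p ∈ R
    · rw [Set.indicator_of_mem hp, Complex.conj_ofReal, mul_comm]
    · have : g p = 0 := by
        by_contra h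
        exact hp (hg p h)
      rw [this, zero_mul, mul_zero]
  · exact fun p hp => hR (hg p (right_ne_zero_of_mul hp))

/-- An integration by parts formula on the closure of the test functions supported in `R`. -/
theorem inner_lineDeriv_eq {d L : ℝ} {R : Set (ℝ × ℝ)} (hR : R ⊆ pairRegion d L)
    {φ φ' : PairL2 d L} {f Ψ : ℝ × ℝ → ℝ} {c : ℝ} {w : ℝ × ℝ} (hf : ContDiff ℝ ∞ f)
    (hfΨ : ∀ p, fderiv ℝ f p w = -c * Ψ p)
    (hφ : φ =ᵐ[pairMeasure d L] R.indicator fun p => (Ψ p : ℂ))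
    (hφ' : φ' =ᵐ[pairMeasure d L] R.indicator fun p => (f p : ℂ))
    {t : PairL2 d L × PairL2 d L × PairL2 d L} (ht : t ∈ closure (pairTestTriplesIn d L R)) :
    inner ℂ φ' ((w.1 : ℂ) • t.2.1 + (w.2 : ℂ) • t.2.2) = c * inner ℂ φ t.1 := by
  -- For test functions supported in `R` this is integration by parts. The function `f` need not
  -- vanish on the boundary of `R`; the support of the test function suppresses the boundary terms.
  -- This is why the closure is taken inside `R`.
  have hcl : IsClosed {t : PairL2 d L × PairL2 d L × PairL2 d L |
      inner ℂ φ' ((w.1 : ℂ) • t.2.1 + (w.2 : ℂ) • t.2.2) = c * inner ℂ φ t.1} :=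
    isClosed_eq (by fun_prop) (by fun_prop)
  refine closure_minimal ?_ hcl ht
  rintro s ⟨u, hu, husupp, h0, h1, h2⟩
  have hg : ((w.1 : ℂ) • s.2.1 + (w.2 : ℂ) • s.2.2 : PairL2 d L)
      =ᵐ[pairMeasure d L] fun p => fderiv ℝ u p w := by
    filter_upwards [h1, h2, Lp.coeFn_add ((w.1 : ℂ) • s.2.1) ((w.2 : ℂ) • s.2.2),
      Lp.coeFn_smul (w.1 : ℂ) s.2.1, Lp.coeFn_smul (w.2 : ℂ) s.2.2] with p e1 e2 e3 e4 e5
    rw [e3, Pi.add_apply, e4, e5, Pi.smul_apply, Pi.smul_apply, e1, e2]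
    have hw : w = w.1 • ((1, 0) : ℝ × ℝ) + w.2 • ((0, 1) : ℝ × ℝ) := by ext <;> simp
    conv_rhs => rw [hw, map_add, map_smul, map_smul]
    simp
  rw [Set.mem_ofPred_eq, inner_pairL2_of_ae_eq hR hφ' hg, inner_pairL2_of_ae_eq hR hφ h0,
    integral_ofReal_mul_fderiv hf hu.smooth hu.compact, ← integral_neg, ← integral_const_mul]
  · congr 1
    funext p
    rw [hfΨ]
    push_cast
    ring
  · exact fun p hp => husupp (subset_tsupport u hp)
  · intro p hp
    refine husupp (support_fderiv_subset ℝ ?_)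
    intro h
    exact hp (by rw [h]; rfl)

/-! ### Sine modes of the inscribed rectangle -/

/-- The rectangle inscribed in `Ω_L`. -/
def innerRect (d L : ℝ) : Set (ℝ × ℝ) :=
  {q | d ≤ q.1 + q.2 ∧ q.1 + q.2 ≤ 2 * L - d ∧ |q.2 - q.1| ≤ d}

theorem innerRect_subset (d L : ℝ) : innerRect d L ⊆ pairRegion d L := by
  rintro q ⟨h1, h2, h3⟩
  have := abs_le.1 h3
  exact ⟨by linarith, by linarith, by linarith, by linarith, by rwa [abs_sub_comm]⟩

theorem isCompact_innerRect (d L : ℝ) : IsCompact (innerRect d L) := by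
  refine IsCompact.of_isClosed_subset (isCompact_Icc.prod isCompact_Icc) ?_
    ((innerRect_subset d L).trans (pairRegion_subset_Icc d L))
  unfold innerRect
  simp only [Set.ofPred_and]
  refine IsClosed.inter (isClosed_le (by fun_prop) (by fun_prop)) ?_
  refine IsClosed.inter (isClosed_le (by fun_prop) (by fun_prop)) ?_
  exact isClosed_le (by fun_prop) (by fun_prop)

theorem mem_interior_innerRect {d L : ℝ} {q : ℝ × ℝ} (h1 : d < q.1 + q.2)
    (h2 : q.1 + q.2 < 2 * L - d) (h3 : |q.2 - q.1| < d) : q ∈ interior (innerRect d L) := by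
  have ho : IsOpen {q : ℝ × ℝ | d < q.1 + q.2 ∧ q.1 + q.2 < 2 * L - d ∧ |q.2 - q.1| < d} := by
    simp only [Set.ofPred_and]
    refine IsOpen.inter (isOpen_lt (by fun_prop) (by fun_prop)) ?_
    refine IsOpen.inter (isOpen_lt (by fun_prop) (by fun_prop)) ?_
    exact isOpen_lt (by fun_prop) (by fun_prop)
  refine interior_maximal ?_ ho ⟨h1, h2, h3⟩
  exact fun p hp => ⟨hp.1.le, hp.2.1.le, hp.2.2.le⟩

/-- The longitudinal wave number of a mode of `innerRect d L`. -/
def longWave (d L : ℝ) (p : ℕ × ℕ) : ℝ := Real.pi * ((p.2 : ℝ) + 1) / (2 * (L - d))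

/-- The transversal wave number of a mode of `innerRect d L`. -/
def transWave (d : ℝ) (p : ℕ × ℕ) : ℝ := Real.pi * ((p.1 : ℝ) + 1) / d

/-- The longitudinal factor of a mode. -/
def longSin (d L : ℝ) (p : ℕ × ℕ) (s : ℝ) : ℝ := Real.sin (longWave d L p * (s - d))

/-- The derivative of the longitudinal factor of a mode. -/
def longCos (d L : ℝ) (p : ℕ × ℕ) (s : ℝ) : ℝ :=
  longWave d L p * Real.cos (longWave d L p * (s - d))

/-- The transversal factor of a mode. -/
def transSin (d : ℝ) (p : ℕ × ℕ) (v : ℝ) : ℝ := Real.sin (transWave d p * v)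

/-- The derivative of the transversal factor of a mode. -/
def transCos (d : ℝ) (p : ℕ × ℕ) (v : ℝ) : ℝ := transWave d p * Real.cos (transWave d p * v)

section Modes

variable (d L : ℝ) (p : ℕ × ℕ)

theorem contDiff_longSin : ContDiff ℝ ∞ (longSin d L p) := by
  unfold longSin; fun_prop

theorem contDiff_longCos : ContDiff ℝ ∞ (longCos d L p) := by
  unfold longCos; fun_prop

theorem contDiff_transSin : ContDiff ℝ ∞ (transSin d p) := by
  unfold transSin; fun_prop

theorem contDiff_transCos : ContDiff ℝ ∞ (transCos d p) := by
  unfold transCos; fun_prop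

theorem hasDerivAt_longSin (s : ℝ) : HasDerivAt (longSin d L p) (longCos d L p s) s := by
  have h := (((hasDerivAt_id s).sub_const d).const_mul (longWave d L p)).sin
  convert! h using 1
  simp [longCos]
  ring

theorem hasDerivAt_longCos (s : ℝ) :
    HasDerivAt (longCos d L p) (-(longWave d L p) ^ 2 * longSin d L p s) s := by
  have h := ((((hasDerivAt_id s).sub_const d).const_mul (longWave d L p)).cos).const_mul
    (longWave d L p)
  convert! h using 1
  simp [longSin]
  ring

theorem hasDerivAt_transSin (s : ℝ) : HasDerivAt (transSin d p) (transCos d p s) s := by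
  have h := ((hasDerivAt_id s).const_mul (transWave d p)).sin
  convert! h using 1
  simp [transCos]
  ring

theorem hasDerivAt_transCos (s : ℝ) :
    HasDerivAt (transCos d p) (-(transWave d p) ^ 2 * transSin d p s) s := by
  have h := (((hasDerivAt_id s).const_mul (transWave d p)).cos).const_mul (transWave d p)
  convert! h using 1
  simp [transSin]
  ring

/-- The modes of the inscribed rectangle. -/
def innerMode : ℝ × ℝ → ℝ := rotatedProd (longSin d L p) (transSin d p)

theorem contDiff_innerMode : ContDiff ℝ ∞ (innerMode d L p) :=
  contDiff_rotatedProd (contDiff_longSin d L p) (contDiff_transSin d p)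

theorem fderiv_innerMode (q w : ℝ × ℝ) : fderiv ℝ (innerMode d L p) q w
    = (w.1 + w.2) * rotatedProd (longCos d L p) (transSin d p) q
      + (w.2 - w.1) * rotatedProd (longSin d L p) (transCos d p) q :=
  fderiv_rotatedProd (hasDerivAt_longSin d L p) (hasDerivAt_transSin d p) q w

theorem innerMode_swap (q : ℝ × ℝ) : innerMode d L p q.swap = - innerMode d L p q := by
  simp only [innerMode, rotatedProd, transSin, Prod.fst_swap, Prod.snd_swap]
  rw [add_comm q.2 q.1, show q.1 - q.2 = -(q.2 - q.1) by ring, mul_neg, Real.sin_neg, mul_neg]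

variable {d L}

theorem mem_interior_of_innerMode_ne (hd : 0 < d) (hL : d < L) {q : ℝ × ℝ}
    (hq : q ∈ innerRect d L) (h : innerMode d L p q ≠ 0) : q ∈ interior (innerRect d L) := by
  obtain ⟨h1, h2, h3⟩ := hq
  simp only [innerMode, rotatedProd, longSin, transSin, longWave, transWave] at h
  have hs : ∀ n : ℕ, Real.sin (Real.pi * ((n : ℝ) + 1)) = 0 := by
    intro n
    rw [mul_comm]
    exact_mod_cast Real.sin_nat_mul_pi (n + 1)
  refine mem_interior_innerRect (h1.lt_of_ne fun e => h ?_) (h2.lt_of_ne fun e => h ?_)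
    (h3.lt_of_ne fun e => h ?_)
  · rw [← e, sub_self, mul_zero, Real.sin_zero, zero_mul]
  · rw [e, show Real.pi * ((p.2 : ℝ) + 1) / (2 * (L - d)) * (2 * L - d - d)
      = Real.pi * ((p.2 : ℝ) + 1) by
        have : L - d ≠ 0 := by linarith
        field_simp
        ring, hs, zero_mul]
  · have hb : Real.pi * ((p.1 : ℝ) + 1) / d * d = Real.pi * ((p.1 : ℝ) + 1) := by
      field_simp
    rcases eq_or_eq_neg_of_abs_eq e with e | e
    · rw [e, hb, hs, mul_zero]
    · rw [e, mul_neg, hb, Real.sin_neg, hs, neg_zero, mul_zero]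

theorem countable_setOf_sin_eq_zero : {θ : ℝ | Real.sin θ = 0}.Countable := by
  refine (Set.countable_range fun n : ℤ => (n : ℝ) * Real.pi).mono ?_
  intro θ hθ
  exact Real.sin_eq_zero_iff.1 hθ

/-- On each vertical line both sine factors vanish only at countably many points; Fubini does the
rest. -/
theorem ae_innerMode_ne (hd : 0 < d) (hL : d < L) : ∀ᵐ q : ℝ × ℝ, innerMode d L p q ≠ 0 := by
  have hm : MeasurableSet {q : ℝ × ℝ | innerMode d L p q ≠ 0} :=
    ((contDiff_innerMode d L p).continuous.isOpen_preimage _ isOpen_compl_singleton).measurableSet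
  rw [Measure.volume_eq_prod, Measure.ae_prod_iff_ae_ae hm]
  refine Eventually.of_forall fun x => ?_
  have ha : longWave d L p ≠ 0 := by
    have : 0 < L - d := by linarith
    unfold longWave
    positivity
  have hb : transWave d p ≠ 0 := by
    unfold transWave
    positivity
  have h1 : ({θ : ℝ | Real.sin θ = 0}.preimage
      fun y : ℝ => longWave d L p * (x + y - d)).Countable := by
    refine countable_setOf_sin_eq_zero.preimage_of_injOn ?_
    intro y _ y' _ h
    have := mul_left_cancel₀ ha h
    linarith
  have h2 : ({θ : ℝ | Real.sin θ = 0}.preimage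
      fun y : ℝ => transWave d p * (y - x)).Countable := by
    refine countable_setOf_sin_eq_zero.preimage_of_injOn ?_
    intro y _ y' _ h
    have := mul_left_cancel₀ hb h
    linarith
  filter_upwards [h1.ae_notMem volume, h2.ae_notMem volume] with y e1 e2
  exact mul_ne_zero e1 e2

theorem rectEigenvalue_eq_longWave (hL : d < L) :
    rectEigenvalue d (L - d) p = 2 * longWave d L p ^ 2 + 2 * transWave d p ^ 2 := by
  have : L - d ≠ 0 := by linarith
  simp only [rectEigenvalue, longWave, transWave, mul_pow, div_pow]
  rw [Real.sq_sqrt (by norm_num)]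
  field_simp
  ring

end Modes

theorem memLp_indicator_ofReal {d L : ℝ} {R : Set (ℝ × ℝ)} (hR : IsCompact R) {f : ℝ × ℝ → ℝ}
    (hf : Continuous f) : MemLp (R.indicator fun p => (f p : ℂ)) 2 (pairMeasure d L) := by
  obtain ⟨C, hC⟩ := hR.exists_bound_of_continuousOn hf.continuousOn
  refine MemLp.of_bound (C := max C 0) ?_ (Eventually.of_forall fun p => ?_)
  · exact ((Complex.continuous_ofReal.comp hf).aestronglyMeasurable).indicator hR.measurableSet
  · by_cases hp : p ∈ R
    · rw [Set.indicator_of_mem hp, Complex.norm_real]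
      exact (hC p hp).trans (le_max_left _ _)
    · rw [Set.indicator_of_notMem hp, norm_zero]
      exact le_max_right _ _

theorem norm_sq_sum_smul_of_orthogonal {E : Type*} [NormedAddCommGroup E] [InnerProductSpace ℂ E]
    {ι : Type*} [Fintype ι] {y : ι → E} (hy : Pairwise fun i j => inner ℂ (y i) (y j) = 0)
    (c : ι → ℂ) : ‖∑ i, c i • y i‖ ^ 2 = ∑ i, ‖c i‖ ^ 2 * ‖y i‖ ^ 2 := by
  have e : ∀ x : E, (inner ℂ x x).re = ‖x‖ ^ 2 := fun x => inner_self_eq_norm_sq (𝕜 := ℂ) x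
  rw [← e, sum_inner]
  simp only [inner_sum]
  have h : ∀ i, ∑ j, inner ℂ (c i • y i) (c j • y j) = ((‖c i‖ ^ 2 * ‖y i‖ ^ 2 : ℝ) : ℂ) := by
    intro i
    rw [Finset.sum_eq_single i]
    · rw [inner_self_eq_norm_sq_to_K, norm_smul, ← mul_pow, Complex.ofReal_pow]
      rfl
    · intro j _ hj
      rw [inner_smul_left, inner_smul_right, hy hj.symm]
      simp
    · simp
  simp only [h]
  rw [← Complex.ofReal_sum, Complex.ofReal_re]

/-- Expresses the energy through `∂₁ + ∂₂` and `∂₂ - ∂₁`, the directions in which the modes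
factorise. -/
theorem norm_sq_add_norm_sq_eq_half {E : Type*} [NormedAddCommGroup E] [InnerProductSpace ℂ E]
    (x y : E) : ‖x‖ ^ 2 + ‖y‖ ^ 2 = (‖x + y‖ ^ 2 + ‖y - x‖ ^ 2) / 2 := by
  have := parallelogram_law_with_norm ℂ y x
  rw [add_comm x y]
  nlinarith

section

variable {d L : ℝ}

theorem memLp_innerMode (d L : ℝ) (p : ℕ × ℕ) :
    MemLp ((innerRect d L).indicator fun q => (innerMode d L p q : ℂ)) 2 (pairMeasure d L) :=
  memLp_indicator_ofReal (isCompact_innerRect d L) (contDiff_innerMode d L p).continuous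

theorem memLp_fderiv_innerMode (d L : ℝ) (p : ℕ × ℕ) (w : ℝ × ℝ) :
    MemLp ((innerRect d L).indicator fun q => (fderiv ℝ (innerMode d L p) q w : ℂ)) 2
      (pairMeasure d L) :=
  memLp_indicator_ofReal (isCompact_innerRect d L)
    (((contDiff_innerMode d L p).continuous_fderiv (by simp)).clm_apply continuous_const)

/-- The modes of the inscribed rectangle as elements of `L²(Ω_L)`. -/
def innerModeTriple (d L : ℝ) (p : ℕ × ℕ) : PairL2 d L × PairL2 d L × PairL2 d L :=
  ((memLp_innerMode d L p).toLp, (memLp_fderiv_innerMode d L p (1, 0)).toLp,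
    (memLp_fderiv_innerMode d L p (0, 1)).toLp)

theorem innerModeTriple_fst (d L : ℝ) (p : ℕ × ℕ) : (innerModeTriple d L p).1
    =ᵐ[pairMeasure d L] (innerRect d L).indicator fun q => (innerMode d L p q : ℂ) :=
  (memLp_innerMode d L p).coeFn_toLp

theorem innerModeTriple_snd_fst (d L : ℝ) (p : ℕ × ℕ) : (innerModeTriple d L p).2.1
    =ᵐ[pairMeasure d L]
      (innerRect d L).indicator fun q => (fderiv ℝ (innerMode d L p) q (1, 0) : ℂ) :=
  (memLp_fderiv_innerMode d L p (1, 0)).coeFn_toLp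

theorem innerModeTriple_snd_snd (d L : ℝ) (p : ℕ × ℕ) : (innerModeTriple d L p).2.2
    =ᵐ[pairMeasure d L]
      (innerRect d L).indicator fun q => (fderiv ℝ (innerMode d L p) q (0, 1) : ℂ) :=
  (memLp_fderiv_innerMode d L p (0, 1)).coeFn_toLp

theorem innerModeTriple_mem (hd : 0 < d) (hL : d < L) (p : ℕ × ℕ) :
    innerModeTriple d L p ∈ closure (pairTestTriplesIn d L (innerRect d L)) := by
  refine mem_closure_pairTestTriplesIn (contDiff_innerMode d L p) (isCompact_innerRect d L)
    (fun q => mem_interior_of_innerMode_ne p hd hL) (innerRect_subset d L) (innerMode_swap d L p)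
    (fun q => ?_) (ae_innerMode_ne p hd hL) (innerModeTriple_fst d L p)
    (innerModeTriple_snd_fst d L p) (innerModeTriple_snd_snd d L p)
  change (d ≤ q.2 + q.1 ∧ q.2 + q.1 ≤ 2 * L - d ∧ |q.1 - q.2| ≤ d) ↔
    (d ≤ q.1 + q.2 ∧ q.1 + q.2 ≤ 2 * L - d ∧ |q.2 - q.1| ≤ d)
  rw [add_comm q.2 q.1, abs_sub_comm]

theorem innerModeTriple_add (d L : ℝ) (p : ℕ × ℕ) :
    ((innerModeTriple d L p).2.1 + (innerModeTriple d L p).2.2 : PairL2 d L)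
      =ᵐ[pairMeasure d L] (innerRect d L).indicator fun q =>
        ((2 * rotatedProd (longCos d L p) (transSin d p) q : ℝ) : ℂ) := by
  filter_upwards [innerModeTriple_snd_fst d L p, innerModeTriple_snd_snd d L p,
    Lp.coeFn_add (innerModeTriple d L p).2.1 (innerModeTriple d L p).2.2] with q h1 h2 h3
  rw [h3, Pi.add_apply, h1, h2]
  by_cases hq : q ∈ innerRect d L
  · simp only [Set.indicator_of_mem hq, fderiv_innerMode]
    push_cast
    ring
  · simp only [Set.indicator_of_notMem hq, add_zero]

theorem innerModeTriple_sub (d L : ℝ) (p : ℕ × ℕ) :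
    ((innerModeTriple d L p).2.2 - (innerModeTriple d L p).2.1 : PairL2 d L)
      =ᵐ[pairMeasure d L] (innerRect d L).indicator fun q =>
        ((2 * rotatedProd (longSin d L p) (transCos d p) q : ℝ) : ℂ) := by
  filter_upwards [innerModeTriple_snd_fst d L p, innerModeTriple_snd_snd d L p,
    Lp.coeFn_sub (innerModeTriple d L p).2.2 (innerModeTriple d L p).2.1] with q h1 h2 h3
  rw [h3, Pi.sub_apply, h1, h2]
  by_cases hq : q ∈ innerRect d L
  · simp only [Set.indicator_of_mem hq, fderiv_innerMode]
    push_cast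
    ring
  · simp only [Set.indicator_of_notMem hq, sub_zero]

/-- On functions of `x + y` the operator `∂₁ + ∂₂` acts as twice the derivative, so its square
multiplies a mode by `-4 longWave²`. This is the weak form of that equation, tested against
functions supported in the rectangle. -/
theorem inner_innerModeTriple_add (p : ℕ × ℕ) {t : PairL2 d L × PairL2 d L × PairL2 d L}
    (ht : t ∈ closure (pairTestTriplesIn d L (innerRect d L))) :
    inner ℂ ((innerModeTriple d L p).2.1 + (innerModeTriple d L p).2.2) (t.2.1 + t.2.2)
      = ((4 * longWave d L p ^ 2 : ℝ) : ℂ) * inner ℂ (innerModeTriple d L p).1 t.1 := by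
  have h := inner_lineDeriv_eq (innerRect_subset d L) (c := 4 * longWave d L p ^ 2) (w := (1, 1))
    (f := fun q => 2 * rotatedProd (longCos d L p) (transSin d p) q) (Ψ := innerMode d L p)
    (contDiff_const.mul (contDiff_rotatedProd (contDiff_longCos d L p) (contDiff_transSin d p)))
    (fun q => ?_) (innerModeTriple_fst d L p) (innerModeTriple_add d L p) ht
  · simpa using h
  · have hd := (contDiff_rotatedProd (contDiff_longCos d L p)
      (contDiff_transSin d p)).differentiable (by simp) q
    rw [fderiv_const_mul hd, smul_apply,
      fderiv_rotatedProd (hasDerivAt_longCos d L p) (hasDerivAt_transSin d p)]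
    simp only [innerMode, rotatedProd, smul_eq_mul]
    ring

theorem inner_innerModeTriple_sub (p : ℕ × ℕ) {t : PairL2 d L × PairL2 d L × PairL2 d L}
    (ht : t ∈ closure (pairTestTriplesIn d L (innerRect d L))) :
    inner ℂ ((innerModeTriple d L p).2.2 - (innerModeTriple d L p).2.1) (t.2.2 - t.2.1)
      = ((4 * transWave d p ^ 2 : ℝ) : ℂ) * inner ℂ (innerModeTriple d L p).1 t.1 := by
  have h := inner_lineDeriv_eq (innerRect_subset d L) (c := 4 * transWave d p ^ 2) (w := (-1, 1))
    (f := fun q => 2 * rotatedProd (longSin d L p) (transCos d p) q) (Ψ := innerMode d L p)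
    (contDiff_const.mul (contDiff_rotatedProd (contDiff_longSin d L p) (contDiff_transCos d p)))
    (fun q => ?_) (innerModeTriple_fst d L p) (innerModeTriple_sub d L p) ht
  · rw [← h]
    congr 1
    simp
    abel
  · have hd := (contDiff_rotatedProd (contDiff_longSin d L p)
      (contDiff_transCos d p)).differentiable (by simp) q
    rw [fderiv_const_mul hd, smul_apply,
      fderiv_rotatedProd (hasDerivAt_longSin d L p) (hasDerivAt_transCos d p)]
    simp only [innerMode, rotatedProd, smul_eq_mul]
    ring

theorem eq_zero_of_mul_eq_mul_conj {a b : ℝ} (hab : a ≠ b) {x y : ℂ}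
    (h1 : x = (a : ℂ) * y) (h2 : (starRingEnd ℂ) x = (b : ℂ) * (starRingEnd ℂ) y) : y = 0 := by
  have h3 := congrArg (starRingEnd ℂ) h2
  simp only [map_mul, Complex.conj_conj, Complex.conj_ofReal] at h3
  rw [h1, ← sub_eq_zero, ← sub_mul, mul_eq_zero] at h3
  rcases h3 with h3 | h3
  · exact absurd (by exact_mod_cast sub_eq_zero.1 h3) hab
  · exact h3

/-- Distinct modes differ in the longitudinal or the transversal wave number. The corresponding weak
equation, used once from each side, gives the inner product two different factors, so no sine
integral need be computed. -/
theorem inner_innerModeTriple_eq_zero (hd : 0 < d) (hL : d < L) {p q : ℕ × ℕ} (hpq : p ≠ q) :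
    inner ℂ (innerModeTriple d L p).1 (innerModeTriple d L q).1 = 0 := by
  have hp := innerModeTriple_mem hd hL p
  have hq := innerModeTriple_mem hd hL q
  have hpi := Real.pi_pos
  have hLd : 0 < L - d := by linarith
  have hsq : ∀ {a b c : ℝ}, 0 < c → 0 ≤ a → 0 ≤ b → a ≠ b → 4 * (Real.pi * (a + 1) / c) ^ 2
      ≠ 4 * (Real.pi * (b + 1) / c) ^ 2 := by
    intro a b c hc ha hb hab h
    apply hab
    have h1 : (Real.pi * (a + 1) / c) ^ 2 = (Real.pi * (b + 1) / c) ^ 2 := by linarith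
    have h2 := (pow_left_inj₀ (by positivity) (by positivity) two_ne_zero).1 h1
    have h3 := (div_left_inj' hc.ne').1 h2
    have h4 := mul_left_cancel₀ hpi.ne' h3
    linarith
  by_cases h : p.1 = q.1
  · have h2 : p.2 ≠ q.2 := fun h' => hpq (Prod.ext h h')
    refine eq_zero_of_mul_eq_mul_conj (hsq (a := p.2) (b := q.2) (c := 2 * (L - d))
      (by positivity) (by positivity) (by positivity) (by exact_mod_cast h2))
      (inner_innerModeTriple_add p hq) ?_
    rw [inner_conj_symm, inner_conj_symm]
    exact inner_innerModeTriple_add q hp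
  · refine eq_zero_of_mul_eq_mul_conj (hsq (a := p.1) (b := q.1) (c := d)
      (by positivity) (by positivity) (by positivity) (by exact_mod_cast h))
      (inner_innerModeTriple_sub p hq) ?_
    rw [inner_conj_symm, inner_conj_symm]
    exact inner_innerModeTriple_sub q hp

theorem innerModeTriple_fst_ne_zero (hd : 0 < d) (hL : d < L) (p : ℕ × ℕ) :
    (innerModeTriple d L p).1 ≠ 0 := by
  intro h
  have h1 := innerModeTriple_fst d L p
  rw [h] at h1
  have h2 : ∀ᵐ q ∂(pairMeasure d L), q ∉ innerRect d L := by
    filter_upwards [h1, Lp.coeFn_zero ℂ 2 (pairMeasure d L),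
      ae_restrict_of_ae (ae_innerMode_ne p hd hL)] with q e1 e2 e3 hq
    rw [e2, Set.indicator_of_mem hq] at e1
    exact e3 (by simpa using e1.symm)
  have h3 : volume (innerRect d L) = 0 := by
    rw [ae_iff] at h2
    simp only [not_not] at h2
    change (pairMeasure d L) (innerRect d L) = 0 at h2
    rwa [pairMeasure, Measure.restrict_apply (isCompact_innerRect d L).measurableSet,
      Set.inter_eq_left.2 (innerRect_subset d L)] at h2
  have h4 : 0 < volume (interior (innerRect d L)) := by
    refine isOpen_interior.measure_pos volume ⟨(L / 2, L / 2), ?_⟩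
    refine mem_interior_innerRect ?_ ?_ ?_
    · linarith
    · linarith
    · simpa using hd
  exact absurd (measure_mono_null interior_subset h3) h4.ne'

/-- Comparison with the inscribed rectangle. -/
theorem mem_bulkLevels_of_lt_card (hd : 0 < d) (hL : d < L) {t : ℝ} {n : ℕ} (F : Finset (ℕ × ℕ))
    (hF : ∀ p ∈ F, rectEigenvalue d (L - d) p ≤ t) (hn : n < F.card) : t ∈ bulkLevels d L n := by
  have ht : 0 ≤ t := by
    obtain ⟨p, hp⟩ := Finset.card_pos.1 (Nat.zero_lt_of_lt hn)
    refine le_trans ?_ (hF p hp)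
    unfold rectEigenvalue
    positivity
  let x : F → pairFormSpace d L := fun p =>
    ⟨WithLp.toLp 2 ![(innerModeTriple d L p).1, (innerModeTriple d L p).2.1,
      (innerModeTriple d L p).2.2],
      closure_pairTestTriplesIn_subset d L _ (innerModeTriple_mem hd hL p)⟩
  have hmem := fun p : F => innerModeTriple_mem hd hL (p : ℕ × ℕ)
  have horth0 : Pairwise fun i j : F =>
      inner ℂ (innerModeTriple d L i).1 (innerModeTriple d L j).1 = 0 := fun i j hij =>
    inner_innerModeTriple_eq_zero hd hL fun h => hij (Subtype.ext h)
  have horth1 : Pairwise fun i j : F =>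
      inner ℂ ((innerModeTriple d L i).2.1 + (innerModeTriple d L i).2.2)
        ((innerModeTriple d L j).2.1 + (innerModeTriple d L j).2.2) = 0 := fun i j hij => by
    exact (inner_innerModeTriple_add _ (hmem j)).trans (by rw [horth0 hij, mul_zero])
  have horth2 : Pairwise fun i j : F =>
      inner ℂ ((innerModeTriple d L i).2.2 - (innerModeTriple d L i).2.1)
        ((innerModeTriple d L j).2.2 - (innerModeTriple d L j).2.1) = 0 := fun i j hij => by
    exact (inner_innerModeTriple_sub _ (hmem j)).trans (by rw [horth0 hij, mul_zero])
  have e : ∀ z : PairL2 d L, (inner ℂ z z).re = ‖z‖ ^ 2 := fun z =>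
    inner_self_eq_norm_sq (𝕜 := ℂ) z
  have hn1 : ∀ i : F, ‖(innerModeTriple d L i).2.1 + (innerModeTriple d L i).2.2‖ ^ 2
      = 4 * longWave d L i ^ 2 * ‖(innerModeTriple d L i).1‖ ^ 2 := fun i => by
    rw [← e, inner_innerModeTriple_add _ (hmem i), Complex.re_ofReal_mul, e]
  have hn2 : ∀ i : F, ‖(innerModeTriple d L i).2.2 - (innerModeTriple d L i).2.1‖ ^ 2
      = 4 * transWave d i ^ 2 * ‖(innerModeTriple d L i).1‖ ^ 2 := fun i => by
    rw [← e, inner_innerModeTriple_sub _ (hmem i), Complex.re_ofReal_mul, e]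
  have hlin : LinearIndependent ℂ x := by
    refine LinearIndependent.of_comp (pairEmbedding d L).toLinearMap ?_
    exact linearIndependent_of_ne_zero_of_inner_eq_zero
      (fun i => innerModeTriple_fst_ne_zero hd hL i) horth0
  have hfd : FiniteDimensional ℂ (Submodule.span ℂ (Set.range x)) :=
    FiniteDimensional.span_of_finite ℂ (Set.finite_range x)
  refine mem_bulkLevels_of_form_le (isCompactOperator_pairEmbedding hd (hd.trans hL)) ht
    (Submodule.span ℂ (Set.range x)) (fun v hv => ?_) ?_
  · obtain ⟨c, rfl⟩ := (Submodule.mem_span_range_iff_exists_fun ℂ).1 hv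
    have hcoe : ∀ j, ((∑ i, c i • x i : pairFormSpace d L) : PairTriple d L) j
        = ∑ i, c i • (x i : PairTriple d L) j := by
      intro j
      rw [Submodule.coe_sum, WithLp.ofLp_sum, Finset.sum_apply]
      rfl
    have c0 : ((∑ i, c i • x i : pairFormSpace d L) : PairTriple d L) 0
        = ∑ i, c i • (innerModeTriple d L i).1 := hcoe 0
    have c1 : ((∑ i, c i • x i : pairFormSpace d L) : PairTriple d L) 1
        = ∑ i, c i • (innerModeTriple d L i).2.1 := hcoe 1
    have c2 : ((∑ i, c i • x i : pairFormSpace d L) : PairTriple d L) 2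
        = ∑ i, c i • (innerModeTriple d L i).2.2 := hcoe 2
    -- The modes are orthogonal in `L²`, and so are both their rotated derivatives. The energy of a
    -- combination is thus the sum over its modes, each contributing at most `t` times its squared
    -- norm.
    rw [c0, c1, c2, norm_sq_add_norm_sq_eq_half, ← Finset.sum_add_distrib,
      ← Finset.sum_sub_distrib]
    simp only [← smul_add, ← smul_sub]
    rw [norm_sq_sum_smul_of_orthogonal horth0, norm_sq_sum_smul_of_orthogonal horth1,
      norm_sq_sum_smul_of_orthogonal horth2, ← Finset.sum_add_distrib, Finset.sum_div,
      Finset.mul_sum]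
    refine Finset.sum_le_sum fun i _ => ?_
    rw [hn1, hn2]
    have h1 := hF i i.2
    rw [rectEigenvalue_eq_longWave _ hL] at h1
    have h2 : 0 ≤ ‖c i‖ ^ 2 * ‖(innerModeTriple d L i).1‖ ^ 2 := by positivity
    nlinarith [mul_le_mul_of_nonneg_right h1 h2]
  · rw [finrank_span_eq_card hlin, Fintype.card_coe]
    omega

theorem bulkLevels_nonempty (hd : 0 < d) (hL : d < L) (n : ℕ) : (bulkLevels d L n).Nonempty := by
  let F : Finset (ℕ × ℕ) := (Finset.range (n + 1)).map ⟨fun m => (0, m), fun a b h => by simpa using h⟩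
  obtain ⟨t, ht⟩ := (F.finite_toSet.image (rectEigenvalue d (L - d))).bddAbove
  refine ⟨t, mem_bulkLevels_of_lt_card hd hL F (fun p hp => ht ⟨p, hp, rfl⟩) ?_⟩
  simp [F]

theorem bulkEigenvalue_le_of_lt_card (hd : 0 < d) (hL : d < L) {t : ℝ} {n : ℕ}
    (F : Finset (ℕ × ℕ)) (hF : ∀ p ∈ F, rectEigenvalue d (L - d) p ≤ t) (hn : n < F.card) :
    bulkEigenvalue d L n ≤ t := by
  rw [bulkEigenvalue_eq]
  exact csInf_le ⟨0, fun s hs => nonneg_of_mem_bulkLevels hs⟩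
    (mem_bulkLevels_of_lt_card hd hL F hF hn)

/-! ### Comparing spectra by injections of mode labels -/

theorem finite_setOf_rectEigenvalue_le {l : ℝ} (hd : 0 < d) (hl : 0 < l) (t : ℝ) :
    {p : ℕ × ℕ | rectEigenvalue d l p ≤ t}.Finite :=
  (finite_setOf_rectEigenvalue_lt hd hl (t + 1)).subset fun p hp => by
    change rectEigenvalue d l p ≤ t at hp
    change rectEigenvalue d l p < t + 1
    linarith

/-- Distinct eigenvalues of the pair Hamiltonian dominate distinct eigenvalues of the
circumscribed rectangle. -/
theorem exists_injective_rectEigenvalue_le (hd : 0 < d) (hL : d < L) :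
    ∃ σ : ℕ → ℕ × ℕ, Function.Injective σ ∧
      ∀ n, rectEigenvalue d L (σ n) ≤ bulkEigenvalue d L n := by
  have hL0 : 0 < L := hd.trans hL
  let T : ℕ → Finset (ℕ × ℕ) := fun n =>
    (finite_setOf_rectEigenvalue_le hd hL0 (bulkEigenvalue d L n)).toFinset
  have hT : ∀ n, n < (T n).card := by
    intro n
    set E := bulkEigenvalue d L n with hE
    -- The counting lemma needs a level strictly above `E`. As the rectangle has finitely many
    -- eigenvalues below `E + 1`, some `s > E` has no eigenvalue strictly between `E` and `s`.
    obtain ⟨s, hs, hsT⟩ : ∃ s, E < s ∧ ∀ p, rectEigenvalue d L p < s → rectEigenvalue d L p ≤ E := by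
      let G := ((finite_setOf_rectEigenvalue_le hd hL0 (E + 1)).toFinset.image
        (rectEigenvalue d L)).filter (fun r => E < r)
      by_cases hG : G.Nonempty
      · refine ⟨G.min' hG, (Finset.mem_filter.1 (G.min'_mem hG)).2, fun p hp => ?_⟩
        by_contra! h
        by_cases h1 : rectEigenvalue d L p ≤ E + 1
        · have : rectEigenvalue d L p ∈ G := Finset.mem_filter.2
            ⟨Finset.mem_image.2 ⟨p, (Set.Finite.mem_toFinset _).2 h1, rfl⟩, h⟩
          exact absurd (G.min'_le _ this) (not_le.2 hp)
        · have hm := (Finset.mem_filter.1 (G.min'_mem hG)).1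
          obtain ⟨q, hq, hqe⟩ := Finset.mem_image.1 hm
          have hq' : rectEigenvalue d L q ≤ E + 1 := (Set.Finite.mem_toFinset
            (finite_setOf_rectEigenvalue_le hd hL0 (E + 1))).1 hq
          linarith
      · refine ⟨E + 1, by linarith, fun p hp => ?_⟩
        by_contra! h
        exact hG ⟨rectEigenvalue d L p, Finset.mem_filter.2
          ⟨Finset.mem_image.2 ⟨p, (Set.Finite.mem_toFinset _).2 hp.le, rfl⟩, h⟩⟩
    refine (lt_card_of_bulkEigenvalue_lt hd hL0 (bulkLevels_nonempty hd hL n) hs).trans_le ?_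
    refine Finset.card_le_card fun p hp => ?_
    have hp' : rectEigenvalue d L p < s := (Set.Finite.mem_toFinset
      (finite_setOf_rectEigenvalue_lt hd hL0 s)).1 hp
    exact (Set.Finite.mem_toFinset _).2 (hsT p hp')
  -- Hall's condition: a finite set of indices with maximum `n` has at most `n + 1` elements, and `T
  -- n` alone contains that many labels.
  obtain ⟨σ, hσ, h⟩ := (Finset.all_card_le_biUnion_card_iff_exists_injective T).1 (by
    intro s
    rcases s.eq_empty_or_nonempty with rfl | hs
    · simp
    · have h1 : s.card ≤ s.max' hs + 1 := by
        rw [← Finset.card_range (s.max' hs + 1)]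
        exact Finset.card_le_card fun n hn =>
          Finset.mem_range.2 (Nat.lt_succ_of_le (s.le_max' n hn))
      exact h1.trans ((hT _).trans_le
        (Finset.card_le_card (Finset.subset_biUnion_of_mem T (s.max'_mem hs)))))
  exact ⟨σ, hσ, fun n => (Set.Finite.mem_toFinset
    (finite_setOf_rectEigenvalue_le hd hL0 (bulkEigenvalue d L n))).1 (h n)⟩

/-- Distinct eigenvalues of the inscribed rectangle dominate distinct eigenvalues of the pair
Hamiltonian. -/
theorem exists_injective_le_rectEigenvalue (hd : 0 < d) (hL : d < L) :
    ∃ τ : ℕ × ℕ → ℕ, Function.Injective τ ∧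
      ∀ p, bulkEigenvalue d L (τ p) ≤ rectEigenvalue d (L - d) p := by
  have hl : 0 < L - d := by linarith
  let G : ℕ × ℕ → Finset (ℕ × ℕ) := fun p =>
    (finite_setOf_rectEigenvalue_le hd hl (rectEigenvalue d (L - d) p)).toFinset
  have hG : ∀ p q, q ∈ G p ↔ rectEigenvalue d (L - d) q ≤ rectEigenvalue d (L - d) p :=
    fun p q => Set.Finite.mem_toFinset _
  -- Hall's condition: a finite set of labels lies in `G p` for its member `p` of largest
  -- eigenvalue, and the range attached to `p` has the size of `G p`.
  obtain ⟨τ, hτ, h⟩ := (Finset.all_card_le_biUnion_card_iff_exists_injective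
    (fun p => Finset.range (G p).card)).1 (by
      intro s
      rcases s.eq_empty_or_nonempty with rfl | hs
      · simp
      · obtain ⟨p, hp, hmax⟩ := s.exists_max_image (rectEigenvalue d (L - d)) hs
        refine le_trans ?_ (Finset.card_le_card
          (Finset.subset_biUnion_of_mem (fun p => Finset.range (G p).card) hp))
        rw [Finset.card_range]
        exact Finset.card_le_card fun q hq => (hG p q).2 (hmax q hq))
  exact ⟨τ, hτ, fun p => bulkEigenvalue_le_of_lt_card hd hL (G p) (fun q hq => (hG p q).1 hq)
    (Finset.mem_range.1 (h p))⟩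

end

/-! ### The ideal Bose gas -/

section Gibbs

variable {ι : Type} {β μ : ℝ} {ε : ι → ℝ}

/-- The fugacity factor `exp (-β (ε - μ))` of a mode. -/
def fugacity (β μ : ℝ) (ε : ι → ℝ) (i : ι) : ℝ≥0∞ := ENNReal.ofReal (Real.exp (-β * (ε i - μ)))

theorem boltzmannWeight_add_single (ν : ι →₀ ℕ) (i : ι) (j : ℕ) :
    boltzmannWeight β μ ε (ν + Finsupp.single i j)
      = fugacity β μ ε i ^ j * boltzmannWeight β μ ε ν := by
  unfold boltzmannWeight fugacity
  rw [Finsupp.sum_add_index' (by simp) (by intro i k l; push_cast; ring),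
    Finsupp.sum_single_index (by simp), ← ENNReal.ofReal_pow (Real.exp_pos _).le,
    ← ENNReal.ofReal_mul (by positivity), ← Real.exp_nat_mul, ← Real.exp_add]
  congr 2
  ring

theorem add_single_injective (i : ι) (j : ℕ) :
    Function.Injective fun ν : ι →₀ ℕ => ν + Finsupp.single i j :=
  add_left_injective _

theorem tsum_ite_lt (n : ℕ) : ∑' j : ℕ, (if j < n then (1 : ℝ≥0∞) else 0) = n := by
  rw [tsum_eq_sum (s := Finset.range n) (by intro j hj; rw [if_neg (by simpa using hj)])]
  rw [Finset.sum_congr rfl fun j hj => if_pos (Finset.mem_range.1 hj)]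
  simp

/-- Write `ν i` as the number of `j < ν i`. The configurations with more than `j` particles in mode
`i` are those obtained by adding `j + 1` particles, which multiplies the weight by `z^(j+1)`; the
geometric series gives `z/(1 - z)`. In `ℝ≥0∞` no summability is needed. -/
theorem tsum_boltzmannWeight_mul (i : ι) :
    ∑' ν : ι →₀ ℕ, boltzmannWeight β μ ε ν * (ν i : ℝ≥0∞)
      = fugacity β μ ε i * (1 - fugacity β μ ε i)⁻¹ * ∑' ν : ι →₀ ℕ, boltzmannWeight β μ ε ν := by
  have h1 : ∀ ν : ι →₀ ℕ, boltzmannWeight β μ ε ν * (ν i : ℝ≥0∞)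
      = ∑' j : ℕ, (if j < ν i then boltzmannWeight β μ ε ν else 0) := by
    intro ν
    rw [← tsum_ite_lt (ν i), ← ENNReal.tsum_mul_left]
    simp
  have h2 : ∀ j : ℕ, ∑' ν : ι →₀ ℕ, (if j < ν i then boltzmannWeight β μ ε ν else 0)
      = fugacity β μ ε i ^ (j + 1) * ∑' ν : ι →₀ ℕ, boltzmannWeight β μ ε ν := by
    intro j
    rw [← (add_single_injective i (j + 1)).tsum_eq, ← ENNReal.tsum_mul_left]
    · refine tsum_congr fun ν => ?_
      rw [if_pos (by simp; omega), boltzmannWeight_add_single]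
    · intro ν hν
      have hj : j < ν i := by
        by_contra h
        simp [h] at hν
      refine ⟨ν - Finsupp.single i (j + 1), tsub_add_cancel_of_le ?_⟩
      exact Finsupp.single_le_iff.2 hj
  simp only [h1]
  rw [ENNReal.tsum_comm]
  simp only [h2]
  rw [ENNReal.tsum_mul_right]
  congr 1
  simp only [pow_succ']
  rw [ENNReal.tsum_mul_left, ENNReal.tsum_geometric]

/-- Adding one mode to the support contributes one geometric series, indexed by its occupation
number. -/
theorem tsum_boltzmannWeight_support_le [DecidableEq ι] (S : Finset ι) :
    ∑' ν : ι →₀ ℕ, (if ν.support ⊆ S then boltzmannWeight β μ ε ν else 0)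
      ≤ ∏ i ∈ S, (1 - fugacity β μ ε i)⁻¹ := by
  induction S using Finset.induction_on with
  | empty =>
    rw [tsum_eq_single 0]
    · simp [boltzmannWeight]
    · intro ν hν
      rw [if_neg]
      rwa [Finset.subset_empty, Finsupp.support_eq_empty]
  | insert i S hi ih =>
    have h1 : ∀ ν : ι →₀ ℕ, (if ν.support ⊆ insert i S then boltzmannWeight β μ ε ν else 0)
        = ∑' j : ℕ, (if ν i = j ∧ ν.support ⊆ insert i S then boltzmannWeight β μ ε ν else 0) := by
      intro ν
      rw [tsum_eq_single (ν i)]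
      · simp
      · intro j hj
        rw [if_neg fun h => hj h.1.symm]
    have h2 : ∀ j : ℕ, ∑' ν : ι →₀ ℕ,
        (if ν i = j ∧ ν.support ⊆ insert i S then boltzmannWeight β μ ε ν else 0)
        ≤ fugacity β μ ε i ^ j *
          ∑' ν : ι →₀ ℕ, (if ν.support ⊆ S then boltzmannWeight β μ ε ν else 0) := by
      intro j
      rw [← (add_single_injective i j).tsum_eq, ← ENNReal.tsum_mul_left]
      · refine ENNReal.tsum_le_tsum fun ν => ?_
        split_ifs with h3 h4
        · rw [boltzmannWeight_add_single]
        · exfalso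
          apply h4
          intro k hk
          have hν0 : ν i = 0 := by simpa using h3.1
          have hki : k ≠ i := by
            rintro rfl
            exact (Finsupp.mem_support_iff.1 hk) hν0
          have hk' : k ∈ (ν + Finsupp.single i j).support := by
            rw [Finsupp.mem_support_iff] at hk ⊢
            simp only [Finsupp.add_apply]
            omega
          exact Finset.mem_of_mem_insert_of_ne (h3.2 hk') hki
        · positivity
        · simp
      · intro ν hν
        have hj : ν i = j := by
          by_contra h
          simp [h] at hν
        refine ⟨ν - Finsupp.single i j, tsub_add_cancel_of_le ?_⟩
        exact Finsupp.single_le_iff.2 hj.ge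
    simp only [h1]
    rw [ENNReal.tsum_comm, Finset.prod_insert hi]
    refine (ENNReal.tsum_le_tsum h2).trans ?_
    rw [ENNReal.tsum_mul_right, ENNReal.tsum_geometric]
    gcongr

theorem bose_pos (hβ : 0 < β) {E : ℝ} (hE : μ < E) : 0 < bose β μ E := by
  unfold bose
  have : 1 < Real.exp (β * (E - μ)) := Real.one_lt_exp_iff.2 (mul_pos hβ (sub_pos.2 hE))
  exact one_div_pos.2 (by linarith)

theorem inv_one_sub_fugacity (hβ : 0 < β) {i : ι} (hi : μ < ε i) :
    (1 - fugacity β μ ε i)⁻¹ = ENNReal.ofReal (1 + bose β μ (ε i)) := by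
  have h1 : 1 < Real.exp (β * (ε i - μ)) := Real.one_lt_exp_iff.2 (mul_pos hβ (sub_pos.2 hi))
  have h0 : 0 < 1 - Real.exp (-β * (ε i - μ)) := by
    rw [neg_mul, Real.exp_neg, sub_pos]
    exact inv_lt_one_of_one_lt₀ h1
  rw [fugacity, ← ENNReal.ofReal_one, ← ENNReal.ofReal_sub _ (Real.exp_pos _).le,
    ← ENNReal.ofReal_inv_of_pos h0]
  congr 1
  rw [bose, neg_mul, Real.exp_neg]
  have h2 : Real.exp (β * (ε i - μ)) - 1 ≠ 0 := by linarith
  field_simp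
  ring

/-- Each factor `1/(1 - z_i)` of the partition function is `1 + bose`, at most `exp bose`, so the
partition function is at most the exponential of the total Bose sum. Without finiteness the quotient
in `gibbsOccupation` would lose its meaning. -/
theorem tsum_boltzmannWeight_ne_top (hβ : 0 < β) (hε : ∀ i, μ < ε i)
    (hs : Summable fun i => bose β μ (ε i)) :
    ∑' ν : ι →₀ ℕ, boltzmannWeight β μ ε ν ≠ ⊤ := by
  classical
  refine ne_top_of_le_ne_top
    (ENNReal.ofReal_ne_top (r := Real.exp (∑' i, bose β μ (ε i)))) ?_
  rw [ENNReal.tsum_eq_iSup_sum]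
  refine iSup_le fun T => ?_
  let S := T.biUnion Finsupp.support
  have hb : ∀ i, 0 ≤ bose β μ (ε i) := fun i => (bose_pos hβ (hε i)).le
  calc ∑ ν ∈ T, boltzmannWeight β μ ε ν
      = ∑ ν ∈ T, (if ν.support ⊆ S then boltzmannWeight β μ ε ν else 0) :=
        Finset.sum_congr rfl fun ν hν => by
          rw [if_pos (Finset.subset_biUnion_of_mem Finsupp.support hν)]
    _ ≤ ∑' ν : ι →₀ ℕ, (if ν.support ⊆ S then boltzmannWeight β μ ε ν else 0) :=
        ENNReal.sum_le_tsum T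
    _ ≤ ∏ i ∈ S, (1 - fugacity β μ ε i)⁻¹ := tsum_boltzmannWeight_support_le S
    _ = ENNReal.ofReal (∏ i ∈ S, (1 + bose β μ (ε i))) := by
        rw [ENNReal.ofReal_prod_of_nonneg fun i _ => by linarith [hb i]]
        exact Finset.prod_congr rfl fun i _ => inv_one_sub_fugacity hβ (hε i)
    _ ≤ ENNReal.ofReal (Real.exp (∑' i, bose β μ (ε i))) := by
        refine ENNReal.ofReal_le_ofReal ?_
        refine le_trans (Finset.prod_le_prod (fun i _ => by linarith [hb i])
          (fun i _ => (add_comm (1 : ℝ) _).le.trans (Real.add_one_le_exp (bose β μ (ε i))))) ?_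
        rw [← Real.exp_sum]
        exact Real.exp_le_exp.2 (hs.sum_le_tsum S fun i _ => hb i)

/-- The Bose–Einstein occupation numbers. -/
theorem gibbsOccupation_eq_bose (hβ : 0 < β) (hε : ∀ i, μ < ε i)
    (hs : Summable fun i => bose β μ (ε i)) (i : ι) :
    gibbsOccupation β μ ε i = bose β μ (ε i) := by
  have hZ0 : ∑' ν : ι →₀ ℕ, boltzmannWeight β μ ε ν ≠ 0 := by
    intro h
    have := ENNReal.tsum_eq_zero.1 h 0
    simp [boltzmannWeight] at this
  rw [gibbsOccupation, tsum_boltzmannWeight_mul, mul_div_assoc,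
    ENNReal.div_self hZ0 (tsum_boltzmannWeight_ne_top hβ hε hs), mul_one,
    inv_one_sub_fugacity hβ (hε i), fugacity, ENNReal.toReal_mul,
    ENNReal.toReal_ofReal (Real.exp_pos _).le,
    ENNReal.toReal_ofReal (by linarith [bose_pos hβ (hε i)]), bose, neg_mul, Real.exp_neg]
  have h1 : 1 < Real.exp (β * (ε i - μ)) :=
    Real.one_lt_exp_iff.2 (mul_pos hβ (sub_pos.2 (hε i)))
  have h2 : Real.exp (β * (ε i - μ)) - 1 ≠ 0 := by linarith
  have h3 : Real.exp (β * (ε i - μ)) ≠ 0 := by linarith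
  field_simp
  ring

end Gibbs

/-! ### Positivity of the surface Laplacian -/

theorem pathWeight_nonneg {e : ℕ → ℝ} (he : ∀ i, 0 ≤ e i) (N : ℕ) (i j : Fin N) :
    0 ≤ pathWeight e N i j := by
  unfold pathWeight
  split_ifs
  · exact he _
  · exact he _
  · exact le_rfl

/-- By symmetry of the weights, twice the quadratic form is `∑ γ_ij (x_i - x_j)²`. -/
theorem surfaceEigenvalue_nonneg {e : ℕ → ℝ} (he : ∀ i, 0 ≤ e i) (N : ℕ) (j : Fin N) :
    0 ≤ surfaceEigenvalue e N j := by
  refine Matrix.PosSemidef.eigenvalues_nonneg ?_ j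
  refine Matrix.PosSemidef.of_dotProduct_mulVec_nonneg (pathLaplacian_isHermitian e N) fun x => ?_
  have h1 : star x ⬝ᵥ (pathLaplacian e N).mulVec x
      = ∑ i, ∑ k, pathWeight e N i k * (x i * (x i - x k)) := by
    rw [pathLaplacian, Matrix.sub_mulVec, star_trivial]
    refine Finset.sum_congr rfl fun i _ => ?_
    rw [Pi.sub_apply, Matrix.mulVec_diagonal]
    simp only [Matrix.mulVec, dotProduct, Matrix.of_apply]
    rw [Finset.sum_mul, ← Finset.sum_sub_distrib, Finset.mul_sum]
    exact Finset.sum_congr rfl fun k _ => by ring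
  have h2 : ∑ i, ∑ k, pathWeight e N i k * (x i * (x i - x k))
      = ∑ i, ∑ k, pathWeight e N i k * (x k * (x k - x i)) := by
    rw [Finset.sum_comm]
    exact Finset.sum_congr rfl fun i _ => Finset.sum_congr rfl fun k _ => by
      rw [pathWeight_symm]
  have h3 : 0 ≤ ∑ i, ∑ k, pathWeight e N i k * (x i - x k) ^ 2 :=
    Finset.sum_nonneg fun i _ => Finset.sum_nonneg fun k _ =>
      mul_nonneg (pathWeight_nonneg he N i k) (sq_nonneg _)
  have h4 : ∑ i, ∑ k, pathWeight e N i k * (x i - x k) ^ 2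
      = ∑ i, ∑ k, pathWeight e N i k * (x i * (x i - x k))
        + ∑ i, ∑ k, pathWeight e N i k * (x k * (x k - x i)) := by
    simp only [← Finset.sum_add_distrib]
    exact Finset.sum_congr rfl fun i _ => Finset.sum_congr rfl fun k _ => by ring
  rw [h1]
  linarith

/-! ### Bose–Einstein sums over the bulk spectrum -/

section Bulk

variable {β μ d L : ℝ}

theorem bulkEigenvalue_zero_le (hd : 0 < d) (hL : d < L) (n : ℕ) :
    bulkEigenvalue d L 0 ≤ bulkEigenvalue d L n := by
  rw [bulkEigenvalue_eq, bulkEigenvalue_eq]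
  refine csInf_le_csInf ⟨0, fun s hs => nonneg_of_mem_bulkLevels hs⟩ (bulkLevels_nonempty hd hL n) ?_
  rintro t ⟨φ, hφ, h⟩
  exact ⟨fun _ => φ 0, hφ.comp (fun _ => 0) (fun a b _ => Fin.ext (by omega)), fun _ => h 0⟩

theorem bulkThreshold_le_rectEigenvalue (hd : 0 < d) (l : ℝ) (p : ℕ × ℕ) :
    bulkThreshold d ≤ rectEigenvalue d l p := by
  have h1 : (1 : ℝ) ≤ ((p.1 : ℝ) + 1) ^ 2 := one_le_pow₀ (by linarith [p.1.cast_nonneg (α := ℝ)])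
  have h2 : 2 * Real.pi ^ 2 / d ^ 2 * 1 ≤ 2 * Real.pi ^ 2 / d ^ 2 * ((p.1 : ℝ) + 1) ^ 2 := by gcongr
  rw [bulkThreshold, rectEigenvalue, mul_div_right_comm (2 * Real.pi ^ 2)]
  linarith [sq_nonneg (Real.pi / (Real.sqrt 2 * l) * ((p.2 : ℝ) + 1))]

theorem bulkThreshold_le_bulkEigenvalue (hd : 0 < d) (hL : d < L) (n : ℕ) :
    bulkThreshold d ≤ bulkEigenvalue d L n := by
  obtain ⟨σ, -, h⟩ := exists_injective_rectEigenvalue_le hd hL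
  exact (bulkThreshold_le_rectEigenvalue hd L _).trans (h n)

/-- A gap `δ` above the chemical potential makes the Bose function comparable to the Boltzmann
factor, which is summable over the rectangle modes. -/
theorem bose_le_exp (hβ : 0 < β) {δ E : ℝ} (hδ : 0 < δ) (hE : δ ≤ E - μ) :
    bose β μ E ≤ (1 - Real.exp (-(β * δ)))⁻¹ * Real.exp (-(β * (E - μ))) := by
  have h0 : 0 < β * δ := mul_pos hβ hδ
  have h1 : Real.exp (-(β * δ)) < 1 := Real.exp_lt_one_iff.2 (by linarith)
  have h2 : Real.exp (-(β * (E - μ))) ≤ Real.exp (-(β * δ)) :=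
    Real.exp_le_exp.2 (neg_le_neg (mul_le_mul_of_nonneg_left hE hβ.le))
  have h3 : bose β μ E = (1 - Real.exp (-(β * (E - μ))))⁻¹ * Real.exp (-(β * (E - μ))) := by
    have h4 : Real.exp (β * (E - μ)) - 1 ≠ 0 := by
      have : 1 < Real.exp (β * (E - μ)) := Real.one_lt_exp_iff.2 (mul_pos hβ (by linarith))
      linarith
    rw [bose, Real.exp_neg]
    field_simp
  rw [h3]
  gcongr

theorem bose_anti (hβ : 0 < β) {E E' : ℝ} (hE : μ < E) (h : E ≤ E') :
    bose β μ E' ≤ bose β μ E := by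
  have : 1 < Real.exp (β * (E - μ)) := Real.one_lt_exp_iff.2 (mul_pos hβ (sub_pos.2 hE))
  unfold bose
  gcongr

theorem summable_exp_neg_mul_sq {a : ℝ} (ha : 0 < a) :
    Summable fun n : ℕ => Real.exp (-(a * ((n : ℝ) + 1) ^ 2)) := by
  refine Summable.of_nonneg_of_le (fun n => (Real.exp_pos _).le) (fun n => ?_)
    (Real.summable_exp_nat_mul_iff.2 (neg_neg_of_pos ha))
  refine Real.exp_le_exp.2 ?_
  have : (n : ℝ) ≤ ((n : ℝ) + 1) ^ 2 := by nlinarith [n.cast_nonneg (α := ℝ)]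
  nlinarith

theorem summable_exp_rectEigenvalue (hβ : 0 < β) (hd : 0 < d) {l : ℝ} (hl : 0 < l) :
    Summable fun p : ℕ × ℕ => Real.exp (-(β * rectEigenvalue d l p)) := by
  have h1 := (summable_exp_neg_mul_sq
    (by positivity : 0 < β * (2 * Real.pi ^ 2 / d ^ 2))).mul_of_nonneg
    (summable_exp_neg_mul_sq (by positivity : 0 < β * (Real.pi / (Real.sqrt 2 * l)) ^ 2))
    (fun n => (Real.exp_pos _).le) (fun n => (Real.exp_pos _).le)
  refine h1.congr fun p => ?_
  rw [← Real.exp_add, rectEigenvalue]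
  congr 1
  ring

theorem summable_bose_rectEigenvalue (hβ : 0 < β) (hd : 0 < d) {l : ℝ} (hl : 0 < l)
    (hμ : μ < bulkThreshold d) : Summable fun p : ℕ × ℕ => bose β μ (rectEigenvalue d l p) := by
  have hδ : 0 < bulkThreshold d - μ := sub_pos.2 hμ
  have hp : ∀ p, bulkThreshold d - μ ≤ rectEigenvalue d l p - μ := fun p =>
    sub_le_sub_right (bulkThreshold_le_rectEigenvalue hd l p) μ
  refine Summable.of_nonneg_of_le (fun p => (bose_pos hβ (by linarith [hp p])).le)
    (fun p => bose_le_exp hβ hδ (hp p)) (Summable.mul_left _ ?_)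
  refine ((summable_exp_rectEigenvalue hβ hd hl).mul_left (Real.exp (β * μ))).congr fun p => ?_
  rw [← Real.exp_add]
  congr 1
  ring

/-- The gap is `E_0(L) - μ`. Hence `μ` may exceed the threshold `2π²/d²`, as the divergence argument
requires. -/
theorem summable_bose_bulkEigenvalue (hβ : 0 < β) (hd : 0 < d) (hL : d < L)
    (hμ : μ < bulkEigenvalue d L 0) : Summable fun n => bose β μ (bulkEigenvalue d L n) := by
  obtain ⟨σ, hσ, h⟩ := exists_injective_rectEigenvalue_le hd hL
  have hn : ∀ n, bulkEigenvalue d L 0 - μ ≤ bulkEigenvalue d L n - μ := fun n =>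
    sub_le_sub_right (bulkEigenvalue_zero_le hd hL n) μ
  refine Summable.of_nonneg_of_le (fun n => (bose_pos hβ (by linarith [hn n])).le)
    (fun n => bose_le_exp hβ (sub_pos.2 hμ) (hn n)) (Summable.mul_left _ ?_)
  refine Summable.of_nonneg_of_le (fun n => (Real.exp_pos _).le) (fun n => ?_)
    (((summable_exp_rectEigenvalue hβ hd (hd.trans hL)).comp_injective hσ).mul_left
      (Real.exp (β * μ)))
  rw [Function.comp_apply, ← Real.exp_add]
  refine Real.exp_le_exp.2 ?_
  nlinarith [h n]

/-! ### Riemann sums over the bands -/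

theorem excitedIntegrand_eq_bose (n : ℕ) (x : ℝ) :
    excitedIntegrand β d μ n x = bose β μ (2 * Real.pi ^ 2 * (n : ℝ) ^ 2 / d ^ 2 + x ^ 2) := by
  rw [excitedIntegrand, bose, ← Real.exp_add]
  congr 3
  ring

theorem bose_rectEigenvalue (l : ℝ) (p : ℕ × ℕ) :
    bose β μ (rectEigenvalue d l p)
      = excitedIntegrand β d μ (p.1 + 1) (Real.pi / (Real.sqrt 2 * l) * ((p.2 + 1 : ℕ) : ℝ)) := by
  rw [excitedIntegrand_eq_bose, rectEigenvalue]
  push_cast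
  rfl

theorem bulkThreshold_le_band (hd : 0 < d) (n : ℕ) (x : ℝ) :
    bulkThreshold d ≤ 2 * Real.pi ^ 2 * ((n + 1 : ℕ) : ℝ) ^ 2 / d ^ 2 + x ^ 2 := by
  have h1 : (1 : ℝ) ≤ ((n + 1 : ℕ) : ℝ) ^ 2 :=
    one_le_pow₀ (by push_cast; linarith [n.cast_nonneg (α := ℝ)])
  have h2 : 2 * Real.pi ^ 2 / d ^ 2 * 1 ≤ 2 * Real.pi ^ 2 / d ^ 2 * ((n + 1 : ℕ) : ℝ) ^ 2 := by
    gcongr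
  rw [bulkThreshold, mul_div_right_comm (2 * Real.pi ^ 2)]
  linarith [sq_nonneg x]

theorem excitedIntegrand_pos (hβ : 0 < β) (hd : 0 < d) (hμ : μ < bulkThreshold d) (n : ℕ) (x : ℝ) :
    0 < excitedIntegrand β d μ (n + 1) x := by
  rw [excitedIntegrand_eq_bose]
  exact bose_pos hβ (hμ.trans_le (bulkThreshold_le_band hd n x))

/-- The Gaussian majorant of the integrand of the excited density. -/
def excitedMajorant (β d : ℝ) (n : ℕ) (x : ℝ) : ℝ :=
  Real.exp (-(β * (2 * Real.pi ^ 2 / d ^ 2) * ((n : ℝ) + 1) ^ 2)) * Real.exp (-β * x ^ 2)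

theorem excitedMajorant_nonneg (n : ℕ) (x : ℝ) : 0 ≤ excitedMajorant β d n x := by
  unfold excitedMajorant
  positivity

theorem excitedIntegrand_le (hβ : 0 < β) (hd : 0 < d) {M : ℝ} (hM : M < bulkThreshold d)
    (hμ : μ ≤ M) (n : ℕ) (x : ℝ) :
    excitedIntegrand β d μ (n + 1) x
      ≤ (1 - Real.exp (-(β * (bulkThreshold d - M))))⁻¹ * Real.exp (β * μ)
        * excitedMajorant β d n x := by
  rw [excitedIntegrand_eq_bose]
  have h := bulkThreshold_le_band hd n x
  refine (bose_le_exp hβ (sub_pos.2 hM) (by linarith)).trans_eq ?_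
  rw [excitedMajorant, mul_assoc (1 - _)⁻¹, ← Real.exp_add, ← Real.exp_add]
  congr 2
  push_cast
  ring

theorem integrable_excitedMajorant (hβ : 0 < β) (n : ℕ) : Integrable (excitedMajorant β d n) :=
  (integrable_exp_neg_mul_sq hβ).const_mul _

theorem summable_integral_excitedMajorant (hβ : 0 < β) (hd : 0 < d) (s : Set ℝ) :
    Summable fun n => ∫ x in s, excitedMajorant β d n x := by
  simp only [excitedMajorant, integral_const_mul]
  exact (summable_exp_neg_mul_sq (by positivity : 0 < β * (2 * Real.pi ^ 2 / d ^ 2))).mul_right _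

theorem measurable_excitedIntegrand (n : ℕ) : Measurable (excitedIntegrand β d μ n) := by
  unfold excitedIntegrand
  fun_prop

theorem integrable_excitedIntegrand (hβ : 0 < β) (hd : 0 < d) (hμ : μ < bulkThreshold d) (n : ℕ) :
    Integrable (excitedIntegrand β d μ (n + 1)) := by
  refine ((integrable_excitedMajorant (d := d) hβ n).const_mul
    ((1 - Real.exp (-(β * (bulkThreshold d - μ))))⁻¹ * Real.exp (β * μ))).mono'
    (measurable_excitedIntegrand _).aestronglyMeasurable (ae_of_all _ fun x => ?_)
  rw [Real.norm_of_nonneg (excitedIntegrand_pos hβ hd hμ n x).le]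
  exact excitedIntegrand_le hβ hd hμ le_rfl n x

theorem integral_excitedIntegrand_le (hβ : 0 < β) (hd : 0 < d) {M : ℝ} (hM : M < bulkThreshold d)
    (hμ : μ ≤ M) (n : ℕ) (s : Set ℝ) :
    ∫ x in s, excitedIntegrand β d μ (n + 1) x
      ≤ (1 - Real.exp (-(β * (bulkThreshold d - M))))⁻¹ * Real.exp (β * μ)
        * ∫ x in s, excitedMajorant β d n x := by
  rw [← integral_const_mul]
  exact integral_mono (integrable_excitedIntegrand hβ hd (hμ.trans_lt hM) n).integrableOn
    ((integrable_excitedMajorant hβ n).const_mul _).integrableOn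
    fun x => excitedIntegrand_le hβ hd hM hμ n x

theorem summable_integral_excitedIntegrand (hβ : 0 < β) (hd : 0 < d) (hμ : μ < bulkThreshold d)
    (s : Set ℝ) : Summable fun n : ℕ => ∫ x in s, excitedIntegrand β d μ (n + 1) x :=
  Summable.of_nonneg_of_le
    (fun n => integral_nonneg fun x => (excitedIntegrand_pos hβ hd hμ n x).le)
    (fun n => integral_excitedIntegrand_le hβ hd hμ le_rfl n s)
    ((summable_integral_excitedMajorant hβ hd s).mul_left _)

theorem antitoneOn_excitedIntegrand (hβ : 0 < β) (hd : 0 < d) (hμ : μ < bulkThreshold d) (n : ℕ) :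
    AntitoneOn (excitedIntegrand β d μ (n + 1)) (Set.Ici 0) := by
  intro x hx y _ hxy
  rw [excitedIntegrand_eq_bose, excitedIntegrand_eq_bose]
  refine bose_anti hβ (hμ.trans_le (bulkThreshold_le_band hd n x)) ?_
  have : 0 ≤ x := hx
  gcongr

/-- The excited density restricted to longitudinal momenta above `h`, up to normalisation. -/
def excitedTail (β d μ h : ℝ) : ℝ :=
  ∑' n : ℕ, ∫ x in Set.Ioi h, excitedIntegrand β d μ (n + 1) x

/-- In each band the longitudinal momenta are `h, 2h, 3h, …`, and a decreasing function summed at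
these points is at most `h⁻¹` times its integral over `(0, ∞)`. -/
theorem tsum_bose_rectEigenvalue_le (hβ : 0 < β) (hd : 0 < d) {l : ℝ} (hl : 0 < l)
    (hμ : μ < bulkThreshold d) :
    ∑' p : ℕ × ℕ, bose β μ (rectEigenvalue d l p)
      ≤ (Real.pi / (Real.sqrt 2 * l))⁻¹ * excitedTail β d μ 0 := by
  have hs := summable_bose_rectEigenvalue hβ hd hl hμ
  set h := Real.pi / (Real.sqrt 2 * l) with hh
  have h0 : 0 < h := by positivity
  rw [hs.tsum_prod, excitedTail, ← tsum_mul_left]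
  refine Summable.tsum_le_tsum (fun n => ?_) hs.prod
    ((summable_integral_excitedIntegrand hβ hd hμ _).mul_left _)
  have hi := integrable_excitedIntegrand hβ hd hμ n
  have h1 := AntitoneOn.tsum_add_one_le_integral
    (f := fun t => excitedIntegrand β d μ (n + 1) (h * t))
    (fun x hx y hy hxy => antitoneOn_excitedIntegrand hβ hd hμ n
      (mul_nonneg h0.le hx) (mul_nonneg h0.le hy) (mul_le_mul_of_nonneg_left hxy h0.le))
    (hi.comp_mul_left' h0.ne').integrableOn (fun t _ => (excitedIntegrand_pos hβ hd hμ n _).le)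
  rw [integral_comp_mul_left_Ioi _ _ h0, mul_zero] at h1
  simp only [bose_rectEigenvalue]
  exact h1

/-- The same sum is at least `h⁻¹` times the integral from its first node `h`; this missing initial
interval is the reason for the lower limit in `excitedTail`. -/
theorem le_tsum_bose_rectEigenvalue (hβ : 0 < β) (hd : 0 < d) {l : ℝ} (hl : 0 < l)
    (hμ : μ < bulkThreshold d) :
    (Real.pi / (Real.sqrt 2 * l))⁻¹ * excitedTail β d μ (Real.pi / (Real.sqrt 2 * l))
      ≤ ∑' p : ℕ × ℕ, bose β μ (rectEigenvalue d l p) := by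
  have hs := summable_bose_rectEigenvalue hβ hd hl hμ
  have h0 : 0 < Real.pi / (Real.sqrt 2 * l) := by positivity
  rw [hs.tsum_prod, excitedTail, ← tsum_mul_left]
  refine Summable.tsum_le_tsum (fun n => ?_)
    ((summable_integral_excitedIntegrand hβ hd hμ _).mul_left _) hs.prod
  have h2 := hs.prod_factor n
  simp only [bose_rectEigenvalue] at h2 ⊢
  set h := Real.pi / (Real.sqrt 2 * l) with hh
  have h1 := AntitoneOn.integral_le_tsum_comp_add
    (f := fun t => excitedIntegrand β d μ (n + 1) (h * t)) 1
    (fun x hx y hy hxy => antitoneOn_excitedIntegrand hβ hd hμ n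
      (mul_nonneg h0.le (by simp at hx; linarith)) (mul_nonneg h0.le (by simp at hy; linarith))
      (mul_le_mul_of_nonneg_left hxy h0.le))
    ((summable_nat_add_iff 1).1 h2)
    (fun t _ => (excitedIntegrand_pos hβ hd hμ n _).le)
  rw [integral_comp_mul_left_Ioi _ _ h0, Nat.cast_one, mul_one] at h1
  exact h1

theorem tsum_bose_bulkEigenvalue_le (hβ : 0 < β) (hd : 0 < d) (hL : d < L)
    (hμ : μ < bulkThreshold d) :
    ∑' n, bose β μ (bulkEigenvalue d L n) ≤ Real.sqrt 2 * L / Real.pi * excitedTail β d μ 0 := by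
  obtain ⟨σ, hσ, h⟩ := exists_injective_rectEigenvalue_le hd hL
  have h1 := tsum_bose_rectEigenvalue_le hβ hd (hd.trans hL) hμ
  rw [inv_div] at h1
  refine le_trans ?_ h1
  exact Summable.tsum_le_tsum_of_inj σ hσ
    (fun p _ => (bose_pos hβ (hμ.trans_le (bulkThreshold_le_rectEigenvalue hd L p))).le)
    (fun n => bose_anti hβ (hμ.trans_le (bulkThreshold_le_rectEigenvalue hd L _)) (h n))
    (summable_bose_bulkEigenvalue hβ hd hL (hμ.trans_le (bulkThreshold_le_bulkEigenvalue hd hL 0)))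
    (summable_bose_rectEigenvalue hβ hd (hd.trans hL) hμ)

theorem le_tsum_bose_bulkEigenvalue (hβ : 0 < β) (hd : 0 < d) (hL : d < L)
    (hμ : μ < bulkThreshold d) :
    Real.sqrt 2 * (L - d) / Real.pi * excitedTail β d μ (Real.pi / (Real.sqrt 2 * (L - d)))
      ≤ ∑' n, bose β μ (bulkEigenvalue d L n) := by
  obtain ⟨τ, hτ, h⟩ := exists_injective_le_rectEigenvalue hd hL
  have h1 := le_tsum_bose_rectEigenvalue hβ hd (sub_pos.2 hL) hμ
  rw [inv_div] at h1
  refine h1.trans ?_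
  exact Summable.tsum_le_tsum_of_inj τ hτ
    (fun n _ => (bose_pos hβ (hμ.trans_le (bulkThreshold_le_bulkEigenvalue hd hL n))).le)
    (fun p => bose_anti hβ (hμ.trans_le (bulkThreshold_le_bulkEigenvalue hd hL _)) (h p))
    (summable_bose_rectEigenvalue hβ hd (sub_pos.2 hL) hμ)
    (summable_bose_bulkEigenvalue hβ hd hL (hμ.trans_le (bulkThreshold_le_bulkEigenvalue hd hL 0)))

theorem continuous_excitedIntegrand_chemicalPotential (hβ : 0 < β) (hd : 0 < d)
    (hμ : μ < bulkThreshold d) (n : ℕ) (x : ℝ) :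
    ContinuousAt (fun ν => excitedIntegrand β d ν (n + 1) x) μ := by
  have h := (excitedIntegrand_pos hβ hd hμ n x).ne'
  unfold excitedIntegrand at h ⊢
  have h' := (div_ne_zero_iff.1 h).2
  exact ContinuousAt.div (by fun_prop) (by fun_prop) h'

theorem tendsto_excitedTail (hβ : 0 < β) (hd : 0 < d) (hμ : μ < bulkThreshold d)
    {m h : ℕ → ℝ} (hm : Tendsto m atTop (𝓝 μ)) (hh : Tendsto h atTop (𝓝 0))
    (hh0 : ∀ᶠ k in atTop, 0 ≤ h k) :
    Tendsto (fun k => excitedTail β d (m k) (h k)) atTop (𝓝 (excitedTail β d μ 0)) := by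
  -- A fixed `M` between `μ` and the threshold gives Gaussian majorants independent of `k`, for the
  -- integrals as well as for the sum over bands.
  obtain ⟨M, hμM, hM⟩ := exists_between hμ
  have hmM : ∀ᶠ k in atTop, m k ≤ M := (hm.eventually_lt_const hμM).mono fun k hk => hk.le
  set K := (1 - Real.exp (-(β * (bulkThreshold d - M))))⁻¹ * Real.exp (β * M) with hK
  have hinv : 0 ≤ (1 - Real.exp (-(β * (bulkThreshold d - M))))⁻¹ := by
    have : Real.exp (-(β * (bulkThreshold d - M))) < 1 :=
      Real.exp_lt_one_iff.2 (neg_neg_of_pos (mul_pos hβ (sub_pos.2 hM)))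
    exact inv_nonneg.2 (by linarith)
  have hle : ∀ ν ≤ M, ∀ n x, excitedIntegrand β d ν (n + 1) x ≤ K * excitedMajorant β d n x := by
    intro ν hν n x
    refine (excitedIntegrand_le hβ hd hM hν n x).trans ?_
    have := excitedMajorant_nonneg (β := β) (d := d) n x
    rw [hK]
    gcongr
  refine tendsto_tsum_of_dominated_convergence
    (bound := fun n => K * ∫ x in Set.Ioi (0 : ℝ), excitedMajorant β d n x)
    ((summable_integral_excitedMajorant hβ hd _).mul_left _) (fun n => ?_) ?_
  · have h1 : ∀ᶠ k in atTop, ∫ x in Set.Ioi (0 : ℝ), (Set.Ioi (h k)).indicator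
          (excitedIntegrand β d (m k) (n + 1)) x
        = ∫ x in Set.Ioi (h k), excitedIntegrand β d (m k) (n + 1) x := by
      filter_upwards [hh0] with k hk
      rw [setIntegral_indicator measurableSet_Ioi, Set.Ioi_inter_Ioi, max_eq_right hk]
    refine Tendsto.congr' h1 ?_
    refine tendsto_integral_filter_of_dominated_convergence
      (fun x => K * excitedMajorant β d n x) ?_ ?_ ?_ ?_
    · exact Eventually.of_forall fun k =>
        ((measurable_excitedIntegrand _).indicator measurableSet_Ioi).aestronglyMeasurable
    · filter_upwards [hmM] with k hk
      refine ae_of_all _ fun x => ?_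
      refine (norm_indicator_le_norm_self _ x).trans ?_
      rw [Real.norm_of_nonneg (excitedIntegrand_pos hβ hd (hk.trans_lt hM) n x).le]
      exact hle _ hk n x
    · exact ((integrable_excitedMajorant hβ n).const_mul _).integrableOn
    · refine (ae_restrict_iff' measurableSet_Ioi).2 (ae_of_all _ fun x hx => ?_)
      refine Tendsto.congr' ?_
        ((continuous_excitedIntegrand_chemicalPotential hβ hd hμ n x).tendsto.comp hm)
      filter_upwards [hh.eventually_lt_const hx] with k hk
      rw [Set.indicator_of_mem (Set.mem_Ioi.2 hk)]
      rfl
  · filter_upwards [hmM, hh0] with k hk hk0 n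
    have hpos := fun x => (excitedIntegrand_pos hβ hd (hk.trans_lt hM) n x).le
    rw [Real.norm_of_nonneg (integral_nonneg hpos), ← integral_const_mul]
    calc ∫ x in Set.Ioi (h k), excitedIntegrand β d (m k) (n + 1) x
        ≤ ∫ x in Set.Ioi (0 : ℝ), excitedIntegrand β d (m k) (n + 1) x :=
          setIntegral_mono_set (integrable_excitedIntegrand hβ hd (hk.trans_lt hM) n).integrableOn
            (ae_of_all _ hpos) (Set.Ioi_subset_Ioi hk0).eventuallyLE
      _ ≤ _ := integral_mono (integrable_excitedIntegrand hβ hd (hk.trans_lt hM) n).integrableOn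
          ((integrable_excitedMajorant hβ n).const_mul _).integrableOn (hle _ hk n)

theorem tendsto_excitedTail_atBot (hβ : 0 < β) (hd : 0 < d) {m : ℕ → ℝ}
    (hm : Tendsto m atTop atBot) :
    Tendsto (fun k => excitedTail β d (m k) 0) atTop (𝓝 0) := by
  have hthr : 0 < bulkThreshold d := by unfold bulkThreshold; positivity
  have h1 : Tendsto (fun k => (1 - Real.exp (-(β * (bulkThreshold d - 0))))⁻¹ * Real.exp (β * m k)
      * ∑' n, ∫ x in Set.Ioi (0 : ℝ), excitedMajorant β d n x) atTop (𝓝 0) := by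
    have h2 : Tendsto (fun k => Real.exp (β * m k)) atTop (𝓝 0) :=
      Real.tendsto_exp_atBot.comp (hm.const_mul_atBot hβ)
    simpa using (h2.const_mul _).mul_const _
  refine tendsto_of_tendsto_of_tendsto_of_le_of_le' tendsto_const_nhds h1 ?_ ?_
  · filter_upwards [hm.eventually_le_atBot 0] with k hk
    exact tsum_nonneg fun n =>
      integral_nonneg fun x => (excitedIntegrand_pos hβ hd (hk.trans_lt hthr) n x).le
  · filter_upwards [hm.eventually_le_atBot 0] with k hk
    rw [excitedTail, ← tsum_mul_left]
    exact Summable.tsum_le_tsum (fun n => integral_excitedIntegrand_le hβ hd hthr hk n _)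
      (summable_integral_excitedIntegrand hβ hd (hk.trans_lt hthr) _)
      ((summable_integral_excitedMajorant hβ hd _).mul_left _)

theorem excitedDensity_eq : excitedDensity β d μ = Real.sqrt 2 / Real.pi * excitedTail β d μ 0 :=
  rfl

/-- Below the threshold the bulk pair density converges to the excited density. -/
theorem tendsto_bulkDensity (hβ : 0 < β) (hd : 0 < d) (hμ : μ < bulkThreshold d)
    {l m : ℕ → ℝ} (hl : Tendsto l atTop atTop) (hm : Tendsto m atTop (𝓝 μ)) :
    Tendsto (fun k => 1 / l k * ∑' n, bose β (m k) (bulkEigenvalue d (l k) n)) atTop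
      (𝓝 (excitedDensity β d μ)) := by
  have hld : Tendsto (fun k => l k - d) atTop atTop := tendsto_atTop_add_const_right _ (-d) hl
  have hh : Tendsto (fun k => Real.pi / (Real.sqrt 2 * (l k - d))) atTop (𝓝 0) :=
    tendsto_const_nhds.div_atTop (hld.const_mul_atTop (by positivity))
  have hh0 : ∀ᶠ k in atTop, 0 ≤ Real.pi / (Real.sqrt 2 * (l k - d)) := by
    filter_upwards [hld.eventually_ge_atTop 0] with k hk
    positivity
  have hup := (tendsto_excitedTail hβ hd hμ hm tendsto_const_nhds
    (Eventually.of_forall fun _ => le_rfl)).const_mul (Real.sqrt 2 / Real.pi)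
  have hlow := (tendsto_excitedTail hβ hd hμ hm hh hh0).const_mul (Real.sqrt 2 / Real.pi)
  have hratio : Tendsto (fun k => 1 - d / l k) atTop (𝓝 1) := by
    simpa using tendsto_const_nhds.sub (tendsto_const_nhds.div_atTop hl (a := d))
  have hlow' := hratio.mul hlow
  rw [one_mul, ← excitedDensity_eq] at hlow'
  rw [← excitedDensity_eq] at hup
  refine tendsto_of_tendsto_of_tendsto_of_le_of_le' hlow' hup ?_ ?_
  · filter_upwards [hl.eventually_gt_atTop d, hm.eventually_lt_const hμ] with k hk hmk
    have hk0 : 0 < l k := hd.trans hk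
    have h1 := mul_le_mul_of_nonneg_left (le_tsum_bose_bulkEigenvalue hβ hd hk hmk)
      (one_div_pos.2 hk0).le
    refine le_trans (le_of_eq ?_) h1
    field_simp
  · filter_upwards [hl.eventually_gt_atTop d, hm.eventually_lt_const hμ] with k hk hmk
    have hk0 : 0 < l k := hd.trans hk
    have h1 := mul_le_mul_of_nonneg_left (tsum_bose_bulkEigenvalue_le hβ hd hk hmk)
      (one_div_pos.2 hk0).le
    refine h1.trans (le_of_eq ?_)
    field_simp

theorem tendsto_bulkDensity_atBot (hβ : 0 < β) (hd : 0 < d)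
    {l m : ℕ → ℝ} (hl : Tendsto l atTop atTop) (hm : Tendsto m atTop atBot) :
    Tendsto (fun k => 1 / l k * ∑' n, bose β (m k) (bulkEigenvalue d (l k) n)) atTop (𝓝 0) := by
  have hup := (tendsto_excitedTail_atBot hβ hd hm).const_mul (Real.sqrt 2 / Real.pi)
  rw [mul_zero] at hup
  refine tendsto_of_tendsto_of_tendsto_of_le_of_le' tendsto_const_nhds hup ?_ ?_
  · filter_upwards [hl.eventually_gt_atTop d, hm.eventually_lt_atBot (bulkThreshold d)] with k hk hmk
    have hk0 : 0 < l k := hd.trans hk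
    exact mul_nonneg (one_div_pos.2 hk0).le (tsum_nonneg fun n =>
      (bose_pos hβ (hmk.trans_le (bulkThreshold_le_bulkEigenvalue hd hk n))).le)
  · filter_upwards [hl.eventually_gt_atTop d, hm.eventually_lt_atBot (bulkThreshold d)] with k hk hmk
    have hk0 : 0 < l k := hd.trans hk
    have h1 := mul_le_mul_of_nonneg_left (tsum_bose_bulkEigenvalue_le hβ hd hk hmk)
      (one_div_pos.2 hk0).le
    refine h1.trans (le_of_eq ?_)
    field_simp

/-! ### Divergence at the threshold -/

/-- Near the threshold the lowest band alone contributes a large number of pairs. -/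
theorem le_tsum_bose_of_near_threshold (hβ : 0 < β) (hd : 0 < d) (hL : d < L)
    (hμ : μ < bulkEigenvalue d L 0) {s : ℝ} (hs : 0 < s) (hs1 : 2 * β * s ^ 2 ≤ 1)
    (hμs : bulkThreshold d - s ^ 2 ≤ μ) :
    (s * (L - d) / Real.pi - 1) * (1 / (4 * β * s ^ 2))
      ≤ ∑' n, bose β μ (bulkEigenvalue d L n) := by
  obtain ⟨τ, hτ, h⟩ := exists_injective_le_rectEigenvalue hd hL
  have hl : 0 < L - d := sub_pos.2 hL
  have hE : ∀ n, μ < bulkEigenvalue d L n := fun n => hμ.trans_le (bulkEigenvalue_zero_le hd hL n)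
  -- The lowest-band modes `m < M` have longitudinal momentum at most `s`, even after dropping the
  -- helpful factor `√2`. Their energies exceed `μ` by at most `2 s²`.
  set M := ⌊s * (L - d) / Real.pi⌋₊ with hM
  have hM' : s * (L - d) / Real.pi - 1 ≤ M := (Nat.sub_one_lt_floor _).le
  let ι : ℕ → ℕ := fun m => τ (0, m)
  have hι : Function.Injective ι := fun a b hab => by simpa using hτ hab
  have h1 : ∀ m ∈ Finset.range M, 1 / (4 * β * s ^ 2) ≤ bose β μ (bulkEigenvalue d L (ι m)) := by
    intro m hm
    have hm1 : ((m : ℝ) + 1) ≤ s * (L - d) / Real.pi := by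
      have : m + 1 ≤ M := Finset.mem_range.1 hm
      exact_mod_cast (Nat.le_floor_iff (by positivity)).1 this
    have hw : Real.pi / (Real.sqrt 2 * (L - d)) * ((m : ℝ) + 1) ≤ s := by
      have hsq : (1 : ℝ) ≤ Real.sqrt 2 := Real.one_le_sqrt.2 (by norm_num)
      rw [le_div_iff₀ Real.pi_pos] at hm1
      rw [div_mul_eq_mul_div, div_le_iff₀ (by positivity)]
      nlinarith [mul_pos hs hl]
    have hw2 : (Real.pi / (Real.sqrt 2 * (L - d)) * ((m : ℝ) + 1)) ^ 2 ≤ s ^ 2 := by gcongr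
    have h3 := h (0, m)
    simp only [rectEigenvalue] at h3
    have hband : 2 * Real.pi ^ 2 * (((0 : ℕ) : ℝ) + 1) ^ 2 / d ^ 2 = bulkThreshold d := by
      simp [bulkThreshold]
    rw [hband] at h3
    have h4 : bulkEigenvalue d L (ι m) - μ ≤ 2 * s ^ 2 := by
      change bulkEigenvalue d L (τ (0, m)) - μ ≤ 2 * s ^ 2
      linarith
    have h5 : 0 < β * (bulkEigenvalue d L (ι m) - μ) := mul_pos hβ (sub_pos.2 (hE _))
    have h6 : β * (bulkEigenvalue d L (ι m) - μ) ≤ 2 * β * s ^ 2 := by nlinarith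
    -- `e^x - 1 ≤ 2x` for `0 < x ≤ 1`, with `x ≤ 2βs²`.
    have h7 : Real.exp (β * (bulkEigenvalue d L (ι m) - μ)) - 1 ≤ 4 * β * s ^ 2 := by
      have h8 := Real.abs_exp_sub_one_le
        (x := β * (bulkEigenvalue d L (ι m) - μ)) (by rw [abs_of_pos h5]; linarith)
      rw [abs_of_pos h5] at h8
      linarith [le_abs_self (Real.exp (β * (bulkEigenvalue d L (ι m) - μ)) - 1)]
    unfold bose
    exact one_div_le_one_div_of_le (by linarith [Real.add_one_lt_exp h5.ne']) h7
  calc (s * (L - d) / Real.pi - 1) * (1 / (4 * β * s ^ 2))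
      ≤ M * (1 / (4 * β * s ^ 2)) := by gcongr
    _ ≤ ∑ m ∈ Finset.range M, bose β μ (bulkEigenvalue d L (ι m)) := by
        simpa using Finset.card_nsmul_le_sum (Finset.range M) _ _ h1
    _ = ∑ n ∈ (Finset.range M).map ⟨ι, hι⟩, bose β μ (bulkEigenvalue d L n) := by
        rw [Finset.sum_map]
        rfl
    _ ≤ ∑' n, bose β μ (bulkEigenvalue d L n) :=
        (summable_bose_bulkEigenvalue hβ hd hL hμ).sum_le_tsum _
          fun n _ => (bose_pos hβ (hE n)).le

/-- At the threshold the bulk pair density diverges: there is no finite critical density. -/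
theorem tendsto_bulkDensity_atTop (hβ : 0 < β) (hd : 0 < d)
    {l m : ℕ → ℝ} (hl : Tendsto l atTop atTop) (hm : Tendsto m atTop (𝓝 (bulkThreshold d)))
    (hml : ∀ k, m k < bulkEigenvalue d (l k) 0) :
    Tendsto (fun k => 1 / l k * ∑' n, bose β (m k) (bulkEigenvalue d (l k) n)) atTop atTop := by
  refine tendsto_atTop.2 fun A => ?_
  have hπ := Real.pi_pos
  -- About `sL` modes with occupation of order `1/s²` give a density of order `1/s`, unbounded as `s
  -- → 0`.
  obtain ⟨s, hs, hs1, hs2⟩ : ∃ s : ℝ, 0 < s ∧ 2 * β * s ^ 2 ≤ 1 ∧ A ≤ 1 / (16 * Real.pi * β * s) := by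
    have h1 : Tendsto (fun s : ℝ => 2 * β * s ^ 2) (𝓝[>] 0) (𝓝 0) := by
      have : Continuous fun s : ℝ => 2 * β * s ^ 2 := by fun_prop
      simpa using (this.tendsto 0).mono_left nhdsWithin_le_nhds
    have h2 : Tendsto (fun s : ℝ => 1 / (16 * Real.pi * β * s)) (𝓝[>] 0) atTop := by
      have h3 := tendsto_inv_nhdsGT_zero (𝕜 := ℝ)
      refine (h3.const_mul_atTop (by positivity : 0 < 1 / (16 * Real.pi * β))).congr fun s => ?_
      rw [one_div, one_div, mul_inv _ s]
    obtain ⟨s, hs, h3, h4⟩ := (eventually_mem_nhdsWithin.and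
      ((h1.eventually_lt_const one_pos).and (h2.eventually_ge_atTop A))).exists
    exact ⟨s, hs, h3.le, h4⟩
  have hm' := hm.eventually_const_lt (show bulkThreshold d - s ^ 2 < bulkThreshold d by
    linarith [pow_pos hs 2])
  filter_upwards [hm', hl.eventually_ge_atTop (2 * d + 4 * Real.pi / s)] with k hk hlk
  have hps : 0 < 4 * Real.pi / s := by positivity
  have hLd : d < l k := by linarith
  have hl0 : 0 < l k := hd.trans hLd
  refine hs2.trans ?_
  have h1 := mul_le_mul_of_nonneg_left
    (le_tsum_bose_of_near_threshold hβ hd hLd (hml k) hs hs1 hk.le) (one_div_pos.2 hl0).le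
  refine le_trans ?_ h1
  -- The choice of `l k` ensures `l k - d ≥ l k / 2` and `s * l k ≥ 4π`, so subtracting `1` costs at
  -- most half of `s * l k / (2π)`.
  have h2 : s * l k / (4 * Real.pi) ≤ s * (l k - d) / Real.pi - 1 := by
    have h3 : 4 * Real.pi ≤ s * l k := by
      have : 4 * Real.pi / s ≤ l k := by linarith
      rwa [div_le_iff₀' hs] at this
    rw [div_le_iff₀ (by positivity), sub_mul, div_mul_eq_mul_div, le_sub_iff_add_le,
      le_div_iff₀ hπ]
    nlinarith [mul_pos hs hl0, mul_nonneg hs.le (by linarith : 0 ≤ l k - 2 * d)]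
  calc 1 / (16 * Real.pi * β * s) = 1 / l k * (s * l k / (4 * Real.pi) * (1 / (4 * β * s ^ 2))) := by
        field_simp
        norm_num
    _ ≤ _ := by gcongr

end Bulk

/-! ### The thermodynamic limit -/

theorem surfaceNumber_nonneg {β μ α lam ρs : ℝ} (hβ : 0 < β) {e : ℕ → ℝ} (he : ∀ i, 0 ≤ e i)
    (N : ℕ) (hμ : μ < lam * ρs - α) : 0 ≤ surfaceNumber β μ α lam ρs e N :=
  Finset.sum_nonneg fun j _ => (bose_pos hβ (by linarith [surfaceEigenvalue_nonneg he N j])).le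

theorem bulkOccupation_eq_bose {β μ d L α lam ρs : ℝ} (hβ : 0 < β) (hd : 0 < d) (hL : d < L)
    {e : ℕ → ℝ} (he : ∀ i, 0 ≤ e i) (N : ℕ)
    (hμ : μ < min (lam * ρs - α) (bulkEigenvalue d L 0)) (n : ℕ) :
    bulkOccupation β μ d L α lam ρs e N n = bose β μ (bulkEigenvalue d L n) := by
  obtain ⟨h1, h2⟩ := lt_min_iff.1 hμ
  refine gibbsOccupation_eq_bose hβ ?_ ?_ (Sum.inr n)
  · rintro (j | m)
    · change μ < surfaceEigenvalue e N j - α + lam * ρs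
      linarith [surfaceEigenvalue_nonneg he N j]
    · exact h2.trans_le (bulkEigenvalue_zero_le hd hL m)
  · exact Summable.sum (fun i => bose β μ (modeEnergy d L α lam ρs e N i)) (Summable.of_finite)
      (summable_bose_bulkEigenvalue hβ hd hL h2)

/-- All bulk energies lie above the threshold, so with `μ_k ≤ M` the ground state occupation is
bounded by a constant: there is no condensation in the bulk. -/
theorem tendsto_groundDensity {β d M : ℝ} (hβ : 0 < β) (hd : 0 < d) (hM : M < bulkThreshold d)
    {l m : ℕ → ℝ} (hl : Tendsto l atTop atTop) (hm : ∀ᶠ k in atTop, m k ≤ M) :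
    Tendsto (fun k => bose β (m k) (bulkEigenvalue d (l k) 0) / l k) atTop (𝓝 0) := by
  have h1 : Tendsto (fun k => bose β M (bulkThreshold d) / l k) atTop (𝓝 0) :=
    tendsto_const_nhds.div_atTop hl
  refine tendsto_of_tendsto_of_tendsto_of_le_of_le' tendsto_const_nhds h1 ?_ ?_
  · filter_upwards [hm, hl.eventually_gt_atTop d] with k hk hlk
    have hE := bulkThreshold_le_bulkEigenvalue hd hlk 0
    exact div_nonneg (bose_pos hβ (by linarith)).le (hd.trans hlk).le
  · filter_upwards [hm, hl.eventually_gt_atTop d] with k hk hlk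
    have hE := bulkThreshold_le_bulkEigenvalue hd hlk 0
    have hl0 : 0 < l k := hd.trans hlk
    have h2 : 1 < Real.exp (β * (bulkThreshold d - M)) :=
      Real.one_lt_exp_iff.2 (mul_pos hβ (sub_pos.2 hM))
    unfold bose
    gcongr

/-- If the bulk pair density converges while the chemical potential stays below the threshold,
the limit is carried by the excited states. -/
theorem tendsto_densities {β d α lam ρ M r : ℝ} (hβ : 0 < β) (hd : 0 < d)
    {e : ℕ → ℝ} (he : ∀ i, 0 ≤ e i) {N : ℝ → ℕ} {L μ ρs : ℕ → ℝ}
    (hLpos : ∀ k, 0 < L k) (hL : Tendsto L atTop atTop)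
    (hLN : ∃ C : ℝ, ∀ k, L k ≤ C * N (L k))
    (hμ : ∀ k, μ k < min (lam * ρs k - α) (bulkEigenvalue d (L k) 0))
    (hself : ∀ k, ρs k = 1 / (N (L k) : ℝ) * surfaceNumber β (μ k) α lam (ρs k) e (N (L k)))
    (hdens : Tendsto (fun k => 1 / L k *
        (surfaceNumber β (μ k) α lam (ρs k) e (N (L k))
          + ∑' n : ℕ, bose β (μ k) (bulkEigenvalue d (L k) n)))
      atTop (𝓝 ρ))
    (hM : M < bulkThreshold d) (hμM : ∀ᶠ k in atTop, μ k ≤ M)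
    (hbulk : Tendsto (fun k => 1 / L k * ∑' n, bose β (μ k) (bulkEigenvalue d (L k) n)) atTop
      (𝓝 r)) :
    Tendsto (fun k => (N (L k) : ℝ) / L k * ρs k
        + bulkOccupation β (μ k) d (L k) α lam (ρs k) e (N (L k)) 0 / L k) atTop (𝓝 (ρ - r)) ∧
    Tendsto (fun k => 1 / L k *
        ∑' n : ℕ, bulkOccupation β (μ k) d (L k) α lam (ρs k) e (N (L k)) (n + 1)) atTop (𝓝 r) := by
  have hground := tendsto_groundDensity hβ hd hM hL hμM
  have hev : ∀ᶠ k in atTop, ∀ n, bulkOccupation β (μ k) d (L k) α lam (ρs k) e (N (L k)) n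
      = bose β (μ k) (bulkEigenvalue d (L k) n) := by
    filter_upwards [hL.eventually_gt_atTop d] with k hk
    exact bulkOccupation_eq_bose hβ hd hk he (N (L k)) (hμ k)
  constructor
  · have h := (hdens.sub hbulk).add hground
    rw [add_zero] at h
    refine h.congr' ?_
    filter_upwards [hev] with k hk
    -- The bound on `L/n(L)` in the form `L ≤ C * N` excludes `N = 0`, for which the division in the
    -- self-consistency equation would be void.
    have hN : (N (L k) : ℝ) ≠ 0 := by
      obtain ⟨C, hC⟩ := hLN
      intro h0
      have := hC k
      rw [h0, mul_zero] at this
      linarith [hLpos k]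
    have hs : (N (L k) : ℝ) * ρs k = surfaceNumber β (μ k) α lam (ρs k) e (N (L k)) := by
      conv_lhs => rw [hself k]
      field_simp
    rw [hk 0, div_mul_eq_mul_div ((N (L k) : ℕ) : ℝ), hs]
    ring
  · have h := hbulk.sub hground
    rw [sub_zero] at h
    refine h.congr' ?_
    filter_upwards [hev, hL.eventually_gt_atTop d] with k hk hLk
    have hsum := summable_bose_bulkEigenvalue hβ hd hLk (lt_min_iff.1 (hμ k)).2
    simp only [hk]
    rw [hsum.tsum_eq_zero_add]
    ring

/-- The surface contribution is nonnegative, so a diverging bulk density would make the total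
diverge, contrary to its finite limit `ρ`. -/
theorem not_tendsto_bulkThreshold {β d α lam ρ : ℝ} (hβ : 0 < β) (hd : 0 < d)
    {e : ℕ → ℝ} (he : ∀ i, 0 ≤ e i) {N : ℝ → ℕ} {L μ ρs : ℕ → ℝ}
    (hLpos : ∀ k, 0 < L k) (hL : Tendsto L atTop atTop)
    (hμ : ∀ k, μ k < min (lam * ρs k - α) (bulkEigenvalue d (L k) 0))
    (hdens : Tendsto (fun k => 1 / L k *
        (surfaceNumber β (μ k) α lam (ρs k) e (N (L k))
          + ∑' n : ℕ, bose β (μ k) (bulkEigenvalue d (L k) n)))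
      atTop (𝓝 ρ)) : ¬ Tendsto μ atTop (𝓝 (bulkThreshold d)) := by
  intro h
  refine not_tendsto_nhds_of_tendsto_atTop ?_ ρ hdens
  refine tendsto_atTop_mono (fun k => ?_)
    (tendsto_bulkDensity_atTop hβ hd hL h fun k => (lt_min_iff.1 (hμ k)).2)
  refine mul_le_mul_of_nonneg_left ?_ (one_div_pos.2 (hLpos k)).le
  linarith [surfaceNumber_nonneg hβ he (N (L k)) (lt_min_iff.1 (hμ k)).1]

end ElectronPairs
end

/-! ### The main theorem -/

open ElectronPairs in
theorem mainTheorem3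
    (β d α lam ρ : ℝ) (hβ : 0 < β) (hd : 0 < d) (hα : 0 ≤ α) (hlam : 0 < lam) (hρ : 0 < ρ)
    (e : ℕ → ℝ) (he : ∀ i, 0 ≤ e i)
    (N : ℝ → ℕ)
    (L μ ρs : ℕ → ℝ)
    (hLpos : ∀ k, 0 < L k) (hL : Tendsto L atTop atTop)
    (hLN : ∃ C : ℝ, ∀ k, L k ≤ C * N (L k))
    (hρs : ∀ k, 0 ≤ ρs k)
    (hμ : ∀ k, μ k < min (lam * ρs k - α) (bulkEigenvalue d (L k) 0))
    (hself : ∀ k, ρs k = 1 / (N (L k) : ℝ) * surfaceNumber β (μ k) α lam (ρs k) e (N (L k)))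
    (hdens : Tendsto (fun k => 1 / L k *
        (surfaceNumber β (μ k) α lam (ρs k) e (N (L k))
          + ∑' n : ℕ, bose β (μ k) (bulkEigenvalue d (L k) n)))
      atTop (𝓝 ρ)) :
    (∀ μlim : ℝ, μlim ≤ bulkThreshold d → Tendsto μ atTop (𝓝 μlim) →
      (∀ n : ℕ, 1 ≤ n → IntegrableOn (excitedIntegrand β d μlim n) (Set.Ioi 0)) ∧
      Summable (fun n : ℕ => ∫ x in Set.Ioi (0 : ℝ), excitedIntegrand β d μlim (n + 1) x) ∧
      Tendsto (fun k => (N (L k) : ℝ) / L k * ρs k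
          + bulkOccupation β (μ k) d (L k) α lam (ρs k) e (N (L k)) 0 / L k)
        atTop (𝓝 (ρ - excitedDensity β d μlim)) ∧
      Tendsto (fun k => 1 / L k *
          ∑' n : ℕ, bulkOccupation β (μ k) d (L k) α lam (ρs k) e (N (L k)) (n + 1))
        atTop (𝓝 (excitedDensity β d μlim))) ∧
    (Tendsto μ atTop atBot →
      Tendsto (fun k => (N (L k) : ℝ) / L k * ρs k
          + bulkOccupation β (μ k) d (L k) α lam (ρs k) e (N (L k)) 0 / L k)
        atTop (𝓝 ρ) ∧
      Tendsto (fun k => 1 / L k *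
          ∑' n : ℕ, bulkOccupation β (μ k) d (L k) α lam (ρs k) e (N (L k)) (n + 1))
        atTop (𝓝 0)) := by
  refine ⟨fun μlim hle hlim => ?_, fun hbot => ?_⟩
  · have hlt : μlim < bulkThreshold d := by
      refine lt_of_le_of_ne hle ?_
      rintro rfl
      exact not_tendsto_bulkThreshold hβ hd he hLpos hL hμ hdens hlim
    obtain ⟨M, hM1, hM2⟩ := exists_between hlt
    refine ⟨fun n hn => ?_, summable_integral_excitedIntegrand hβ hd hlt _,
      tendsto_densities hβ hd he hLpos hL hLN hμ hself hdens hM2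
        ((hlim.eventually_lt_const hM1).mono fun k hk => hk.le)
        (tendsto_bulkDensity hβ hd hlt hL hlim)⟩
    obtain ⟨n, rfl⟩ := Nat.exists_eq_add_of_le' hn
    exact (integrable_excitedIntegrand hβ hd hlt n).integrableOn
  · obtain ⟨M, hM⟩ := exists_lt (bulkThreshold d)
    have h := tendsto_densities hβ hd he hLpos hL hLN hμ hself hdens hM
      (hbot.eventually_le_atBot M) (tendsto_bulkDensity_atBot hβ hd hL hbot)
    rwa [sub_zero] at h
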